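/- **Setting.** Let $n-r\ge 2$, $r\ge 1$, let $\mathbb R^{n+2}_{r+1}$ be $\mathbb R^{n+2}$ with $\langle x,x\rangle=\sum_{i\le n-r+1}x_i^2-\sum_{i>n-r+1}x_i^2$, and let $Q^n_r=\{[x]: x\ne 0,\ \langle x,x\rangle=0\}$ be its projective light cone. Everything is smooth. Let $y:M\to Q^n_r$ be a timelike surface ($M$ a 2-manifold; the conformal structure induced by $y$ is Lorentzian). *Asymptotic coordinates* $(u,v)$ are null coordinates of $y$, with *canonical lift* $Y$ (so $[Y]=y$) satisfying $\langle dY,dY\rangle=\frac{\sigma}{2}(du\otimes dv+dv\otimes du)$, $\sigma=\pm1$. The usual orientation of the coordinates is $\sigma=1$, and coordinates of $y$ are always taken with $\sigma=1$. Let $V=\mathrm{Span}\{Y,Y_u,Y_v,Y_{uv}\}$, let $D$ be the connection on $V^\perp$ given by orthogonal projection of the derivative, and let $\kappa_1,\kappa_2$ be the $V^\perp$-components of $Y_{uu},Y_{vv}$. The conformal metric is the quadratic form $g=\sigma\langle\kappa_1,\kappa_2\rangle\,du\,dv$, and the Willmore functional of a closed surface is $W=\frac12\int_M g$, where $du\,dv$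 is integrated as the area element of the coordinates $(u,v)$ (so $W(y)=\frac12\int_M\langle\kappa_1,\kappa_2\rangle\,du\,dv$). The surface is $(\pm)$-*isothermic* if around each point there are asymptotic coordinates, called *adapted*, with $\kappa_1=\varepsilon\kappa_2$, $\varepsilon=\pm1$. For $c\neq0$, a timelike surface $x$ in the quadric (space form) $\{\langle x,x\rangle=c\}\subset\mathbb R^{n+2}_{r+1}$ is $(\pm)$-isothermic if around each point there are null coordinates (adapted coordinates), with induced metric $\sigma e^{2\omega}du\,dv$, in which the components $\Omega_1,\Omega_2$ of $x_{uu},x_{vv}$ normal to the surface satisfy $\Omega_1=\varepsilon\Omega_2$. Its mean curvature vector $H$ is the normal component of $x_{uv}/\langle x_u,x_v\rangle$. A *parallel minimal section* is a nowhere vanishing (possibly lightlike) normal field that is parallel for the normal connection and orthogonal to $H$. The conformal metric and Willmore functional of $x$ are those of $[(x,1)]$ in the projective light cone of $\mathbb R^{n+2}_{r+1}\oplus\mathbb R$ with the product $\langle x,x'\rangle-c\,tt'$. A *$c$-polar transform* of $y$ is a section $\psi:M\to\mathbb R^{n+2}_{r+1}$ of $V^\perp$ with $D\psi=0$ and $\langle\psi,\psi\rangle=c$.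 For $c\ne0$ it is regarded as a map into the quadric $\{\langle x,x\rangle=c\}$. For $c=0$ it is regarded, where $\psi\neq 0$, as the map $[\psi]$ into $Q^n_r$. **Theorem.** Let $y:M\to Q^n_r$ be a timelike $(\pm)$-isothermic surface, $\kappa_1=\varepsilon\kappa_2$ with $\varepsilon=\pm1$, and let $\psi$ be a $c$-polar transform of $y$. (i) Suppose $\langle\psi,\kappa_1\rangle\ne0$ on an open dense subset $M_0\subset M$ (for adapted coordinates of $y$). Then on $M_0$ the surface $\psi$ (respectively $[\psi]$ if $c=0$) is a timelike $(\pm)$-isothermic surface with the same sign $\varepsilon$. Every adapted coordinate system $(u,v)$ of $y$ on an open subset of $M_0$ is adapted for $\psi$, with metric or conformal structure of sign $\sigma=\varepsilon$ in these coordinates. Moreover, on the domain of each such coordinate system, with canonical lift $Y$, the map $Y^\psi=Y/\langle\psi,\kappa_1\rangle$ is a lift of $y$ dual to $\psi$, that is, $Y^\psi_u$ is a nonzero multiple of $\psi_v$ and $Y^\psi_v$ is a nonzero multiple of $\psi_u$ at each point. If $c\ne0$, then $Y^\psi$ is a parallel minimal section of $\psi$, so $\psi$ is locally a generalized $H$-surface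 with a lightlike parallel minimal section. If $c=0$, then $Y^\psi$ is a parallel section of the conformal normal bundle of $[\psi]$. (ii) Under the hypothesis of (i), in each such adapted coordinate system of $y$ the conformal metric of $\psi$ is $$g^\psi=\Big(\langle\kappa_1,\kappa_2\rangle+\Big(\frac{\langle\psi,D_u\kappa_1\rangle}{\langle\psi,\kappa_1\rangle}\Big)_v\Big)\,du\,dv .$$ Furthermore, if $M$ is closed and $\psi$ (respectively $[\psi]$ if $c=0$; in that case $\psi$ is nowhere zero) is an immersion on all of $M$, then $W(\psi)=W(y)$, where $W(\psi)=\frac12\int_M g^\psi$ is integrated in the same asymptotic coordinates $(u,v)$ as $W(y)$, i.e. in coordinates of sign $\sigma=\varepsilon$ for $\psi$. -/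

import Mathlib

open scoped Manifold ContDiff

noncomputable section

namespace TimelikeSurface

/-- The pseudo-Euclidean product of `ℝ^m_s`: the first `m - s` coordinates count positively, the
last `s` negatively. -/
def pseudoForm (m s : ℕ) : LinearMap.BilinForm ℝ (Fin m → ℝ) :=
  LinearMap.mk₂ ℝ (fun x y => ∑ i : Fin m, (if (i : ℕ) + s < m then (1 : ℝ) else -1) * (x i * y i))
    (by intro x x' y; rw [← Finset.sum_add_distrib]
        exact Finset.sum_congr rfl fun i _ => by simp only [Pi.add_apply]; ring)
    (by intro a x y; rw [smul_eq_mul, Finset.mul_sum]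
        exact Finset.sum_congr rfl fun i _ => by simp only [Pi.smul_apply, smul_eq_mul]; ring)
    (by intro x y y'; rw [← Finset.sum_add_distrib]
        exact Finset.sum_congr rfl fun i _ => by simp only [Pi.add_apply]; ring)
    (by intro a x y; rw [smul_eq_mul, Finset.mul_sum]
        exact Finset.sum_congr rfl fun i _ => by simp only [Pi.smul_apply, smul_eq_mul]; ring)

section Linear

variable {E : Type*} [AddCommGroup E] [Module ℝ E]

/-- The product `⟨x, x'⟩ - c t t'` on `E × ℝ`. If `⟨x, x⟩ = c` then `(x, 1)` is a null vector of it;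
for `c ≠ 0` the map `x ↦ [(x, 1)]` is the conformal embedding of the space form `⟨x, x⟩ = c` into
the projective light cone with one more dimension. -/
def coneForm (B : LinearMap.BilinForm ℝ E) (c : ℝ) : LinearMap.BilinForm ℝ (E × ℝ) :=
  LinearMap.mk₂ ℝ (fun x y => B x.1 y.1 - c * (x.2 * y.2))
    (by intro x x' y; simp only [Prod.fst_add, Prod.snd_add, map_add, LinearMap.add_apply]; ring)
    (by intro a x y
        simp only [Prod.smul_fst, Prod.smul_snd, map_smul, LinearMap.smul_apply, smul_eq_mul]; ring)
    (by intro x y y'; simp only [Prod.fst_add, Prod.snd_add, map_add]; ring)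
    (by intro a x y; simp only [Prod.smul_fst, Prod.smul_snd, map_smul, smul_eq_mul]; ring)

open Classical in
/-- The component of `w` in `V^⊥` with respect to the splitting `V ⊕ V^⊥` (which exists and is
unique whenever `B` is nondegenerate on the finite-dimensional `V`; otherwise a default value). -/
def normalPart (B : LinearMap.BilinForm ℝ E) (V : Submodule ℝ E) (w : E) : E :=
  if h : ∃ k, k ∈ B.orthogonal V ∧ w - k ∈ V then h.choose else w

theorem normalPart_eq (B : LinearMap.BilinForm ℝ E) (V : Submodule ℝ E)
    (hV : V ⊓ B.orthogonal V = ⊥) {w k : E} (hk : k ∈ B.orthogonal V) (hw : w - k ∈ V) :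
    normalPart B V w = k := by
  have h : ∃ k, k ∈ B.orthogonal V ∧ w - k ∈ V := ⟨k, hk, hw⟩
  have h1 := h.choose_spec
  rw [normalPart, dif_pos h]
  have h2 : h.choose - k ∈ V ⊓ B.orthogonal V := by
    refine ⟨?_, Submodule.sub_mem _ h1.1 hk⟩
    have := V.sub_mem hw h1.2
    rwa [sub_sub_sub_cancel_left] at this
  rw [hV, Submodule.mem_bot] at h2
  exact sub_eq_zero.mp h2

/-- The projective light cone: all `[x]` with `x ≠ 0` and `⟨x, x⟩ = 0`. -/
def projCone (B : LinearMap.BilinForm ℝ E) : Set (Projectivization ℝ E) :=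
  {q | B q.rep q.rep = 0}

/-- The point `[x]`, with a default value for `x = 0`. -/
def proj [Nontrivial E] (x : E) : Projectivization ℝ E :=
  open Classical in if h : x ≠ 0 then Projectivization.mk ℝ x h else Classical.arbitrary _

end Linear

section Surface

variable {M : Type*} [TopologicalSpace M]
variable {E : Type*} [NormedAddCommGroup E] [NormedSpace ℝ E]

/-- Partial derivative `F_u` in the coordinates `φ = (u, v)`. -/
def du (φ : OpenPartialHomeomorph M (ℝ × ℝ)) (F : M → E) (p : M) : E :=
  fderiv ℝ (F ∘ φ.symm) (φ p) (1, 0)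

/-- Partial derivative `F_v` in the coordinates `φ = (u, v)`. -/
def dv (φ : OpenPartialHomeomorph M (ℝ × ℝ)) (F : M → E) (p : M) : E :=
  fderiv ℝ (F ∘ φ.symm) (φ p) (0, 1)

/-- `Y` is a lift of `y` over `U`. -/
def IsLiftOn (y : M → Projectivization ℝ E) (Y : M → E) (U : Set M) : Prop :=
  ∀ p ∈ U, ∃ h : Y p ≠ 0, Projectivization.mk ℝ (Y p) h = y p

/-- The conformal tangent space `Span {Y, Y_u, Y_v, Y_uv}`. -/
def confTangent (φ : OpenPartialHomeomorph M (ℝ × ℝ)) (Y : M → E) (p : M) : Submodule ℝ E :=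
  Submodule.span ℝ {Y p, du φ Y p, dv φ Y p, du φ (dv φ Y) p}

/-- `D_u F`: the part of `F_u` in the conformal normal bundle. -/
def confDu (B : LinearMap.BilinForm ℝ E) (φ : OpenPartialHomeomorph M (ℝ × ℝ))
    (Y F : M → E) (p : M) : E :=
  normalPart B (confTangent φ Y p) (du φ F p)

/-- `D_v F`: the part of `F_v` in the conformal normal bundle. -/
def confDv (B : LinearMap.BilinForm ℝ E) (φ : OpenPartialHomeomorph M (ℝ × ℝ))
    (Y F : M → E) (p : M) : E :=
  normalPart B (confTangent φ Y p) (dv φ F p)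

/-- The conformal Hopf differential `κ₁`, the normal part of `Y_uu`. -/
def kappa1 (B : LinearMap.BilinForm ℝ E) (φ : OpenPartialHomeomorph M (ℝ × ℝ))
    (Y : M → E) (p : M) : E :=
  normalPart B (confTangent φ Y p) (du φ (du φ Y) p)

/-- The conformal Hopf differential `κ₂`, the normal part of `Y_vv`. -/
def kappa2 (B : LinearMap.BilinForm ℝ E) (φ : OpenPartialHomeomorph M (ℝ × ℝ))
    (Y : M → E) (p : M) : E :=
  normalPart B (confTangent φ Y p) (dv φ (dv φ Y) p)

/-- Span of position and tangent plane of a surface `x` in a space form `⟨x, x⟩ = c`, `c ≠ 0`; its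
orthogonal complement is the normal space of the surface in the space form. -/
def quadTangent (φ : OpenPartialHomeomorph M (ℝ × ℝ)) (x : M → E) (p : M) : Submodule ℝ E :=
  Submodule.span ℝ {x p, du φ x p, dv φ x p}

/-- The Hopf differential `Ω₁`, the normal part of `x_uu`. -/
def omega1 (B : LinearMap.BilinForm ℝ E) (φ : OpenPartialHomeomorph M (ℝ × ℝ))
    (x : M → E) (p : M) : E :=
  normalPart B (quadTangent φ x p) (du φ (du φ x) p)

/-- The Hopf differential `Ω₂`, the normal part of `x_vv`. -/
def omega2 (B : LinearMap.BilinForm ℝ E) (φ : OpenPartialHomeomorph M (ℝ × ℝ))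
    (x : M → E) (p : M) : E :=
  normalPart B (quadTangent φ x p) (dv φ (dv φ x) p)

/-- The mean curvature vector in null coordinates: `⟨x_u, x_v⟩ H` is the normal part of `x_uv`. -/
def meanCurvature (B : LinearMap.BilinForm ℝ E) (φ : OpenPartialHomeomorph M (ℝ × ℝ))
    (x : M → E) (p : M) : E :=
  (B (du φ x p) (dv φ x p))⁻¹ • normalPart B (quadTangent φ x p) (du φ (dv φ x) p)

variable [ChartedSpace (ℝ × ℝ) M]

/-- The form induced by `F` on the tangent plane at `p` is Lorentzian: a quadratic form on a plane
has signature `(1, 1)` exactly if it takes both signs. -/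
def IsLorentzianAt (B : LinearMap.BilinForm ℝ E) (F : M → E) (p : M) : Prop :=
  ∃ X X' : TangentSpace 𝓘(ℝ, ℝ × ℝ) p,
    0 < B (mfderiv 𝓘(ℝ, ℝ × ℝ) 𝓘(ℝ, E) F p X) (mfderiv 𝓘(ℝ, ℝ × ℝ) 𝓘(ℝ, E) F p X) ∧
    B (mfderiv 𝓘(ℝ, ℝ × ℝ) 𝓘(ℝ, E) F p X') (mfderiv 𝓘(ℝ, ℝ × ℝ) 𝓘(ℝ, E) F p X') < 0

/-- `y` is a (smooth) timelike surface in the projective light cone over the open set `U`. -/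
def IsTimelikeOn (B : LinearMap.BilinForm ℝ E) (y : M → Projectivization ℝ E) (U : Set M) : Prop :=
  ∀ p ∈ U, y p ∈ projCone B ∧
    ∃ (W : Set M) (Y : M → E), IsOpen W ∧ p ∈ W ∧ W ⊆ U ∧
      ContMDiffOn 𝓘(ℝ, ℝ × ℝ) 𝓘(ℝ, E) ∞ Y W ∧ IsLiftOn y Y W ∧ IsLorentzianAt B Y p

/-- `φ = (u, v)` is an asymptotic (null) coordinate system for `y`, in which the induced conformal
structure is that of `σ du dv` (`σ = ±1`), and `Y` is a canonical lift:
`⟨dY, dY⟩ = σ (du ⊗ dv + dv ⊗ du) / 2`. The usual orientation of the coordinates is `σ = 1`. -/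
structure IsCanonicalLift (B : LinearMap.BilinForm ℝ E) (σ : ℝ)
    (φ : OpenPartialHomeomorph M (ℝ × ℝ)) (y : M → Projectivization ℝ E) (Y : M → E) : Prop where
  chart : φ ∈ IsManifold.maximalAtlas 𝓘(ℝ, ℝ × ℝ) ∞ M
  smooth : ContMDiffOn 𝓘(ℝ, ℝ × ℝ) 𝓘(ℝ, E) ∞ Y φ.source
  lift : IsLiftOn y Y φ.source
  null : ∀ p ∈ φ.source, B (Y p) (Y p) = 0
  uu : ∀ p ∈ φ.source, B (du φ Y p) (du φ Y p) = 0
  vv : ∀ p ∈ φ.source, B (dv φ Y p) (dv φ Y p) = 0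
  uv : ∀ p ∈ φ.source, B (du φ Y p) (dv φ Y p) = σ / 2

/-- `φ` is an asymptotic coordinate system with canonical lift `Y` and `κ₁ = ε κ₂`. -/
def IsAdaptedLift (B : LinearMap.BilinForm ℝ E) (σ ε : ℝ)
    (φ : OpenPartialHomeomorph M (ℝ × ℝ)) (y : M → Projectivization ℝ E) (Y : M → E) : Prop :=
  IsCanonicalLift B σ φ y Y ∧ ∀ p ∈ φ.source, kappa1 B φ Y p = ε • kappa2 B φ Y p

/-- `y` is a timelike `(±)`-isothermic surface (`ε = ±1`) over the open set `U`. -/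
def IsIsothermicOn (B : LinearMap.BilinForm ℝ E) (ε : ℝ) (y : M → Projectivization ℝ E)
    (U : Set M) : Prop :=
  IsTimelikeOn B y U ∧
    ∀ p ∈ U, ∃ (φ : OpenPartialHomeomorph M (ℝ × ℝ)) (Y : M → E),
      p ∈ φ.source ∧ φ.source ⊆ U ∧ IsAdaptedLift B 1 ε φ y Y

/-- `x` is a (smooth) timelike surface in the space form `⟨x, x⟩ = c` over the open set `U`. -/
def IsQuadTimelikeOn (B : LinearMap.BilinForm ℝ E) (c : ℝ) (x : M → E) (U : Set M) : Prop :=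
  ContMDiffOn 𝓘(ℝ, ℝ × ℝ) 𝓘(ℝ, E) ∞ x U ∧
    ∀ p ∈ U, B (x p) (x p) = c ∧ IsLorentzianAt B x p

/-- `φ = (u, v)` is an adapted asymptotic coordinate system of the surface `x` in a space form: the
induced metric is `σ e^{2ω} du dv` (`σ = ±1`) and `Ω₁ = ε Ω₂`. -/
structure IsQuadAdapted (B : LinearMap.BilinForm ℝ E) (σ ε : ℝ)
    (φ : OpenPartialHomeomorph M (ℝ × ℝ)) (x : M → E) : Prop where
  chart : φ ∈ IsManifold.maximalAtlas 𝓘(ℝ, ℝ × ℝ) ∞ M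
  uu : ∀ p ∈ φ.source, B (du φ x p) (du φ x p) = 0
  vv : ∀ p ∈ φ.source, B (dv φ x p) (dv φ x p) = 0
  uv : ∀ p ∈ φ.source, 0 < σ * B (du φ x p) (dv φ x p)
  hopf : ∀ p ∈ φ.source, omega1 B φ x p = ε • omega2 B φ x p

/-- `x` is a timelike `(±)`-isothermic surface (`ε = ±1`) in `⟨x, x⟩ = c` over `U`. -/
def IsQuadIsothermicOn (B : LinearMap.BilinForm ℝ E) (c ε : ℝ) (x : M → E) (U : Set M) : Prop :=
  IsQuadTimelikeOn B c x U ∧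
    ∀ p ∈ U, ∃ φ : OpenPartialHomeomorph M (ℝ × ℝ),
      p ∈ φ.source ∧ φ.source ⊆ U ∧ IsQuadAdapted B 1 ε φ x

/-- `N` is a parallel minimal section along the surface `x` in a space form, over an asymptotic
chart: a nowhere zero normal field with `D N = 0` and `⟨N, H⟩ = 0`. -/
structure IsParallelMinimalSection (B : LinearMap.BilinForm ℝ E)
    (φ : OpenPartialHomeomorph M (ℝ × ℝ)) (x N : M → E) : Prop where
  smooth : ContMDiffOn 𝓘(ℝ, ℝ × ℝ) 𝓘(ℝ, E) ∞ N φ.source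
  ne_zero : ∀ p ∈ φ.source, N p ≠ 0
  normal : ∀ p ∈ φ.source, N p ∈ B.orthogonal (quadTangent φ x p)
  parallel_u : ∀ p ∈ φ.source, normalPart B (quadTangent φ x p) (du φ N p) = 0
  parallel_v : ∀ p ∈ φ.source, normalPart B (quadTangent φ x p) (dv φ N p) = 0
  minimal : ∀ p ∈ φ.source, B (N p) (meanCurvature B φ x p) = 0

/-- `ψ` is a `c`-polar transform of `y`: a parallel section of the conformal normal bundle with
`⟨ψ, ψ⟩ = c`. -/
structure IsPolarTransform (B : LinearMap.BilinForm ℝ E) (c : ℝ)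
    (y : M → Projectivization ℝ E) (ψ : M → E) : Prop where
  smooth : ContMDiff 𝓘(ℝ, ℝ × ℝ) 𝓘(ℝ, E) ∞ ψ
  length : ∀ p, B (ψ p) (ψ p) = c
  normal : ∀ (φ : OpenPartialHomeomorph M (ℝ × ℝ)) (Y : M → E), IsCanonicalLift B 1 φ y Y →
    ∀ p ∈ φ.source, ψ p ∈ B.orthogonal (confTangent φ Y p)
  parallel : ∀ (φ : OpenPartialHomeomorph M (ℝ × ℝ)) (Y : M → E), IsCanonicalLift B 1 φ y Y →
    ∀ p ∈ φ.source, confDu B φ Y ψ p = 0 ∧ confDv B φ Y ψ p = 0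

/-- The coefficient of `du dv` in the conformal metric, for a canonical lift `Y` in coordinates of
sign `σ`; it is `⟨κ₁, κ₂⟩` for `σ = 1`, and the sign `σ` makes the quadratic form `g = (⋯) du dv`
independent of the orientation of the coordinates. -/
def metricCoeff (B : LinearMap.BilinForm ℝ E) (σ : ℝ) (φ : OpenPartialHomeomorph M (ℝ × ℝ))
    (Y : M → E) (p : M) : ℝ :=
  σ * B (kappa1 B φ Y p) (kappa2 B φ Y p)

/-- In the asymptotic coordinates `φ = (u, v)` of sign `σ`, the conformal metric of `y` is
`g du dv`. -/
def HasConformalMetric (B : LinearMap.BilinForm ℝ E) (σ : ℝ)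
    (φ : OpenPartialHomeomorph M (ℝ × ℝ)) (y : M → Projectivization ℝ E) (g : M → ℝ) : Prop :=
  (∃ Y, IsCanonicalLift B σ φ y Y) ∧
    ∀ Y, IsCanonicalLift B σ φ y Y → ∀ p ∈ φ.source, metricCoeff B σ φ Y p = g p

/-- A finite smooth partition of unity subordinate to asymptotic charts of sign `σ`, together with
canonical lifts over these charts. -/
structure AsymptoticPartition (B : LinearMap.BilinForm ℝ E) (σ : ℝ)
    (y : M → Projectivization ℝ E) where
  k : ℕ
  φ : Fin k → OpenPartialHomeomorph M (ℝ × ℝ)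
  Y : Fin k → M → E
  canonical : ∀ i, IsCanonicalLift B σ (φ i) y (Y i)
  ρ : Fin k → M → ℝ
  smooth : ∀ i, ContMDiff 𝓘(ℝ, ℝ × ℝ) 𝓘(ℝ, ℝ) ∞ (ρ i)
  nonneg : ∀ i p, 0 ≤ ρ i p
  subordinate : ∀ i, tsupport (ρ i) ⊆ (φ i).source
  sum_eq_one : ∀ p, ∑ i, ρ i p = 1

/-- `½ ∫_M g`, computed with a partition of unity. -/
def AsymptoticPartition.energy {B : LinearMap.BilinForm ℝ E} {σ : ℝ}
    {y : M → Projectivization ℝ E} (P : AsymptoticPartition B σ y) : ℝ :=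
  (1 / 2) * ∑ i, ∫ x in (P.φ i).target,
    P.ρ i ((P.φ i).symm x) * metricCoeff B σ (P.φ i) (P.Y i) ((P.φ i).symm x)

/-- On a closed surface, the Willmore functional `½ ∫_M g` exists and equals `w`, where
`g = (⋯) du dv` is integrated with respect to the area `du dv` of the asymptotic coordinates of
sign `σ` of the surface. -/
def HasWillmore (B : LinearMap.BilinForm ℝ E) (σ : ℝ) (y : M → Projectivization ℝ E)
    (w : ℝ) : Prop :=
  Nonempty (AsymptoticPartition B σ y) ∧ ∀ P : AsymptoticPartition B σ y, P.energy = w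

/-- The polar surface is globally immersed: `ψ` itself for `c ≠ 0`, and `[ψ]` for `c = 0`. -/
def IsPolarImmersed (c : ℝ) (ψ : M → E) : Prop :=
  (c ≠ 0 → ∀ p, Function.Injective (mfderiv 𝓘(ℝ, ℝ × ℝ) 𝓘(ℝ, E) ψ p)) ∧
  (c = 0 → ∀ p, ψ p ≠ 0 ∧ ∀ X : TangentSpace 𝓘(ℝ, ℝ × ℝ) p,
    mfderiv 𝓘(ℝ, ℝ × ℝ) 𝓘(ℝ, E) ψ p X ∈ (Submodule.span ℝ {ψ p} : Submodule ℝ E) → X = 0)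

end Surface

end TimelikeSurface

end

set_option linter.unusedSectionVars false

noncomputable section

namespace TimelikeSurface

section Calculus

variable {M : Type*} [TopologicalSpace M]
variable {E : Type*} [NormedAddCommGroup E] [NormedSpace ℝ E]
variable {E' : Type*} [NormedAddCommGroup E'] [NormedSpace ℝ E']

/-- `F` is smooth in the coordinates `φ`. -/
def SmoothIn (φ : OpenPartialHomeomorph M (ℝ × ℝ)) (F : M → E) : Prop :=
  ContDiffOn ℝ ∞ (F ∘ φ.symm) φ.target

/-- Directional derivative in the coordinates `φ`. -/
def dirDeriv (φ : OpenPartialHomeomorph M (ℝ × ℝ)) (w : ℝ × ℝ) (F : M → E) (p : M) : E :=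
  fderiv ℝ (F ∘ φ.symm) (φ p) w

variable {φ : OpenPartialHomeomorph M (ℝ × ℝ)} {p : M}

theorem du_eq_dirDeriv (F : M → E) : du φ F = dirDeriv φ (1, 0) F := rfl

theorem dv_eq_dirDeriv (F : M → E) : dv φ F = dirDeriv φ (0, 1) F := rfl

theorem SmoothIn.contDiffAt {F : M → E} (hF : SmoothIn φ F) (hp : p ∈ φ.source) :
    ContDiffAt ℝ ∞ (F ∘ φ.symm) (φ p) :=
  ContDiffOn.contDiffAt hF (φ.open_target.mem_nhds (φ.map_source hp))

theorem SmoothIn.differentiableAt {F : M → E} (hF : SmoothIn φ F) (hp : p ∈ φ.source) :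
    DifferentiableAt ℝ (F ∘ φ.symm) (φ p) :=
  (hF.contDiffAt hp).differentiableAt (by simp)

theorem SmoothIn.congr {F G : M → E} (hF : SmoothIn φ F) (h : ∀ q ∈ φ.source, G q = F q) :
    SmoothIn φ G :=
  ContDiffOn.congr hF fun _ hx => h _ (φ.map_target hx)

theorem dirDeriv_congr {F G : M → E} (h : ∀ q ∈ φ.source, F q = G q) (hp : p ∈ φ.source)
    (w : ℝ × ℝ) : dirDeriv φ w F p = dirDeriv φ w G p := by
  unfold dirDeriv
  rw [Filter.EventuallyEq.fderiv_eq]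
  filter_upwards [φ.open_target.mem_nhds (φ.map_source hp)] with x hx
  exact h _ (φ.map_target hx)

theorem du_congr {F G : M → E} (h : ∀ q ∈ φ.source, F q = G q) (hp : p ∈ φ.source) :
    du φ F p = du φ G p := dirDeriv_congr h hp _

theorem dv_congr {F G : M → E} (h : ∀ q ∈ φ.source, F q = G q) (hp : p ∈ φ.source) :
    dv φ F p = dv φ G p := dirDeriv_congr h hp _

theorem SmoothIn.const (e : E) : SmoothIn φ fun _ => e := contDiffOn_const

theorem SmoothIn.add {F G : M → E} (hF : SmoothIn φ F) (hG : SmoothIn φ G) :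
    SmoothIn φ fun q => F q + G q := ContDiffOn.add hF hG

theorem SmoothIn.sub {F G : M → E} (hF : SmoothIn φ F) (hG : SmoothIn φ G) :
    SmoothIn φ fun q => F q - G q := ContDiffOn.sub hF hG

theorem SmoothIn.smul {f : M → ℝ} {F : M → E} (hf : SmoothIn φ f) (hF : SmoothIn φ F) :
    SmoothIn φ fun q => f q • F q := ContDiffOn.smul hf hF

theorem SmoothIn.mul {f g : M → ℝ} (hf : SmoothIn φ f) (hg : SmoothIn φ g) :
    SmoothIn φ fun q => f q * g q := ContDiffOn.mul hf hg

theorem SmoothIn.inv {f : M → ℝ} (hf : SmoothIn φ f) (h0 : ∀ q ∈ φ.source, f q ≠ 0) :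
    SmoothIn φ fun q => (f q)⁻¹ := ContDiffOn.inv hf fun _ hx => h0 _ (φ.map_target hx)

theorem SmoothIn.prodMk {F : M → E} {G : M → E'} (hF : SmoothIn φ F) (hG : SmoothIn φ G) :
    SmoothIn φ fun q => (F q, G q) := ContDiffOn.prodMk hF hG

theorem SmoothIn.dirDeriv {F : M → E} (hF : SmoothIn φ F) (w : ℝ × ℝ) :
    SmoothIn φ (dirDeriv φ w F) := by
  have h : ContDiffOn ℝ ∞ (fun x => fderiv ℝ (F ∘ φ.symm) x w) φ.target :=
    (ContDiffOn.fderiv_of_isOpen hF φ.open_target (by simp)).clm_apply contDiffOn_const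
  refine h.congr fun x hx => ?_
  simp only [TimelikeSurface.dirDeriv, Function.comp_apply, φ.right_inv hx]

theorem SmoothIn.du {F : M → E} (hF : SmoothIn φ F) : SmoothIn φ (du φ F) := hF.dirDeriv _

theorem SmoothIn.dv {F : M → E} (hF : SmoothIn φ F) : SmoothIn φ (dv φ F) := hF.dirDeriv _

theorem dirDeriv_const (e : E) (w : ℝ × ℝ) : dirDeriv φ w (fun _ => e) p = 0 := by
  have : ((fun _ => e) ∘ φ.symm : ℝ × ℝ → E) = fun _ => e := rfl
  simp [dirDeriv, this]

theorem dirDeriv_add {F G : M → E} (hF : SmoothIn φ F) (hG : SmoothIn φ G) (hp : p ∈ φ.source)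
    (w : ℝ × ℝ) :
    dirDeriv φ w (fun q => F q + G q) p = dirDeriv φ w F p + dirDeriv φ w G p := by
  have := fderiv_add (hF.differentiableAt hp) (hG.differentiableAt hp)
  unfold dirDeriv
  rw [← add_apply, ← this]; rfl

theorem dirDeriv_sub {F G : M → E} (hF : SmoothIn φ F) (hG : SmoothIn φ G) (hp : p ∈ φ.source)
    (w : ℝ × ℝ) :
    dirDeriv φ w (fun q => F q - G q) p = dirDeriv φ w F p - dirDeriv φ w G p := by
  have := fderiv_sub (hF.differentiableAt hp) (hG.differentiableAt hp)
  unfold dirDeriv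
  rw [← sub_apply, ← this]; rfl

theorem dirDeriv_smul {f : M → ℝ} {F : M → E} (hf : SmoothIn φ f) (hF : SmoothIn φ F)
    (hp : p ∈ φ.source) (w : ℝ × ℝ) :
    dirDeriv φ w (fun q => f q • F q) p = f p • dirDeriv φ w F p + dirDeriv φ w f p • F p := by
  have := fderiv_smul (hf.differentiableAt hp) (hF.differentiableAt hp)
  have h2 := congrArg (fun L => L w) this
  simp only [add_apply, smul_apply,
    ContinuousLinearMap.smulRight_apply, Function.comp_apply, φ.left_inv hp] at h2
  exact h2

theorem dirDeriv_mul {f g : M → ℝ} (hf : SmoothIn φ f) (hg : SmoothIn φ g)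
    (hp : p ∈ φ.source) (w : ℝ × ℝ) :
    dirDeriv φ w (fun q => f q * g q) p = f p * dirDeriv φ w g p + dirDeriv φ w f p * g p :=
  dirDeriv_smul hf hg hp w

theorem dirDeriv_prodMk {F : M → E} {G : M → E'} (hF : SmoothIn φ F) (hG : SmoothIn φ G)
    (hp : p ∈ φ.source) (w : ℝ × ℝ) :
    dirDeriv φ w (fun q => (F q, G q)) p = (dirDeriv φ w F p, dirDeriv φ w G p) := by
  have := (hF.differentiableAt hp).fderiv_prodMk (hG.differentiableAt hp)
  exact congrArg (fun L => L w) this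

theorem dirDeriv_sum {ι : Type*} (s : Finset ι) {F : ι → M → E} (hF : ∀ i ∈ s, SmoothIn φ (F i))
    (hp : p ∈ φ.source) (w : ℝ × ℝ) :
    dirDeriv φ w (fun q => ∑ i ∈ s, F i q) p = ∑ i ∈ s, dirDeriv φ w (F i) p := by
  have := fderiv_fun_sum (fun i hi => (hF i hi).differentiableAt hp)
  have h2 := congrArg (fun L => L w) this
  simp only [sum_apply] at h2
  exact h2

theorem dirDeriv_comm {F : M → E} (hF : SmoothIn φ F) (hp : p ∈ φ.source) (w w' : ℝ × ℝ) :
    dirDeriv φ w (dirDeriv φ w' F) p = dirDeriv φ w' (dirDeriv φ w F) p := by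
  have key : ∀ a b : ℝ × ℝ, dirDeriv φ a (dirDeriv φ b F) p =
      fderiv ℝ (fderiv ℝ (F ∘ φ.symm)) (φ p) a b := by
    intro a b
    have h1 : dirDeriv φ b F ∘ φ.symm =ᶠ[nhds (φ p)]
        fun x => fderiv ℝ (F ∘ φ.symm) x b := by
      filter_upwards [φ.open_target.mem_nhds (φ.map_source hp)] with x hx
      simp only [dirDeriv, Function.comp_apply, φ.right_inv hx]
    have h2 : DifferentiableAt ℝ (fderiv ℝ (F ∘ φ.symm)) (φ p) :=
      ((hF.contDiffAt hp).fderiv_right (m := ∞) (by simp)).differentiableAt (by simp)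
    change fderiv ℝ (dirDeriv φ b F ∘ φ.symm) (φ p) a = _
    rw [h1.fderiv_eq, fderiv_clm_apply h2 (differentiableAt_const b)]
    simp
  rw [key, key]
  have h := (hF.contDiffAt hp).isSymmSndFDerivAt (by
    rw [minSmoothness_of_isRCLikeNormedField]; exact WithTop.coe_le_coe.2 le_top)
  exact h w w'

theorem du_dv_comm {F : M → E} (hF : SmoothIn φ F) (hp : p ∈ φ.source) :
    dv φ (du φ F) p = du φ (dv φ F) p := dirDeriv_comm hF hp _ _

section Bilinear

variable [FiniteDimensional ℝ E]

theorem SmoothIn.bilin (B : LinearMap.BilinForm ℝ E) {F G : M → E} (hF : SmoothIn φ F)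
    (hG : SmoothIn φ G) : SmoothIn φ fun q => B (F q) (G q) := by
  let L : E →L[ℝ] E →L[ℝ] ℝ := LinearMap.toContinuousLinearMap
    ((LinearMap.toContinuousLinearMap : (E →ₗ[ℝ] ℝ) ≃ₗ[ℝ] (E →L[ℝ] ℝ)).toLinearMap ∘ₗ B)
  exact (L.contDiff.comp_contDiffOn hF).clm_apply hG

theorem dirDeriv_bilin (B : LinearMap.BilinForm ℝ E) {F G : M → E} (hF : SmoothIn φ F)
    (hG : SmoothIn φ G) (hp : p ∈ φ.source) (w : ℝ × ℝ) :
    dirDeriv φ w (fun q => B (F q) (G q)) p =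
      B (dirDeriv φ w F p) (G p) + B (F p) (dirDeriv φ w G p) := by
  let L : E →L[ℝ] E →L[ℝ] ℝ := LinearMap.toContinuousLinearMap
    ((LinearMap.toContinuousLinearMap : (E →ₗ[ℝ] ℝ) ≃ₗ[ℝ] (E →L[ℝ] ℝ)).toLinearMap ∘ₗ B)
  have h := L.hasFDerivAt_of_bilinear (hF.differentiableAt hp).hasFDerivAt
    (hG.differentiableAt hp).hasFDerivAt
  have h2 := congrArg (fun L => L w) h.fderiv
  simp only [add_apply, ContinuousLinearMap.precompR_apply,
    ContinuousLinearMap.precompL_apply, Function.comp_apply, φ.left_inv hp] at h2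
  rw [add_comm]
  exact h2

end Bilinear

end Calculus

section Frames

variable {M : Type*} [TopologicalSpace M]
variable {E : Type*} [NormedAddCommGroup E] [NormedSpace ℝ E]
variable {φ : OpenPartialHomeomorph M (ℝ × ℝ)} {p : M} {B : LinearMap.BilinForm ℝ E}

theorem normalPart_eq_zero {V : Submodule ℝ E} (hV : V ⊓ B.orthogonal V = ⊥) {w : E}
    (hw : w ∈ V) : normalPart B V w = 0 :=
  normalPart_eq B V hV (Submodule.zero_mem _) (by simpa using hw)

theorem mem_orthogonal_span {s : Set E} {w : E} :
    w ∈ B.orthogonal (Submodule.span ℝ s) ↔ ∀ x ∈ s, B x w = 0 := by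
  constructor
  · intro h x hx
    exact h x (Submodule.subset_span hx)
  · intro h x hx
    induction hx using Submodule.span_induction with
    | mem x hx => exact h x hx
    | zero => exact (by simp : B 0 w = 0)
    | add x y _ _ hx hy =>
      have hx' : B x w = 0 := hx
      have hy' : B y w = 0 := hy
      exact (by simp [hx', hy'] : B (x + y) w = 0)
    | smul a x _ hx =>
      have hx' : B x w = 0 := hx
      exact (by simp [hx'] : B (a • x) w = 0)

theorem mem_orthogonal_four {a b c d w : E} :
    w ∈ B.orthogonal (Submodule.span ℝ {a, b, c, d}) ↔
      B a w = 0 ∧ B b w = 0 ∧ B c w = 0 ∧ B d w = 0 := by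
  rw [mem_orthogonal_span]
  simp

theorem mem_orthogonal_three {a b c w : E} :
    w ∈ B.orthogonal (Submodule.span ℝ {a, b, c}) ↔ B a w = 0 ∧ B b w = 0 ∧ B c w = 0 := by
  rw [mem_orthogonal_span]
  simp

theorem mem_span_four {a b c d w : E} : w ∈ Submodule.span ℝ {a, b, c, d} ↔
    ∃ i j k l : ℝ, w = i • a + j • b + k • c + l • d := by
  simp only [Submodule.mem_span_insert, Submodule.mem_span_singleton]
  constructor
  · rintro ⟨i, _, ⟨j, _, ⟨k, _, ⟨l, rfl⟩, rfl⟩, rfl⟩, rfl⟩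
    exact ⟨i, j, k, l, by abel⟩
  · rintro ⟨i, j, k, l, rfl⟩
    exact ⟨i, _, ⟨j, _, ⟨k, _, ⟨l, rfl⟩, rfl⟩, rfl⟩, by abel⟩

theorem mem_span_three {a b c w : E} : w ∈ Submodule.span ℝ {a, b, c} ↔
    ∃ i j k : ℝ, w = i • a + j • b + k • c := by
  simp only [Submodule.mem_span_insert, Submodule.mem_span_singleton]
  constructor
  · rintro ⟨i, _, ⟨j, _, ⟨k, rfl⟩, rfl⟩, rfl⟩
    exact ⟨i, j, k, by abel⟩
  · rintro ⟨i, j, k, rfl⟩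
    exact ⟨i, _, ⟨j, _, ⟨k, rfl⟩, rfl⟩, by abel⟩

/-- A quadruple with the Gram matrix type of a conformal frame spans a nondegenerate subspace. -/
theorem span_four_inf_orthogonal (hB : ∀ x y, B x y = B y x) {a b c d : E} (haa : B a a = 0)
    (hab : B a b = 0) (hac : B a c = 0) (had : B a d ≠ 0) (hbb : B b b = 0) (hcc : B c c = 0)
    (hbc : B b c ≠ 0) :
    Submodule.span ℝ {a, b, c, d} ⊓ B.orthogonal (Submodule.span ℝ {a, b, c, d}) = ⊥ := by
  rw [Submodule.eq_bot_iff]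
  rintro w ⟨hw, hw'⟩
  obtain ⟨i, j, k, l, rfl⟩ := mem_span_four.1 hw
  obtain ⟨h1, h2, h3, h4⟩ := mem_orthogonal_four.1 hw'
  have hba := hB b a
  have hca := hB c a
  have hcb := hB c b
  have hda := hB d a
  simp only [map_add, map_smul, smul_eq_mul] at h1 h2 h3 h4
  rw [haa, hab, hac] at h1
  have hl : l = 0 := by simpa [had] using h1
  subst hl
  have hk : k = 0 := by
    rw [hba, hab, hbb] at h2
    simpa [hbc] using h2
  have hj : j = 0 := by
    rw [hca, hac, hcc, hcb] at h3
    simpa [hbc] using h3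
  subst hk hj
  have hi : i = 0 := by
    rw [hda] at h4
    simpa [had] using h4
  simp [hi]

theorem span_three_inf_orthogonal (hB : ∀ x y, B x y = B y x) {a b c : E} (haa : B a a ≠ 0)
    (hab : B a b = 0) (hac : B a c = 0) (hbb : B b b = 0) (hcc : B c c = 0) (hbc : B b c ≠ 0) :
    Submodule.span ℝ {a, b, c} ⊓ B.orthogonal (Submodule.span ℝ {a, b, c}) = ⊥ := by
  rw [Submodule.eq_bot_iff]
  rintro w ⟨hw, hw'⟩
  obtain ⟨i, j, k, rfl⟩ := mem_span_three.1 hw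
  obtain ⟨h1, h2, h3⟩ := mem_orthogonal_three.1 hw'
  simp only [map_add, map_smul, smul_eq_mul] at h1 h2 h3
  rw [hab, hac] at h1
  have hi : i = 0 := by simpa [haa] using h1
  rw [hB b a, hab, hbb] at h2
  have hk : k = 0 := by simpa [hbc] using h2
  rw [hB c a, hac, hcc, hB c b] at h3
  have hj : j = 0 := by simpa [hbc] using h3
  simp [hi, hj, hk]

variable [FiniteDimensional ℝ E]

theorem normalPart_spec (hB : ∀ x y, B x y = B y x) {V : Submodule ℝ E}
    (hV : V ⊓ B.orthogonal V = ⊥) (w : E) :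
    normalPart B V w ∈ B.orthogonal V ∧ w - normalPart B V w ∈ V := by
  have hr : B.IsRefl := fun x y h => by rw [hB]; exact h
  have hc : IsCompl V (B.orthogonal V) :=
    (LinearMap.BilinForm.isCompl_orthogonal_iff_disjoint hr).2 (disjoint_iff.2 hV)
  have hw : w ∈ V ⊔ B.orthogonal V := by rw [hc.sup_eq_top]; trivial
  obtain ⟨v, hv, k, hk, rfl⟩ := Submodule.mem_sup.1 hw
  have h : v + k - k ∈ V := by simpa using hv
  rw [normalPart_eq B V hV hk h]
  exact ⟨hk, h⟩

theorem dirDeriv_bilin_eq {F G : M → E} {q : M → ℝ} (hF : SmoothIn φ F) (hG : SmoothIn φ G)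
    (h : ∀ p ∈ φ.source, B (F p) (G p) = q p) (hp : p ∈ φ.source) (w : ℝ × ℝ) :
    B (dirDeriv φ w F p) (G p) + B (F p) (dirDeriv φ w G p) = dirDeriv φ w q p := by
  rw [← dirDeriv_bilin B hF hG hp]
  exact dirDeriv_congr h hp w

theorem dirDeriv_bilin_const {F G : M → E} {k : ℝ} (hF : SmoothIn φ F) (hG : SmoothIn φ G)
    (h : ∀ p ∈ φ.source, B (F p) (G p) = k) (hp : p ∈ φ.source) (w : ℝ × ℝ) :
    B (dirDeriv φ w F p) (G p) + B (F p) (dirDeriv φ w G p) = 0 := by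
  rw [dirDeriv_bilin_eq hF hG h hp, dirDeriv_const]

/-- `X` has constant length `⟨X, X⟩ = c` and the induced form is `2 q du dv`. -/
structure IsNullMap (B : LinearMap.BilinForm ℝ E) (φ : OpenPartialHomeomorph M (ℝ × ℝ))
    (X : M → E) (c : ℝ) (q : M → ℝ) : Prop where
  symm : ∀ x y, B x y = B y x
  smooth : SmoothIn φ X
  len : ∀ p ∈ φ.source, B (X p) (X p) = c
  uu : ∀ p ∈ φ.source, B (du φ X p) (du φ X p) = 0
  vv : ∀ p ∈ φ.source, B (dv φ X p) (dv φ X p) = 0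
  uv : ∀ p ∈ φ.source, B (du φ X p) (dv φ X p) = q p

namespace IsNullMap

variable {X : M → E} {c : ℝ} {q : M → ℝ}

theorem x_u (h : IsNullMap B φ X c q) (hp : p ∈ φ.source) : B (X p) (du φ X p) = 0 := by
  have := dirDeriv_bilin_const h.smooth h.smooth h.len hp (1, 0)
  rw [h.symm] at this
  change B (X p) (du φ X p) + B (X p) (du φ X p) = 0 at this
  linarith

theorem x_v (h : IsNullMap B φ X c q) (hp : p ∈ φ.source) : B (X p) (dv φ X p) = 0 := by
  have := dirDeriv_bilin_const h.smooth h.smooth h.len hp (0, 1)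
  rw [h.symm] at this
  change B (X p) (dv φ X p) + B (X p) (dv φ X p) = 0 at this
  linarith

theorem x_uu (h : IsNullMap B φ X c q) (hp : p ∈ φ.source) : B (X p) (du φ (du φ X) p) = 0 := by
  have := dirDeriv_bilin_const h.smooth h.smooth.du (fun p hp => h.x_u hp) hp (1, 0)
  change B (du φ X p) (du φ X p) + B (X p) (du φ (du φ X) p) = 0 at this
  linarith [h.uu p hp]

theorem x_vv (h : IsNullMap B φ X c q) (hp : p ∈ φ.source) : B (X p) (dv φ (dv φ X) p) = 0 := by
  have := dirDeriv_bilin_const h.smooth h.smooth.dv (fun p hp => h.x_v hp) hp (0, 1)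
  change B (dv φ X p) (dv φ X p) + B (X p) (dv φ (dv φ X) p) = 0 at this
  linarith [h.vv p hp]

theorem x_uv (h : IsNullMap B φ X c q) (hp : p ∈ φ.source) :
    B (X p) (du φ (dv φ X) p) = -q p := by
  have := dirDeriv_bilin_const h.smooth h.smooth.dv (fun p hp => h.x_v hp) hp (1, 0)
  change B (du φ X p) (dv φ X p) + B (X p) (du φ (dv φ X) p) = 0 at this
  linarith [h.uv p hp]

theorem u_uu (h : IsNullMap B φ X c q) (hp : p ∈ φ.source) :
    B (du φ X p) (du φ (du φ X) p) = 0 := by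
  have := dirDeriv_bilin_const h.smooth.du h.smooth.du h.uu hp (1, 0)
  rw [h.symm] at this
  change B (du φ X p) (du φ (du φ X) p) + B (du φ X p) (du φ (du φ X) p) = 0 at this
  linarith

theorem v_vv (h : IsNullMap B φ X c q) (hp : p ∈ φ.source) :
    B (dv φ X p) (dv φ (dv φ X) p) = 0 := by
  have := dirDeriv_bilin_const h.smooth.dv h.smooth.dv h.vv hp (0, 1)
  rw [h.symm] at this
  change B (dv φ X p) (dv φ (dv φ X) p) + B (dv φ X p) (dv φ (dv φ X) p) = 0 at this
  linarith

theorem u_uv (h : IsNullMap B φ X c q) (hp : p ∈ φ.source) :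
    B (du φ X p) (du φ (dv φ X) p) = 0 := by
  have := dirDeriv_bilin_const h.smooth.du h.smooth.du h.uu hp (0, 1)
  rw [h.symm] at this
  change B (du φ X p) (dv φ (du φ X) p) + B (du φ X p) (dv φ (du φ X) p) = 0 at this
  rw [du_dv_comm h.smooth hp] at this
  linarith

theorem v_uv (h : IsNullMap B φ X c q) (hp : p ∈ φ.source) :
    B (dv φ X p) (du φ (dv φ X) p) = 0 := by
  have := dirDeriv_bilin_const h.smooth.dv h.smooth.dv h.vv hp (1, 0)
  rw [h.symm] at this
  change B (dv φ X p) (du φ (dv φ X) p) + B (dv φ X p) (du φ (dv φ X) p) = 0 at this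
  linarith

theorem v_uu (h : IsNullMap B φ X c q) (hp : p ∈ φ.source) :
    B (dv φ X p) (du φ (du φ X) p) = du φ q p := by
  have := dirDeriv_bilin_eq h.smooth.du h.smooth.dv h.uv hp (1, 0)
  change B (du φ (du φ X) p) (dv φ X p) + B (du φ X p) (du φ (dv φ X) p) = du φ q p at this
  rw [h.u_uv hp, h.symm] at this
  linarith

theorem u_vv (h : IsNullMap B φ X c q) (hp : p ∈ φ.source) :
    B (du φ X p) (dv φ (dv φ X) p) = dv φ q p := by
  have := dirDeriv_bilin_eq h.smooth.du h.smooth.dv h.uv hp (0, 1)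
  change B (dv φ (du φ X) p) (dv φ X p) + B (du φ X p) (dv φ (dv φ X) p) = dv φ q p at this
  rw [du_dv_comm h.smooth hp, h.symm, h.v_uv hp] at this
  linarith

theorem confTangent_inf (h : IsNullMap B φ X 0 q) (hp : p ∈ φ.source) (hq : q p ≠ 0) :
    confTangent φ X p ⊓ B.orthogonal (confTangent φ X p) = ⊥ :=
  span_four_inf_orthogonal h.symm (h.len p hp) (h.x_u hp) (h.x_v hp)
    (by rw [h.x_uv hp]; exact neg_ne_zero.2 hq) (h.uu p hp) (h.vv p hp)
    (by rw [h.uv p hp]; exact hq)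

theorem quadTangent_inf (h : IsNullMap B φ X c q) (hc : c ≠ 0) (hp : p ∈ φ.source)
    (hq : q p ≠ 0) : quadTangent φ X p ⊓ B.orthogonal (quadTangent φ X p) = ⊥ :=
  span_three_inf_orthogonal h.symm (by rwa [h.len p hp]) (h.x_u hp) (h.x_v hp) (h.uu p hp)
    (h.vv p hp) (by rw [h.uv p hp]; exact hq)

end IsNullMap

/-- A null map whose induced form has constant coefficient `σ / 2`, `σ = ±1`. -/
abbrev IsNormalizedMap (B : LinearMap.BilinForm ℝ E) (σ : ℝ)
    (φ : OpenPartialHomeomorph M (ℝ × ℝ)) (X : M → E) : Prop :=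
  IsNullMap B φ X 0 fun _ => σ / 2

namespace IsNormalizedMap

variable {Y : M → E} {σ : ℝ}

theorem confTangent_inf (h : IsNormalizedMap B σ φ Y) (hσ : σ ^ 2 = 1) (hp : p ∈ φ.source) :
    confTangent φ Y p ⊓ B.orthogonal (confTangent φ Y p) = ⊥ :=
  IsNullMap.confTangent_inf h hp (by
    intro h0
    have : σ = 0 := by linarith
    simp [this] at hσ)

theorem v_uu (h : IsNormalizedMap B σ φ Y) (hp : p ∈ φ.source) :
    B (dv φ Y p) (du φ (du φ Y) p) = 0 := by
  rw [IsNullMap.v_uu h hp]; exact dirDeriv_const _ _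

theorem u_vv (h : IsNormalizedMap B σ φ Y) (hp : p ∈ φ.source) :
    B (du φ Y p) (dv φ (dv φ Y) p) = 0 := by
  rw [IsNullMap.u_vv h hp]; exact dirDeriv_const _ _

theorem uu_vv (h : IsNormalizedMap B σ φ Y) (hp : p ∈ φ.source) :
    B (du φ (du φ Y) p) (dv φ (dv φ Y) p) = B (du φ (dv φ Y) p) (du φ (dv φ Y) p) := by
  have h1 := dirDeriv_bilin_const h.smooth.du h.smooth.dv.dv (fun p hp => h.u_vv hp) hp (1, 0)
  have h2 := dirDeriv_bilin_const h.smooth.du h.smooth.dv.du (fun p hp => IsNullMap.u_uv h hp)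
    hp (0, 1)
  change B (du φ (du φ Y) p) (dv φ (dv φ Y) p) + B (du φ Y p) (du φ (dv φ (dv φ Y)) p) = 0 at h1
  change B (dv φ (du φ Y) p) (du φ (dv φ Y) p) + B (du φ Y p) (dv φ (du φ (dv φ Y)) p) = 0 at h2
  rw [du_dv_comm h.smooth hp, du_dv_comm h.smooth.dv hp] at h2
  linarith

theorem kappa1_eq (h : IsNormalizedMap B σ φ Y) (hσ : σ ^ 2 = 1) (hp : p ∈ φ.source) :
    kappa1 B φ Y p = du φ (du φ Y) p +
      (2 * σ * B (du φ (du φ Y) p) (du φ (dv φ Y) p)) • Y p := by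
  refine normalPart_eq B _ (h.confTangent_inf hσ hp) ?_ ?_
  · refine mem_orthogonal_four.2 ⟨?_, ?_, ?_, ?_⟩ <;>
      simp only [map_add, map_smul, smul_eq_mul]
    · rw [h.x_uu hp, h.len p hp]; ring
    · rw [h.u_uu hp, h.symm (du φ Y p) (Y p), h.x_u hp]; ring
    · rw [h.v_uu hp, h.symm (dv φ Y p) (Y p), h.x_v hp]; ring
    · rw [h.symm (du φ (dv φ Y) p) (Y p), h.x_uv hp, h.symm (du φ (dv φ Y) p)]
      linear_combination -B (du φ (du φ Y) p) (du φ (dv φ Y) p) * hσ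
  · rw [sub_add_cancel_left]
    exact Submodule.neg_mem _ (Submodule.smul_mem _ _ (Submodule.subset_span (by simp)))

theorem kappa2_eq (h : IsNormalizedMap B σ φ Y) (hσ : σ ^ 2 = 1) (hp : p ∈ φ.source) :
    kappa2 B φ Y p = dv φ (dv φ Y) p +
      (2 * σ * B (dv φ (dv φ Y) p) (du φ (dv φ Y) p)) • Y p := by
  refine normalPart_eq B _ (h.confTangent_inf hσ hp) ?_ ?_
  · refine mem_orthogonal_four.2 ⟨?_, ?_, ?_, ?_⟩ <;>
      simp only [map_add, map_smul, smul_eq_mul]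
    · rw [h.x_vv hp, h.len p hp]; ring
    · rw [h.u_vv hp, h.symm (du φ Y p) (Y p), h.x_u hp]; ring
    · rw [h.v_vv hp, h.symm (dv φ Y p) (Y p), h.x_v hp]; ring
    · rw [h.symm (du φ (dv φ Y) p) (Y p), h.x_uv hp, h.symm (du φ (dv φ Y) p)]
      linear_combination -B (dv φ (dv φ Y) p) (du φ (dv φ Y) p) * hσ
  · rw [sub_add_cancel_left]
    exact Submodule.neg_mem _ (Submodule.smul_mem _ _ (Submodule.subset_span (by simp)))

theorem smooth_kappa1 (h : IsNormalizedMap B σ φ Y) (hσ : σ ^ 2 = 1) :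
    SmoothIn φ (kappa1 B φ Y) := by
  refine SmoothIn.congr ?_ fun q hq => h.kappa1_eq hσ hq
  exact h.smooth.du.du.add (SmoothIn.smul ((SmoothIn.const _).mul
    (h.smooth.du.du.bilin B h.smooth.dv.du)) h.smooth)

theorem metricCoeff_eq_uu_vv (h : IsNormalizedMap B σ φ Y) (hσ : σ ^ 2 = 1) (hp : p ∈ φ.source) :
    metricCoeff B σ φ Y p = σ * B (du φ (du φ Y) p) (dv φ (dv φ Y) p) := by
  rw [metricCoeff, h.kappa1_eq hσ hp, h.kappa2_eq hσ hp]
  simp only [map_add, map_smul, smul_eq_mul, LinearMap.add_apply, LinearMap.smul_apply]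
  rw [h.x_vv hp, h.len p hp, h.symm _ (Y p), h.x_uu hp]
  ring

theorem metricCoeff_eq_uv_uv (h : IsNormalizedMap B σ φ Y) (hσ : σ ^ 2 = 1) (hp : p ∈ φ.source) :
    metricCoeff B σ φ Y p = σ * B (du φ (dv φ Y) p) (du φ (dv φ Y) p) := by
  rw [h.metricCoeff_eq_uu_vv hσ hp, h.uu_vv hp]

theorem kappa1_eq_smul_kappa2 (h : IsNormalizedMap B σ φ Y) (hσ : σ ^ 2 = 1) (hp : p ∈ φ.source)
    {ε s : ℝ} (hs : du φ (du φ Y) p - ε • dv φ (dv φ Y) p = s • Y p) :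
    kappa1 B φ Y p = ε • kappa2 B φ Y p := by
  have hs' : du φ (du φ Y) p = ε • dv φ (dv φ Y) p + s • Y p := by
    rw [← hs]; abel
  rw [h.kappa1_eq hσ hp, h.kappa2_eq hσ hp, hs']
  simp only [map_add, map_smul, LinearMap.add_apply, LinearMap.smul_apply, smul_eq_mul,
    h.x_uv hp]
  match_scalars
  · ring
  · linear_combination -s * hσ

end IsNormalizedMap

end Frames

section Polar

variable {M : Type*} [TopologicalSpace M]
variable {E : Type*} [NormedAddCommGroup E] [NormedSpace ℝ E] [FiniteDimensional ℝ E]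
variable {φ : OpenPartialHomeomorph M (ℝ × ℝ)} {p : M} {B : LinearMap.BilinForm ℝ E}

theorem bilin_normalPart (hB : ∀ x y, B x y = B y x) {V : Submodule ℝ E}
    (hV : V ⊓ B.orthogonal V = ⊥) {k : E} (hk : k ∈ B.orthogonal V) (w : E) :
    B k (normalPart B V w) = B k w := by
  have h : B (w - normalPart B V w) k = 0 := hk _ (normalPart_spec hB hV w).2
  rw [hB, map_sub] at h
  linarith

/-- Local data of a polar transform `ψ` of an isothermic surface with adapted lift `Y`. -/
structure IsPolarPair (B : LinearMap.BilinForm ℝ E) (φ : OpenPartialHomeomorph M (ℝ × ℝ))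
    (Y ψ : M → E) (c ε : ℝ) : Prop where
  normalized : IsNormalizedMap B 1 φ Y
  sign : ε ^ 2 = 1
  hopf : ∀ p ∈ φ.source, kappa1 B φ Y p = ε • kappa2 B φ Y p
  smooth : SmoothIn φ ψ
  len : ∀ p ∈ φ.source, B (ψ p) (ψ p) = c
  normal : ∀ p ∈ φ.source, ψ p ∈ B.orthogonal (confTangent φ Y p)
  du_mem : ∀ p ∈ φ.source, du φ ψ p ∈ confTangent φ Y p
  dv_mem : ∀ p ∈ φ.source, dv φ ψ p ∈ confTangent φ Y p

/-- The function `⟨ψ, κ₁⟩`, written as `⟨ψ, Y_uu⟩`. -/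
def polarCoeff (B : LinearMap.BilinForm ℝ E) (φ : OpenPartialHomeomorph M (ℝ × ℝ))
    (Y ψ : M → E) (p : M) : ℝ :=
  B (ψ p) (du φ (du φ Y) p)

theorem IsNormalizedMap.bilin_uu_vv_of_mem {Y : M → E} (h : IsNormalizedMap B 1 φ Y)
    (hp : p ∈ φ.source) {v : E} (hv : v ∈ confTangent φ Y p) (hv0 : B v (Y p) = 0) :
    B v (du φ (du φ Y) p) = 0 ∧ B v (dv φ (dv φ Y) p) = 0 := by
  obtain ⟨i, j, k, l, rfl⟩ := mem_span_four.1 hv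
  have e1 := h.symm (du φ Y p) (Y p)
  have e2 := h.symm (dv φ Y p) (Y p)
  have e3 := h.symm (du φ (dv φ Y) p) (Y p)
  simp only [map_add, map_smul, LinearMap.add_apply, LinearMap.smul_apply, smul_eq_mul, e1, e2, e3,
    h.len p hp, h.x_u hp, h.x_v hp, h.x_uv hp] at hv0
  have hl : l = 0 := by linarith
  subst hl
  simp only [map_add, map_smul, LinearMap.add_apply, LinearMap.smul_apply, smul_eq_mul,
    h.x_uu hp, h.x_vv hp, h.u_uu hp, h.v_vv hp, h.v_uu hp, h.u_vv hp]
  constructor <;> ring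

namespace IsPolarPair

variable {Y ψ : M → E} {c ε : ℝ}

local notation "μ" => polarCoeff B φ Y ψ

theorem orth (h : IsPolarPair B φ Y ψ c ε) (hp : p ∈ φ.source) :
    B (ψ p) (Y p) = 0 ∧ B (ψ p) (du φ Y p) = 0 ∧ B (ψ p) (dv φ Y p) = 0 ∧
      B (ψ p) (du φ (dv φ Y) p) = 0 := by
  have := mem_orthogonal_four.1 (h.normal p hp)
  simpa only [h.normalized.symm _ (ψ p)] using this

theorem smooth_coeff (h : IsPolarPair B φ Y ψ c ε) : SmoothIn φ μ :=
  h.smooth.bilin B h.normalized.smooth.du.du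

theorem bilin_kappa1 (h : IsPolarPair B φ Y ψ c ε) (hp : p ∈ φ.source) :
    B (ψ p) (kappa1 B φ Y p) = μ p := by
  rw [h.normalized.kappa1_eq (by norm_num) hp, map_add, map_smul, (h.orth hp).1, polarCoeff]
  simp

theorem bilin_vv (h : IsPolarPair B φ Y ψ c ε) (hp : p ∈ φ.source) :
    B (ψ p) (dv φ (dv φ Y) p) = ε * μ p := by
  have h1 := h.bilin_kappa1 hp
  rw [h.hopf p hp, h.normalized.kappa2_eq (by norm_num) hp, map_smul, map_add, map_smul,
    (h.orth hp).1] at h1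
  simp only [smul_eq_mul, mul_zero, add_zero] at h1
  rw [← h1, ← mul_assoc, ← pow_two, h.sign, one_mul]

theorem bilin_deriv (h : IsPolarPair B φ Y ψ c ε) (hp : p ∈ φ.source) (w : ℝ × ℝ) :
    B (dirDeriv φ w ψ p) (Y p) = -B (ψ p) (dirDeriv φ w Y p) := by
  have := dirDeriv_bilin_const h.smooth h.normalized.smooth (fun p hp => (h.orth hp).1) hp w
  linarith

theorem bilin_du_Y (h : IsPolarPair B φ Y ψ c ε) (hp : p ∈ φ.source) :
    B (du φ ψ p) (Y p) = 0 := by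
  have := h.bilin_deriv hp (1, 0)
  change B (du φ ψ p) (Y p) = -B (ψ p) (du φ Y p) at this
  rw [this, (h.orth hp).2.1, neg_zero]

theorem bilin_dv_Y (h : IsPolarPair B φ Y ψ c ε) (hp : p ∈ φ.source) :
    B (dv φ ψ p) (Y p) = 0 := by
  have := h.bilin_deriv hp (0, 1)
  change B (dv φ ψ p) (Y p) = -B (ψ p) (dv φ Y p) at this
  rw [this, (h.orth hp).2.2.1, neg_zero]

theorem du_eq (h : IsPolarPair B φ Y ψ c ε) (hp : p ∈ φ.source) :
    du φ ψ p = (2 * dv φ μ p) • Y p - (2 * μ p) • dv φ Y p := by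
  have hY := h.normalized
  have hd := h.bilin_du_Y hp
  have h1 := dirDeriv_bilin_const h.smooth hY.smooth.du (fun p hp => (h.orth hp).2.1) hp (1, 0)
  have h2 := dirDeriv_bilin_const h.smooth hY.smooth.dv (fun p hp => (h.orth hp).2.2.1) hp (1, 0)
  have h3 := dirDeriv_bilin_const h.smooth hY.smooth.dv.du (fun p hp => (h.orth hp).2.2.2) hp
    (1, 0)
  have h4 := dirDeriv_bilin B h.smooth hY.smooth.du.du hp (0, 1)
  change B (du φ ψ p) (du φ Y p) + B (ψ p) (du φ (du φ Y) p) = 0 at h1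
  change B (du φ ψ p) (dv φ Y p) + B (ψ p) (du φ (dv φ Y) p) = 0 at h2
  change B (du φ ψ p) (du φ (dv φ Y) p) + B (ψ p) (du φ (du φ (dv φ Y)) p) = 0 at h3
  change dv φ μ p = B (dv φ ψ p) (du φ (du φ Y) p) + B (ψ p) (dv φ (du φ (du φ Y)) p) at h4
  rw [(hY.bilin_uu_vv_of_mem hp (h.dv_mem p hp) (h.bilin_dv_Y hp)).1,
    du_dv_comm hY.smooth.du hp, du_congr (fun q hq => du_dv_comm hY.smooth hq) hp] at h4
  change B (du φ ψ p) (du φ Y p) + μ p = 0 at h1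
  obtain ⟨i, j, k, l, hv⟩ := mem_span_four.1 (h.du_mem p hp)
  have e1 := hY.symm (du φ Y p) (Y p)
  have e2 := hY.symm (dv φ Y p) (Y p)
  have e3 := hY.symm (du φ (dv φ Y) p) (Y p)
  have e4 := hY.symm (dv φ Y p) (du φ Y p)
  have e5 := hY.symm (du φ (dv φ Y) p) (du φ Y p)
  have e6 := hY.symm (du φ (dv φ Y) p) (dv φ Y p)
  rw [(h.orth hp).2.2.2] at h2
  rw [hv] at hd h1 h2 h3 ⊢
  simp only [map_add, map_smul, LinearMap.add_apply, LinearMap.smul_apply, smul_eq_mul, e1, e2, e3,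
    e4, e5, e6, hY.len p hp, hY.x_u hp, hY.x_v hp, hY.x_uv hp, hY.uu p hp, hY.vv p hp, hY.uv p hp,
    hY.u_uv hp, hY.v_uv hp] at hd h1 h2 h3
  have hl : l = 0 := by linarith
  have hj : j = 0 := by linarith
  have hk : k = -(2 * μ p) := by linarith
  have hi : i = 2 * dv φ μ p := by rw [h4]; rw [hl] at h3; linarith
  rw [hl, hj, hk, hi]
  module

theorem dv_eq (h : IsPolarPair B φ Y ψ c ε) (hp : p ∈ φ.source) :
    dv φ ψ p = (2 * ε * du φ μ p) • Y p - (2 * ε * μ p) • du φ Y p := by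
  have hY := h.normalized
  have hd := h.bilin_dv_Y hp
  have h1 := dirDeriv_bilin_const h.smooth hY.smooth.du (fun p hp => (h.orth hp).2.1) hp (0, 1)
  have h2 := dirDeriv_bilin_const h.smooth hY.smooth.dv (fun p hp => (h.orth hp).2.2.1) hp (0, 1)
  have h3 := dirDeriv_bilin_const h.smooth hY.smooth.dv.du (fun p hp => (h.orth hp).2.2.2) hp
    (0, 1)
  have h4 := dirDeriv_bilin_eq h.smooth hY.smooth.dv.dv (fun p hp => h.bilin_vv hp) hp (1, 0)
  rw [dirDeriv_mul (SmoothIn.const ε) h.smooth_coeff hp, dirDeriv_const, zero_mul, add_zero] at h4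
  change B (dv φ ψ p) (du φ Y p) + B (ψ p) (dv φ (du φ Y) p) = 0 at h1
  change B (dv φ ψ p) (dv φ Y p) + B (ψ p) (dv φ (dv φ Y) p) = 0 at h2
  change B (dv φ ψ p) (du φ (dv φ Y) p) + B (ψ p) (dv φ (du φ (dv φ Y)) p) = 0 at h3
  change B (du φ ψ p) (dv φ (dv φ Y) p) + B (ψ p) (du φ (dv φ (dv φ Y)) p) = ε * du φ μ p at h4
  rw [(hY.bilin_uu_vv_of_mem hp (h.du_mem p hp) (h.bilin_du_Y hp)).2] at h4
  rw [du_dv_comm hY.smooth.dv hp] at h3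
  rw [du_dv_comm hY.smooth hp, (h.orth hp).2.2.2] at h1
  rw [h.bilin_vv hp] at h2
  obtain ⟨i, j, k, l, hv⟩ := mem_span_four.1 (h.dv_mem p hp)
  have e1 := hY.symm (du φ Y p) (Y p)
  have e2 := hY.symm (dv φ Y p) (Y p)
  have e3 := hY.symm (du φ (dv φ Y) p) (Y p)
  have e4 := hY.symm (dv φ Y p) (du φ Y p)
  have e5 := hY.symm (du φ (dv φ Y) p) (du φ Y p)
  have e6 := hY.symm (du φ (dv φ Y) p) (dv φ Y p)
  rw [hv] at hd h1 h2 h3 ⊢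
  simp only [map_add, map_smul, LinearMap.add_apply, LinearMap.smul_apply, smul_eq_mul, e1, e2, e3,
    e4, e5, e6, hY.len p hp, hY.x_u hp, hY.x_v hp, hY.x_uv hp, hY.uu p hp, hY.vv p hp, hY.uv p hp,
    hY.u_uv hp, hY.v_uv hp] at hd h1 h2 h3
  have hl : l = 0 := by linarith
  have hk : k = 0 := by linarith
  have hj : j = -(2 * ε * μ p) := by linarith
  have hi : i = 2 * ε * du φ μ p := by rw [hl] at h3; linarith
  rw [hl, hj, hk, hi]
  module

/-- `ψ` induces the metric `4 ε ⟨ψ, κ₁⟩² du dv`. -/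
theorem isNullMap (h : IsPolarPair B φ Y ψ c ε) :
    IsNullMap B φ ψ c fun p => 2 * ε * μ p ^ 2 := by
  have hY := h.normalized
  refine ⟨hY.symm, h.smooth, h.len, ?_, ?_, ?_⟩ <;> intro p hp
  · rw [h.du_eq hp]
    simp only [map_sub, map_smul, LinearMap.sub_apply, LinearMap.smul_apply, smul_eq_mul,
      hY.symm (dv φ Y p) (Y p), hY.len p hp, hY.x_v hp, hY.vv p hp]
    ring
  · rw [h.dv_eq hp]
    simp only [map_sub, map_smul, LinearMap.sub_apply, LinearMap.smul_apply, smul_eq_mul,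
      hY.symm (du φ Y p) (Y p), hY.len p hp, hY.x_u hp, hY.uu p hp]
    ring
  · rw [h.du_eq hp, h.dv_eq hp]
    simp only [map_sub, map_smul, LinearMap.sub_apply, LinearMap.smul_apply, smul_eq_mul,
      hY.symm (dv φ Y p) (Y p), hY.symm (dv φ Y p) (du φ Y p), hY.len p hp, hY.x_u hp, hY.x_v hp,
      hY.uv p hp]
    ring

theorem uu_eq (h : IsPolarPair B φ Y ψ c ε) (hp : p ∈ φ.source) :
    du φ (du φ ψ) p = (2 * du φ (dv φ μ) p) • Y p + (2 * dv φ μ p) • du φ Y p -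
      (2 * du φ μ p) • dv φ Y p - (2 * μ p) • du φ (dv φ Y) p := by
  have hY := h.normalized.smooth
  have hm := h.smooth_coeff
  have h2 : ∀ f : M → ℝ, SmoothIn φ f → du φ (fun q => 2 * f q) p = 2 * du φ f p := fun f hf => by
    have := dirDeriv_mul (SmoothIn.const 2) hf hp (1, 0)
    rwa [dirDeriv_const, zero_mul, add_zero] at this
  rw [du_congr (fun q hq => h.du_eq hq) hp, du_eq_dirDeriv,
    dirDeriv_sub (((SmoothIn.const 2).mul hm.dv).smul hY) (((SmoothIn.const 2).mul hm).smul hY.dv)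
      hp,
    dirDeriv_smul ((SmoothIn.const 2).mul hm.dv) hY hp,
    dirDeriv_smul ((SmoothIn.const 2).mul hm) hY.dv hp]
  simp only [← du_eq_dirDeriv]
  rw [h2 _ hm.dv, h2 _ hm]
  module

theorem vv_eq (h : IsPolarPair B φ Y ψ c ε) (hp : p ∈ φ.source) :
    dv φ (dv φ ψ) p = ε • ((2 * du φ (dv φ μ) p) • Y p + (2 * du φ μ p) • dv φ Y p -
      (2 * dv φ μ p) • du φ Y p - (2 * μ p) • du φ (dv φ Y) p) := by
  have hY := h.normalized.smooth
  have hm := h.smooth_coeff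
  have h2 : ∀ f : M → ℝ, SmoothIn φ f → dv φ (fun q => 2 * ε * f q) p = 2 * ε * dv φ f p :=
    fun f hf => by
      have := dirDeriv_mul (SmoothIn.const (2 * ε)) hf hp (0, 1)
      rwa [dirDeriv_const, zero_mul, add_zero] at this
  rw [dv_congr (fun q hq => h.dv_eq hq) hp, dv_eq_dirDeriv,
    dirDeriv_sub (((SmoothIn.const (2 * ε)).mul hm.du).smul hY)
      (((SmoothIn.const (2 * ε)).mul hm).smul hY.du) hp,
    dirDeriv_smul ((SmoothIn.const (2 * ε)).mul hm.du) hY hp,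
    dirDeriv_smul ((SmoothIn.const (2 * ε)).mul hm) hY.du hp]
  simp only [← dv_eq_dirDeriv]
  rw [h2 _ hm.du, h2 _ hm, du_dv_comm hm hp, du_dv_comm hY hp]
  module

theorem uv_eq (h : IsPolarPair B φ Y ψ c ε) (hp : p ∈ φ.source) :
    du φ (dv φ ψ) p = (2 * dv φ (dv φ μ) p) • Y p - (2 * μ p) • dv φ (dv φ Y) p := by
  have hY := h.normalized.smooth
  have hm := h.smooth_coeff
  have h2 : ∀ f : M → ℝ, SmoothIn φ f → dv φ (fun q => 2 * f q) p = 2 * dv φ f p := fun f hf => by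
    have := dirDeriv_mul (SmoothIn.const 2) hf hp (0, 1)
    rwa [dirDeriv_const, zero_mul, add_zero] at this
  rw [← du_dv_comm h.smooth hp, dv_congr (fun q hq => h.du_eq hq) hp, dv_eq_dirDeriv,
    dirDeriv_sub (((SmoothIn.const 2).mul hm.dv).smul hY) (((SmoothIn.const 2).mul hm).smul hY.dv)
      hp,
    dirDeriv_smul ((SmoothIn.const 2).mul hm.dv) hY hp,
    dirDeriv_smul ((SmoothIn.const 2).mul hm) hY.dv hp]
  simp only [← dv_eq_dirDeriv]
  rw [h2 _ hm.dv, h2 _ hm]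
  module

theorem uu_sub_vv (h : IsPolarPair B φ Y ψ c ε) (hp : p ∈ φ.source) (hm : μ p ≠ 0) :
    du φ (du φ ψ) p - ε • dv φ (dv φ ψ) p =
      (2 * du φ μ p / μ p) • du φ ψ p - (ε * (2 * dv φ μ p / μ p)) • dv φ ψ p := by
  rw [h.uu_eq hp, h.vv_eq hp, h.du_eq hp, h.dv_eq hp, smul_smul, ← pow_two, h.sign]
  match_scalars
  · field_simp
    linear_combination (2 * du φ μ p * dv φ μ p) * h.sign
  · field_simp
    linear_combination (-2 * dv φ μ p) * h.sign
  · field_simp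
    ring
  · ring

theorem bilin_uv_uv (h : IsPolarPair B φ Y ψ c ε) (hp : p ∈ φ.source) :
    ε * B (du φ (dv φ ψ) p) (du φ (dv φ ψ) p) = 4 * μ p ^ 2 * metricCoeff B 1 φ Y p := by
  have hY := h.normalized
  rw [metricCoeff, h.hopf p hp, hY.kappa2_eq (by norm_num) hp, h.uv_eq hp]
  simp only [map_sub, map_add, map_smul, LinearMap.sub_apply, LinearMap.add_apply,
    LinearMap.smul_apply, smul_eq_mul, hY.symm _ (Y p), hY.len p hp, hY.x_vv hp]
  ring

theorem bilin_Y_uu (h : IsPolarPair B φ Y ψ c ε) (hp : p ∈ φ.source) :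
    B (Y p) (du φ (du φ ψ) p) = μ p := by
  have hY := h.normalized
  rw [h.uu_eq hp]
  simp only [map_sub, map_add, map_smul, smul_eq_mul, hY.len p hp, hY.x_u hp, hY.x_v hp,
    hY.x_uv hp]
  ring

theorem bilin_Y_uv (h : IsPolarPair B φ Y ψ c ε) (hp : p ∈ φ.source) :
    B (Y p) (du φ (dv φ ψ) p) = 0 := by
  have hY := h.normalized
  rw [h.uv_eq hp]
  simp only [map_sub, map_smul, smul_eq_mul, hY.len p hp, hY.x_vv hp]
  ring

theorem omega1_eq (h : IsPolarPair B φ Y ψ c ε) (hc : c ≠ 0) (hp : p ∈ φ.source)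
    (hm : μ p ≠ 0) :
    omega1 B φ ψ p = du φ (du φ ψ) p - (2 * du φ μ p / μ p) • du φ ψ p := by
  have hψ := h.isNullMap
  have hε : ε ≠ 0 := by rintro rfl; simpa using h.sign
  have hdq : du φ (fun p => 2 * ε * μ p ^ 2) p = 4 * ε * μ p * du φ μ p := by
    have e : (fun p => 2 * ε * μ p ^ 2) = fun p => (2 * ε) * (μ p * μ p) := by
      funext p; ring
    rw [e, du_eq_dirDeriv, dirDeriv_mul (SmoothIn.const _) (h.smooth_coeff.mul h.smooth_coeff) hp,
      dirDeriv_const, dirDeriv_mul h.smooth_coeff h.smooth_coeff hp]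
    simp only [← du_eq_dirDeriv]
    ring
  refine normalPart_eq B _ (hψ.quadTangent_inf hc hp (by positivity)) ?_ ?_
  · refine mem_orthogonal_three.2 ⟨?_, ?_, ?_⟩ <;> simp only [map_sub, map_smul, smul_eq_mul]
    · rw [hψ.x_uu hp, hψ.x_u hp]; ring
    · rw [hψ.u_uu hp, hψ.uu p hp]; ring
    · rw [hψ.v_uu hp, hψ.symm (dv φ ψ p), hψ.uv p hp, hdq]
      field_simp
      ring
  · rw [sub_sub_cancel]
    exact Submodule.smul_mem _ _ (Submodule.subset_span (by simp))

theorem omega2_eq (h : IsPolarPair B φ Y ψ c ε) (hc : c ≠ 0) (hp : p ∈ φ.source)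
    (hm : μ p ≠ 0) :
    omega2 B φ ψ p = dv φ (dv φ ψ) p - (2 * dv φ μ p / μ p) • dv φ ψ p := by
  have hψ := h.isNullMap
  have hε : ε ≠ 0 := by rintro rfl; simpa using h.sign
  have hdq : dv φ (fun p => 2 * ε * μ p ^ 2) p = 4 * ε * μ p * dv φ μ p := by
    have e : (fun p => 2 * ε * μ p ^ 2) = fun p => (2 * ε) * (μ p * μ p) := by
      funext p; ring
    rw [e, dv_eq_dirDeriv, dirDeriv_mul (SmoothIn.const _) (h.smooth_coeff.mul h.smooth_coeff) hp,
      dirDeriv_const, dirDeriv_mul h.smooth_coeff h.smooth_coeff hp]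
    simp only [← dv_eq_dirDeriv]
    ring
  refine normalPart_eq B _ (hψ.quadTangent_inf hc hp (by positivity)) ?_ ?_
  · refine mem_orthogonal_three.2 ⟨?_, ?_, ?_⟩ <;> simp only [map_sub, map_smul, smul_eq_mul]
    · rw [hψ.x_vv hp, hψ.x_v hp]; ring
    · rw [hψ.u_vv hp, hψ.uv p hp, hdq]
      field_simp
      ring
    · rw [hψ.v_vv hp, hψ.vv p hp]; ring
  · rw [sub_sub_cancel]
    exact Submodule.smul_mem _ _ (Submodule.subset_span (by simp))

theorem omega1_eq_smul_omega2 (h : IsPolarPair B φ Y ψ c ε) (hc : c ≠ 0) (hp : p ∈ φ.source)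
    (hm : μ p ≠ 0) : omega1 B φ ψ p = ε • omega2 B φ ψ p := by
  rw [h.omega1_eq hc hp hm, h.omega2_eq hc hp hm, smul_sub, smul_smul, sub_eq_sub_iff_sub_eq_sub]
  exact h.uu_sub_vv hp hm

theorem dirDeriv_inv (h : IsPolarPair B φ Y ψ c ε) (h0 : ∀ q ∈ φ.source, μ q ≠ 0)
    (hp : p ∈ φ.source) (w : ℝ × ℝ) :
    dirDeriv φ w (fun q => (μ q)⁻¹) p = -dirDeriv φ w μ p / μ p ^ 2 := by
  have h1 := dirDeriv_mul (h.smooth_coeff.inv h0) h.smooth_coeff hp w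
  rw [dirDeriv_congr (G := fun _ => (1 : ℝ)) (fun q hq => inv_mul_cancel₀ (h0 q hq)) hp,
    dirDeriv_const] at h1
  have := h0 p hp
  field_simp at h1 ⊢
  linarith

theorem du_dual (h : IsPolarPair B φ Y ψ c ε) (h0 : ∀ q ∈ φ.source, μ q ≠ 0)
    (hp : p ∈ φ.source) :
    du φ (fun q => (μ q)⁻¹ • Y q) p = (-ε / (2 * μ p ^ 2)) • dv φ ψ p := by
  rw [du_eq_dirDeriv, dirDeriv_smul (h.smooth_coeff.inv h0) h.normalized.smooth hp,
    h.dirDeriv_inv h0 hp, h.dv_eq hp]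
  simp only [← du_eq_dirDeriv]
  have := h0 p hp
  match_scalars
  · field_simp
    linear_combination -h.sign
  · field_simp
    linear_combination du φ μ p * h.sign

theorem dv_dual (h : IsPolarPair B φ Y ψ c ε) (h0 : ∀ q ∈ φ.source, μ q ≠ 0)
    (hp : p ∈ φ.source) :
    dv φ (fun q => (μ q)⁻¹ • Y q) p = (-1 / (2 * μ p ^ 2)) • du φ ψ p := by
  rw [dv_eq_dirDeriv, dirDeriv_smul (h.smooth_coeff.inv h0) h.normalized.smooth hp,
    h.dirDeriv_inv h0 hp, h.du_eq hp]
  simp only [← dv_eq_dirDeriv]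
  have := h0 p hp
  match_scalars <;> field_simp

theorem Y_normal (h : IsPolarPair B φ Y ψ c ε) (hp : p ∈ φ.source) :
    B (ψ p) (Y p) = 0 ∧ B (du φ ψ p) (Y p) = 0 ∧ B (dv φ ψ p) (Y p) = 0 ∧
      B (du φ (dv φ ψ) p) (Y p) = 0 :=
  ⟨(h.orth hp).1, h.bilin_du_Y hp, h.bilin_dv_Y hp, by
    rw [h.normalized.symm, h.bilin_Y_uv hp]⟩

end IsPolarPair

/-- The canonical lift obtained from a null lift `X` with `⟨X_u, X_v⟩ = 2 ε m²`. -/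
theorem IsNullMap.normalize {X : M → E} {ε : ℝ} {m : M → ℝ}
    (h : IsNullMap B φ X 0 fun p => 2 * ε * m p ^ 2) (hm : SmoothIn φ m)
    (h0 : ∀ q ∈ φ.source, m q ≠ 0) : IsNormalizedMap B ε φ fun q => (2 * m q)⁻¹ • X q := by
  have hw : SmoothIn φ fun q => (2 * m q)⁻¹ :=
    ((SmoothIn.const 2).mul hm).inv fun q hq => mul_ne_zero two_ne_zero (h0 q hq)
  refine ⟨h.symm, hw.smul h.smooth, ?_, ?_, ?_, ?_⟩ <;> intro p hp
  · simp [h.len p hp]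
  · rw [du_eq_dirDeriv, dirDeriv_smul hw h.smooth hp]
    simp only [← du_eq_dirDeriv, map_add, map_smul, LinearMap.add_apply, LinearMap.smul_apply,
      smul_eq_mul, h.symm _ (X p), h.len p hp, h.x_u hp, h.uu p hp]
    ring
  · rw [dv_eq_dirDeriv, dirDeriv_smul hw h.smooth hp]
    simp only [← dv_eq_dirDeriv, map_add, map_smul, LinearMap.add_apply, LinearMap.smul_apply,
      smul_eq_mul, h.symm _ (X p), h.len p hp, h.x_v hp, h.vv p hp]
    ring
  · rw [du_eq_dirDeriv, dv_eq_dirDeriv, dirDeriv_smul hw h.smooth hp, dirDeriv_smul hw h.smooth hp]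
    simp only [← du_eq_dirDeriv, ← dv_eq_dirDeriv, map_add, map_smul, LinearMap.add_apply,
      LinearMap.smul_apply, smul_eq_mul, h.symm _ (X p), h.len p hp, h.x_u hp, h.x_v hp, h.uv p hp]
    have := h0 p hp
    field_simp
    ring

theorem dirDeriv_half_inv {m : M → ℝ} (hm : SmoothIn φ m) (h0 : ∀ q ∈ φ.source, m q ≠ 0)
    (hp : p ∈ φ.source) (w : ℝ × ℝ) :
    dirDeriv φ w (fun q => (2 * m q)⁻¹) p = -((2 * m p)⁻¹ * (dirDeriv φ w m p / m p)) := by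
  have h2 : ∀ q ∈ φ.source, 2 * m q ≠ 0 := fun q hq => mul_ne_zero two_ne_zero (h0 q hq)
  have hm2 := (SmoothIn.const (φ := φ) (2 : ℝ)).mul hm
  have h1 := dirDeriv_mul (hm2.inv h2) hm2 hp w
  rw [dirDeriv_congr (G := fun _ => (1 : ℝ)) (fun q hq => inv_mul_cancel₀ (h2 q hq)) hp,
    dirDeriv_const, dirDeriv_mul (SmoothIn.const 2) hm hp, dirDeriv_const] at h1
  have := h0 p hp
  field_simp at h1 ⊢
  linarith

theorem SmoothIn.logDeriv {m : M → ℝ} (hm : SmoothIn φ m) (h0 : ∀ q ∈ φ.source, m q ≠ 0)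
    (w : ℝ × ℝ) : SmoothIn φ fun q => TimelikeSurface.dirDeriv φ w m q / m q := by
  simpa only [div_eq_mul_inv] using (hm.dirDeriv w).mul (hm.inv h0)

/-- The conformal metric of a null map `X` with `⟨X_u, X_v⟩ = 2 ε m²`. -/
theorem IsNullMap.metricCoeff_normalize {X : M → E} {ε : ℝ} {m : M → ℝ}
    (h : IsNullMap B φ X 0 fun p => 2 * ε * m p ^ 2) (hε : ε ^ 2 = 1) (hm : SmoothIn φ m)
    (h0 : ∀ q ∈ φ.source, m q ≠ 0) (hp : p ∈ φ.source) :
    metricCoeff B ε φ (fun q => (2 * m q)⁻¹ • X q) p =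
      ε * B (du φ (dv φ X) p) (du φ (dv φ X) p) / (4 * m p ^ 2) +
        dv φ (fun q => du φ m q / m q) p := by
  have hw : SmoothIn φ fun q => (2 * m q)⁻¹ :=
    ((SmoothIn.const 2).mul hm).inv fun q hq => mul_ne_zero two_ne_zero (h0 q hq)
  rw [(h.normalize hm h0).metricCoeff_eq_uv_uv hε hp, ← du_dv_comm (hw.smul h.smooth) hp]
  have e1 : ∀ q ∈ φ.source, du φ (fun q => (2 * m q)⁻¹ • X q) q =
      (2 * m q)⁻¹ • (du φ X q - (du φ m q / m q) • X q) := fun q hq => by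
    rw [du_eq_dirDeriv, dirDeriv_smul hw h.smooth hq, dirDeriv_half_inv hm h0 hq]
    simp only [← du_eq_dirDeriv]
    module
  have hl : SmoothIn φ fun q => du φ m q / m q := hm.logDeriv h0 _
  have hs := hl.smul h.smooth
  rw [dv_congr e1 hp, dv_eq_dirDeriv, dirDeriv_smul hw (h.smooth.du.sub hs) hp,
    dirDeriv_half_inv hm h0 hp, dirDeriv_sub h.smooth.du hs hp, dirDeriv_smul hl h.smooth hp]
  simp only [← dv_eq_dirDeriv]
  rw [du_dv_comm h.smooth hp]
  set L := dv φ (fun q => du φ m q / m q) p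
  simp only [map_add, map_sub, map_smul, LinearMap.add_apply, LinearMap.sub_apply,
    LinearMap.smul_apply, smul_eq_mul, h.symm _ (X p), h.symm (du φ (dv φ X) p) (du φ X p),
    h.symm (du φ (dv φ X) p) (dv φ X p), h.symm (dv φ X p) (du φ X p), h.len p hp, h.x_u hp,
    h.x_v hp, h.uv p hp, h.uu p hp, h.vv p hp, h.x_uv hp, h.u_uv hp, h.v_uv hp]
  have := h0 p hp
  field_simp
  linear_combination (16 * m p ^ 6 * L) * hε

theorem IsPolarPair.hopf_normalize {Y ψ : M → E} {ε : ℝ} (h : IsPolarPair B φ Y ψ 0 ε)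
    (h0 : ∀ q ∈ φ.source, polarCoeff B φ Y ψ q ≠ 0) (hp : p ∈ φ.source) :
    kappa1 B φ (fun q => (2 * polarCoeff B φ Y ψ q)⁻¹ • ψ q) p =
      ε • kappa2 B φ (fun q => (2 * polarCoeff B φ Y ψ q)⁻¹ • ψ q) p := by
  have hm := h.smooth_coeff
  have hN := h.isNullMap.normalize hm h0
  have e3 := h.uu_sub_vv hp (h0 p hp)
  set m := polarCoeff B φ Y ψ
  clear_value m
  have hw : SmoothIn φ fun q => (2 * m q)⁻¹ :=
    ((SmoothIn.const 2).mul hm).inv fun q hq => mul_ne_zero two_ne_zero (h0 q hq)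
  have key : ∀ w : ℝ × ℝ, dirDeriv φ w (dirDeriv φ w fun q => (2 * m q)⁻¹ • ψ q) p =
      (2 * m p)⁻¹ • (dirDeriv φ w (dirDeriv φ w ψ) p -
        (2 * dirDeriv φ w m p / m p) • dirDeriv φ w ψ p) +
        dirDeriv φ w (dirDeriv φ w fun q => (2 * m q)⁻¹) p • ψ p := by
    intro w
    rw [dirDeriv_congr (fun q hq => dirDeriv_smul hw h.smooth hq w) hp,
      dirDeriv_add (hw.smul (h.smooth.dirDeriv w)) ((hw.dirDeriv w).smul h.smooth) hp,
      dirDeriv_smul hw (h.smooth.dirDeriv w) hp, dirDeriv_smul (hw.dirDeriv w) h.smooth hp,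
      dirDeriv_half_inv hm h0 hp]
    module
  refine IsNormalizedMap.kappa1_eq_smul_kappa2 hN h.sign hp
    (s := 2 * m p * (du φ (du φ fun q => (2 * m q)⁻¹) p - ε * dv φ (dv φ fun q => (2 * m q)⁻¹) p))
    ?_
  have e1 := key (1, 0)
  have e2 := key (0, 1)
  simp only [← du_eq_dirDeriv] at e1
  simp only [← dv_eq_dirDeriv] at e2
  rw [e1, e2]
  rw [sub_eq_iff_eq_add] at e3
  rw [e3]
  have := h0 p hp
  match_scalars <;> field_simp <;> ring

/-- Passing from a map into a space form to its lift `(x, 1)` into the light cone. -/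
theorem IsNullMap.cone {X : M → E} {c : ℝ} {q : M → ℝ} (h : IsNullMap B φ X c q) :
    IsNullMap (coneForm B c) φ (fun p => (X p, (1 : ℝ))) 0 q ∧
    ∀ p ∈ φ.source, du φ (dv φ fun p => (X p, (1 : ℝ))) p = (du φ (dv φ X) p, 0) := by
  have hd : ∀ w : ℝ × ℝ, ∀ p ∈ φ.source,
      dirDeriv φ w (fun p => (X p, (1 : ℝ))) p = (dirDeriv φ w X p, 0) := fun w p hp => by
    rw [dirDeriv_prodMk h.smooth (SmoothIn.const 1) hp, dirDeriv_const]
  refine ⟨⟨?_, h.smooth.prodMk (SmoothIn.const 1), ?_, ?_, ?_, ?_⟩, ?_⟩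
  · intro x y
    change B x.1 y.1 - c * (x.2 * y.2) = B y.1 x.1 - c * (y.2 * x.2)
    rw [h.symm, mul_comm x.2]
  · intro p hp
    change B (X p) (X p) - c * (1 * 1) = 0
    rw [h.len p hp]; ring
  · intro p hp
    rw [du_eq_dirDeriv, hd _ p hp]
    change B (du φ X p) (du φ X p) - c * (0 * 0) = 0
    rw [h.uu p hp]; ring
  · intro p hp
    rw [dv_eq_dirDeriv, hd _ p hp]
    change B (dv φ X p) (dv φ X p) - c * (0 * 0) = 0
    rw [h.vv p hp]; ring
  · intro p hp
    rw [du_eq_dirDeriv, dv_eq_dirDeriv, hd _ p hp, hd _ p hp]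
    change B (du φ X p) (dv φ X p) - c * (0 * 0) = q p
    rw [h.uv p hp]; ring
  · intro p hp
    rw [dv_eq_dirDeriv, du_congr (fun q hq => hd _ q hq) hp, du_eq_dirDeriv,
      dirDeriv_prodMk (h.smooth.dirDeriv (0, 1)) (SmoothIn.const (0 : ℝ)) hp, dirDeriv_const]
    rfl

end Polar

section Charts

variable {M : Type*} [TopologicalSpace M]
variable {E : Type*} [NormedAddCommGroup E] [NormedSpace ℝ E]
variable {φ : OpenPartialHomeomorph M (ℝ × ℝ)} {p : M} {B : LinearMap.BilinForm ℝ E}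

/-- The orientation reversal `(u, v) ↦ (-u, v)` of the coordinate plane. -/
def flipPlane : (ℝ × ℝ) ≃L[ℝ] (ℝ × ℝ) :=
  (ContinuousLinearEquiv.neg ℝ).prodCongr (ContinuousLinearEquiv.refl ℝ ℝ)

/-- The coordinates `(-u, v)`. -/
def flipChart (φ : OpenPartialHomeomorph M (ℝ × ℝ)) : OpenPartialHomeomorph M (ℝ × ℝ) :=
  φ.transHomeomorph flipPlane.toHomeomorph

theorem dirDeriv_flipChart (w : ℝ × ℝ) (F : M → E) (p : M) :
    dirDeriv (flipChart φ) w F p = dirDeriv φ (-w.1, w.2) F p := by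
  have h : F ∘ (flipChart φ).symm = (F ∘ φ.symm) ∘ flipPlane.symm := rfl
  unfold dirDeriv
  rw [h, ContinuousLinearEquiv.comp_right_fderiv]
  have h2 : flipPlane.symm (flipChart φ p) = φ p := flipPlane.symm_apply_apply _
  rw [h2]
  rfl

theorem du_neg (F : M → E) : du φ (fun q => -F q) p = -du φ F p := by
  have h : ((fun q => -F q) ∘ φ.symm) = -(F ∘ φ.symm) := rfl
  simp [du, h, fderiv_neg]

theorem du_flipChart (F : M → E) : du (flipChart φ) F = fun q => -du φ F q := by
  funext q
  rw [du_eq_dirDeriv, dirDeriv_flipChart, du, ← map_neg]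
  simp [dirDeriv]

theorem dv_flipChart (F : M → E) : dv (flipChart φ) F = dv φ F := by
  funext q
  rw [dv_eq_dirDeriv, dirDeriv_flipChart]
  simp [dirDeriv, dv]

theorem du_du_flipChart (F : M → E) :
    du (flipChart φ) (du (flipChart φ) F) = du φ (du φ F) := by
  funext q
  rw [du_flipChart, du_flipChart]
  simp [du_neg]

theorem confTangent_flipChart (Y : M → E) : confTangent (flipChart φ) Y p = confTangent φ Y p := by
  simp only [confTangent, du_flipChart, dv_flipChart]
  ext w
  rw [mem_span_four, mem_span_four]
  constructor
  · rintro ⟨i, j, k, l, rfl⟩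
    exact ⟨i, -j, k, -l, by simp⟩
  · rintro ⟨i, j, k, l, rfl⟩
    exact ⟨i, -j, k, -l, by simp⟩

theorem quadTangent_flipChart (Y : M → E) : quadTangent (flipChart φ) Y p = quadTangent φ Y p := by
  simp only [quadTangent, du_flipChart, dv_flipChart]
  ext w
  rw [mem_span_three, mem_span_three]
  constructor
  · rintro ⟨i, j, k, rfl⟩
    exact ⟨i, -j, k, by simp⟩
  · rintro ⟨i, j, k, rfl⟩
    exact ⟨i, -j, k, by simp⟩

variable [ChartedSpace (ℝ × ℝ) M]

theorem smoothIn_iff (hφ : φ ∈ IsManifold.maximalAtlas 𝓘(ℝ, ℝ × ℝ) ∞ M) {F : M → E} :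
    SmoothIn φ F ↔ ContMDiffOn 𝓘(ℝ, ℝ × ℝ) 𝓘(ℝ, E) ∞ F φ.source := by
  constructor
  · intro h
    have h1 := (contMDiffOn_iff_contDiffOn.2 h).comp (contMDiffOn_of_mem_maximalAtlas hφ)
      φ.mapsTo
    exact h1.congr fun q hq => by simp [φ.left_inv hq]
  · intro h
    exact contMDiffOn_iff_contDiffOn.1
      (h.comp (contMDiffOn_symm_of_mem_maximalAtlas hφ) φ.mapsTo_symm)

theorem flipChart_mem [IsManifold 𝓘(ℝ, ℝ × ℝ) ∞ M]
    (hφ : φ ∈ IsManifold.maximalAtlas 𝓘(ℝ, ℝ × ℝ) ∞ M) :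
    flipChart φ ∈ IsManifold.maximalAtlas 𝓘(ℝ, ℝ × ℝ) ∞ M := by
  refine OpenPartialHomeomorph.mem_maximalAtlas_of_contMDiffOn _ ?_ ?_
  · exact (flipPlane.contDiff.contMDiff).comp_contMDiffOn (contMDiffOn_of_mem_maximalAtlas hφ)
  · exact (contMDiffOn_symm_of_mem_maximalAtlas hφ).comp
      (flipPlane.symm.contDiff.contMDiff.contMDiffOn) fun x hx => hx

theorem restr_mem {U : Set M} (hU : IsOpen U)
    (hφ : φ ∈ IsManifold.maximalAtlas 𝓘(ℝ, ℝ × ℝ) ∞ M) :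
    φ.restr U ∈ IsManifold.maximalAtlas 𝓘(ℝ, ℝ × ℝ) ∞ M :=
  restr_mem_maximalAtlas _ hφ hU

theorem IsCanonicalLift.restr {σ : ℝ} {y : M → Projectivization ℝ E} {Y : M → E}
    (h : IsCanonicalLift B σ φ y Y) {U : Set M} (hU : IsOpen U) :
    IsCanonicalLift B σ (φ.restr U) y Y := by
  have hs : (φ.restr U).source ⊆ φ.source := by
    rw [φ.restr_source' U hU]; exact Set.inter_subset_left
  exact ⟨restr_mem hU h.chart, h.smooth.mono hs, fun p hp => h.lift p (hs hp),
    fun p hp => h.null p (hs hp), fun p hp => h.uu p (hs hp), fun p hp => h.vv p (hs hp),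
    fun p hp => h.uv p (hs hp)⟩

theorem IsAdaptedLift.restr {σ ε : ℝ} {y : M → Projectivization ℝ E} {Y : M → E}
    (h : IsAdaptedLift B σ ε φ y Y) {U : Set M} (hU : IsOpen U) :
    IsAdaptedLift B σ ε (φ.restr U) y Y := by
  refine ⟨h.1.restr hU, fun p hp => h.2 p ?_⟩
  rw [φ.restr_source' U hU] at hp
  exact hp.1

variable [IsManifold 𝓘(ℝ, ℝ × ℝ) ∞ M]

theorem IsAdaptedLift.flip {σ ε : ℝ} {y : M → Projectivization ℝ E} {Y : M → E}
    (h : IsAdaptedLift B σ ε φ y Y) : IsAdaptedLift B (-σ) ε (flipChart φ) y Y := by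
  refine ⟨⟨flipChart_mem h.1.chart, h.1.smooth, h.1.lift, h.1.null, ?_, ?_, ?_⟩, ?_⟩
  · intro p hp
    simpa [du_flipChart] using h.1.uu p hp
  · intro p hp
    simpa [dv_flipChart] using h.1.vv p hp
  · intro p hp
    have := h.1.uv p hp
    simp only [du_flipChart, dv_flipChart, map_neg, LinearMap.neg_apply, this]
    ring
  · intro p hp
    simp only [kappa1, kappa2, confTangent_flipChart, du_du_flipChart, dv_flipChart]
    exact h.2 p hp

theorem IsQuadAdapted.flip {σ ε : ℝ} {x : M → E} (h : IsQuadAdapted B σ ε φ x) :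
    IsQuadAdapted B (-σ) ε (flipChart φ) x := by
  refine ⟨flipChart_mem h.chart, ?_, ?_, ?_, ?_⟩
  · intro p hp
    simpa [du_flipChart] using h.uu p hp
  · intro p hp
    simpa [dv_flipChart] using h.vv p hp
  · intro p hp
    have := h.uv p hp
    simpa only [du_flipChart, dv_flipChart, map_neg, LinearMap.neg_apply, neg_mul_neg] using this
  · intro p hp
    simp only [omega1, omega2, quadTangent_flipChart, du_du_flipChart, dv_flipChart]
    exact h.hopf p hp

theorem mfderiv_symm_apply (hφ : φ ∈ IsManifold.maximalAtlas 𝓘(ℝ, ℝ × ℝ) ∞ M) {F : M → E}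
    (hF : SmoothIn φ F) (hp : p ∈ φ.source) (w : ℝ × ℝ) :
    mfderiv 𝓘(ℝ, ℝ × ℝ) 𝓘(ℝ, E) F (φ.symm (φ p))
      (mfderiv 𝓘(ℝ, ℝ × ℝ) 𝓘(ℝ, ℝ × ℝ) φ.symm (φ p) w) = dirDeriv φ w F p := by
  have hd : MDifferentiableAt 𝓘(ℝ, ℝ × ℝ) 𝓘(ℝ, E) F (φ.symm (φ p)) := by
    rw [φ.left_inv hp]
    exact (((smoothIn_iff hφ).1 hF).contMDiffAt
      (φ.open_source.mem_nhds hp)).mdifferentiableAt (by simp)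
  have hs : MDifferentiableAt 𝓘(ℝ, ℝ × ℝ) 𝓘(ℝ, ℝ × ℝ) φ.symm (φ p) :=
    (contMDiffAt_symm_of_mem_maximalAtlas hφ (φ.map_source hp)).mdifferentiableAt (by simp)
  have h := mfderiv_comp (φ p) hd hs
  rw [mfderiv_eq_fderiv] at h
  unfold dirDeriv
  rw [h]
  rfl

/-- Every coordinate vector is represented by a tangent vector. -/
theorem exists_tangent (hφ : φ ∈ IsManifold.maximalAtlas 𝓘(ℝ, ℝ × ℝ) ∞ M) (hp : p ∈ φ.source)
    (w : ℝ × ℝ) : ∃ X : TangentSpace 𝓘(ℝ, ℝ × ℝ) p, (w ≠ 0 → X ≠ 0) ∧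
      ∀ F : M → E, SmoothIn φ F →
        (mfderiv 𝓘(ℝ, ℝ × ℝ) 𝓘(ℝ, E) F p X : E) = dirDeriv φ w F p := by
  have key : ∃ X : TangentSpace 𝓘(ℝ, ℝ × ℝ) (φ.symm (φ p)), (w ≠ 0 → X ≠ 0) ∧
      ∀ F : M → E, SmoothIn φ F →
        (mfderiv 𝓘(ℝ, ℝ × ℝ) 𝓘(ℝ, E) F (φ.symm (φ p)) X : E) = dirDeriv φ w F p := by
    refine ⟨mfderiv 𝓘(ℝ, ℝ × ℝ) 𝓘(ℝ, ℝ × ℝ) φ.symm (φ p) w, ?_,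
      fun F hF => mfderiv_symm_apply hφ hF hp w⟩
    intro hw h0
    have hs : SmoothIn φ φ := contDiffOn_id.congr fun x hx => φ.right_inv hx
    have h1 := mfderiv_symm_apply hφ hs hp w
    have h2 : dirDeriv φ w φ p = w := by
      have : φ ∘ φ.symm =ᶠ[nhds (φ p)] id := by
        filter_upwards [φ.open_target.mem_nhds (φ.map_source hp)] with x hx
        exact φ.right_inv hx
      rw [dirDeriv, this.fderiv_eq, fderiv_id]
      rfl
    rw [h0, h2] at h1
    exact hw (h1.symm.trans (map_zero _))
  rw [φ.left_inv hp] at key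
  exact key

theorem isLorentzianAt_of_null (hφ : φ ∈ IsManifold.maximalAtlas 𝓘(ℝ, ℝ × ℝ) ∞ M) {F : M → E}
    (hB : ∀ x y, B x y = B y x) (hF : SmoothIn φ F) (hp : p ∈ φ.source)
    (huu : B (du φ F p) (du φ F p) = 0) (hvv : B (dv φ F p) (dv φ F p) = 0)
    (huv : B (du φ F p) (dv φ F p) ≠ 0) : IsLorentzianAt B F p := by
  set s := B (du φ F p) (dv φ F p) with hs
  have hd : ∀ t : ℝ, dirDeriv φ (1, t) F p = du φ F p + t • dv φ F p := by
    intro t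
    have : ((1, t) : ℝ × ℝ) = (1, 0) + t • (0, 1) := by simp
    rw [dirDeriv, this, map_add, map_smul]
    rfl
  have hq : ∀ t : ℝ, B (dirDeriv φ (1, t) F p) (dirDeriv φ (1, t) F p) = 2 * t * s := by
    intro t
    rw [hd]
    simp only [map_add, map_smul, LinearMap.add_apply, LinearMap.smul_apply, smul_eq_mul, huu, hvv,
      hB (dv φ F p) (du φ F p), ← hs]
    ring
  have hpos : 0 < s ^ 2 := by positivity
  obtain ⟨X, -, hX⟩ := exists_tangent (E := E) hφ hp (1, s)
  obtain ⟨X', -, hX'⟩ := exists_tangent (E := E) hφ hp (1, -s)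
  refine ⟨X, X', ?_, ?_⟩
  · have := hq s
    rw [← hX F hF] at this
    refine lt_of_lt_of_eq ?_ this.symm
    nlinarith
  · have := hq (-s)
    rw [← hX' F hF] at this
    refine lt_of_eq_of_lt this ?_
    nlinarith

end Charts

section Lifts

variable {M : Type*} [TopologicalSpace M] [ChartedSpace (ℝ × ℝ) M]
variable {E : Type*} [NormedAddCommGroup E] [NormedSpace ℝ E]
variable {φ : OpenPartialHomeomorph M (ℝ × ℝ)} {p : M} {B : LinearMap.BilinForm ℝ E}
variable {σ : ℝ} {y : M → Projectivization ℝ E} {Y : M → E}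

theorem IsCanonicalLift.normalized (h : IsCanonicalLift B σ φ y Y) (hB : ∀ x y, B x y = B y x) :
    IsNormalizedMap B σ φ Y :=
  ⟨hB, (smoothIn_iff h.chart).2 h.smooth, h.null, h.uu, h.vv, h.uv⟩

theorem IsNormalizedMap.isCanonicalLift (h : IsNormalizedMap B σ φ Y)
    (hφ : φ ∈ IsManifold.maximalAtlas 𝓘(ℝ, ℝ × ℝ) ∞ M) (hl : IsLiftOn y Y φ.source) :
    IsCanonicalLift B σ φ y Y :=
  ⟨hφ, (smoothIn_iff hφ).1 h.smooth, hl, h.len, h.uu, h.vv, h.uv⟩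

theorem proj_eq_mk [Nontrivial E] {x : E} (hx : x ≠ 0) : proj x = Projectivization.mk ℝ x hx :=
  dif_pos hx

theorem isLiftOn_smul [Nontrivial E] {U : Set M} {X : M → E} {w : M → ℝ}
    (hX : ∀ p ∈ U, X p ≠ 0) (hw : ∀ p ∈ U, w p ≠ 0) :
    IsLiftOn (fun p => proj (X p)) (fun p => w p • X p) U := by
  intro p hp
  refine ⟨smul_ne_zero (hw p hp) (hX p hp), ?_⟩
  change _ = proj (X p)
  rw [proj_eq_mk (hX p hp), Projectivization.mk_eq_mk_iff']
  exact ⟨w p, rfl⟩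

theorem proj_mem_projCone [Nontrivial E] {x : E} (hx : x ≠ 0) (h : B x x = 0) :
    proj x ∈ projCone B := by
  rw [proj_eq_mk hx]
  obtain ⟨a, ha⟩ := Projectivization.exists_smul_eq_mk_rep ℝ x hx
  have h' : (a : ℝ) • x = (Projectivization.mk ℝ x hx).rep := ha
  change B (Projectivization.mk ℝ x hx).rep (Projectivization.mk ℝ x hx).rep = 0
  rw [← h']
  simp [h]

variable [FiniteDimensional ℝ E]

theorem IsPolarTransform.isPolarPair {c ε : ℝ} {ψ : M → E} (hψ : IsPolarTransform B c y ψ)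
    (hB : ∀ x y, B x y = B y x) (hε : ε ^ 2 = 1) (h : IsAdaptedLift B 1 ε φ y Y) :
    IsPolarPair B φ Y ψ c ε := by
  have hn := h.1.normalized hB
  have hmem : ∀ {p : M} {w : E}, p ∈ φ.source → normalPart B (confTangent φ Y p) w = 0 →
      w ∈ confTangent φ Y p := fun {p w} hp hw => by
    have := (normalPart_spec hB (hn.confTangent_inf (by norm_num) hp) w).2
    rwa [hw, sub_zero] at this
  exact ⟨hn, hε, h.2, (smoothIn_iff h.1.chart).2 hψ.smooth.contMDiffOn, fun p _ => hψ.length p,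
    hψ.normal φ Y h.1, fun p hp => hmem hp (hψ.parallel φ Y h.1 p hp).1,
    fun p hp => hmem hp (hψ.parallel φ Y h.1 p hp).2⟩

namespace IsPolarPair

variable {ψ : M → E} {c ε : ℝ}

theorem sign_ne_zero (h : IsPolarPair B φ Y ψ c ε) : ε ≠ 0 := by
  rintro rfl; simpa using h.sign

theorem ne_zero (h0 : polarCoeff B φ Y ψ p ≠ 0) : ψ p ≠ 0 := by
  intro h
  simp [polarCoeff, h] at h0

theorem isQuadAdapted (h : IsPolarPair B φ Y ψ c ε) (hc : c ≠ 0)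
    (hφ : φ ∈ IsManifold.maximalAtlas 𝓘(ℝ, ℝ × ℝ) ∞ M)
    (h0 : ∀ q ∈ φ.source, polarCoeff B φ Y ψ q ≠ 0) : IsQuadAdapted B ε ε φ ψ := by
  have hn := h.isNullMap
  refine ⟨hφ, hn.uu, hn.vv, fun p hp => ?_, fun p hp => h.omega1_eq_smul_omega2 hc hp (h0 p hp)⟩
  rw [hn.uv p hp]
  have := h0 p hp
  have e : ε * (2 * ε * polarCoeff B φ Y ψ p ^ 2) = ε ^ 2 * (2 * polarCoeff B φ Y ψ p ^ 2) := by
    ring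
  rw [e, h.sign]
  positivity

theorem isCanonicalLift [Nontrivial E] (h : IsPolarPair B φ Y ψ 0 ε)
    (hφ : φ ∈ IsManifold.maximalAtlas 𝓘(ℝ, ℝ × ℝ) ∞ M)
    (h0 : ∀ q ∈ φ.source, polarCoeff B φ Y ψ q ≠ 0) :
    IsCanonicalLift B ε φ (fun p => proj (ψ p)) fun q => (2 * polarCoeff B φ Y ψ q)⁻¹ • ψ q :=
  (h.isNullMap.normalize h.smooth_coeff h0).isCanonicalLift hφ
    (isLiftOn_smul (fun p hp => ne_zero (h0 p hp)) fun p hp => by simpa using h0 p hp)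

theorem isAdaptedLift [Nontrivial E] (h : IsPolarPair B φ Y ψ 0 ε)
    (hφ : φ ∈ IsManifold.maximalAtlas 𝓘(ℝ, ℝ × ℝ) ∞ M)
    (h0 : ∀ q ∈ φ.source, polarCoeff B φ Y ψ q ≠ 0) :
    IsAdaptedLift B ε ε φ (fun p => proj (ψ p)) fun q => (2 * polarCoeff B φ Y ψ q)⁻¹ • ψ q :=
  ⟨h.isCanonicalLift hφ h0, fun _ hp => h.hopf_normalize h0 hp⟩

theorem isCanonicalLift_cone (h : IsPolarPair B φ Y ψ c ε) [Nontrivial E]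
    (hφ : φ ∈ IsManifold.maximalAtlas 𝓘(ℝ, ℝ × ℝ) ∞ M)
    (h0 : ∀ q ∈ φ.source, polarCoeff B φ Y ψ q ≠ 0) :
    IsCanonicalLift (coneForm B c) ε φ (fun p => proj (ψ p, (1 : ℝ)))
      fun q => (2 * polarCoeff B φ Y ψ q)⁻¹ • (ψ q, (1 : ℝ)) :=
  (h.isNullMap.cone.1.normalize h.smooth_coeff h0).isCanonicalLift hφ
    (isLiftOn_smul (X := fun p => (ψ p, (1 : ℝ))) (fun p _ => by simp)
      fun p hp => by simpa using h0 p hp)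

/-- The coefficient of the conformal metric of the polar surface. -/
def metric (B : LinearMap.BilinForm ℝ E) (φ : OpenPartialHomeomorph M (ℝ × ℝ)) (Y ψ : M → E)
    (p : M) : ℝ :=
  metricCoeff B 1 φ Y p +
    dv φ (fun q => du φ (polarCoeff B φ Y ψ) q / polarCoeff B φ Y ψ q) p

theorem metricCoeff_lift (h : IsPolarPair B φ Y ψ 0 ε)
    (h0 : ∀ q ∈ φ.source, polarCoeff B φ Y ψ q ≠ 0) (hp : p ∈ φ.source) :
    metricCoeff B ε φ (fun q => (2 * polarCoeff B φ Y ψ q)⁻¹ • ψ q) p = metric B φ Y ψ p := by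
  have := h0 p hp
  rw [h.isNullMap.metricCoeff_normalize h.sign h.smooth_coeff h0 hp, h.bilin_uv_uv hp, metric]
  congr 1
  field_simp

theorem metricCoeff_cone (h : IsPolarPair B φ Y ψ c ε)
    (h0 : ∀ q ∈ φ.source, polarCoeff B φ Y ψ q ≠ 0) (hp : p ∈ φ.source) :
    metricCoeff (coneForm B c) ε φ
      (fun q => (2 * polarCoeff B φ Y ψ q)⁻¹ • (ψ q, (1 : ℝ))) p = metric B φ Y ψ p := by
  have := h0 p hp
  rw [h.isNullMap.cone.1.metricCoeff_normalize h.sign h.smooth_coeff h0 hp,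
    h.isNullMap.cone.2 p hp, metric]
  have e : coneForm B c (du φ (dv φ ψ) p, 0) (du φ (dv φ ψ) p, 0) =
      B (du φ (dv φ ψ) p) (du φ (dv φ ψ) p) - c * (0 * 0) := rfl
  rw [e, mul_zero, mul_zero, sub_zero, h.bilin_uv_uv hp]
  congr 1
  field_simp

theorem bilin_confDu_kappa1 (h : IsPolarPair B φ Y ψ c ε) (hp : p ∈ φ.source) :
    B (ψ p) (confDu B φ Y (kappa1 B φ Y) p) = du φ (polarCoeff B φ Y ψ) p := by
  have hn := h.normalized
  have hk := hn.smooth_kappa1 (by norm_num)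
  have h1 := dirDeriv_bilin_eq h.smooth hk (fun q hq => h.bilin_kappa1 hq) hp (1, 0)
  change B (du φ ψ p) (kappa1 B φ Y p) + B (ψ p) (du φ (kappa1 B φ Y) p) = _ at h1
  have h2 : B (du φ ψ p) (kappa1 B φ Y p) = 0 :=
    (normalPart_spec hn.symm (hn.confTangent_inf (by norm_num) hp) _).1 _ (h.du_mem p hp)
  rw [confDu, bilin_normalPart hn.symm (hn.confTangent_inf (by norm_num) hp) (h.normal p hp)]
  rw [h2, zero_add] at h1
  exact h1

theorem isParallelMinimalSection (h : IsPolarPair B φ Y ψ c ε) (hc : c ≠ 0)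
    (hφ : φ ∈ IsManifold.maximalAtlas 𝓘(ℝ, ℝ × ℝ) ∞ M)
    (h0 : ∀ q ∈ φ.source, polarCoeff B φ Y ψ q ≠ 0) (hY : ∀ q ∈ φ.source, Y q ≠ 0) :
    IsParallelMinimalSection B φ ψ fun q => (polarCoeff B φ Y ψ q)⁻¹ • Y q := by
  have hn := h.isNullMap
  have hε := h.sign_ne_zero
  have hnd : ∀ p ∈ φ.source,
      quadTangent φ ψ p ⊓ B.orthogonal (quadTangent φ ψ p) = ⊥ := fun p hp =>
    hn.quadTangent_inf hc hp (by have := h0 p hp; positivity)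
  have hnormal : ∀ p ∈ φ.source,
      (polarCoeff B φ Y ψ p)⁻¹ • Y p ∈ B.orthogonal (quadTangent φ ψ p) := fun p hp =>
    Submodule.smul_mem _ _ (mem_orthogonal_three.2
      ⟨(h.Y_normal hp).1, (h.Y_normal hp).2.1, (h.Y_normal hp).2.2.1⟩)
  refine ⟨(smoothIn_iff hφ).1 ((h.smooth_coeff.inv h0).smul h.normalized.smooth),
    fun p hp => smul_ne_zero (inv_ne_zero (h0 p hp)) (hY p hp), hnormal, ?_, ?_, ?_⟩ <;>
    intro p hp
  · rw [h.du_dual h0 hp]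
    exact normalPart_eq_zero (hnd p hp)
      (Submodule.smul_mem _ _ (Submodule.subset_span (by simp)))
  · rw [h.dv_dual h0 hp]
    exact normalPart_eq_zero (hnd p hp)
      (Submodule.smul_mem _ _ (Submodule.subset_span (by simp)))
  · rw [meanCurvature, map_smul, bilin_normalPart hn.symm (hnd p hp) (hnormal p hp), map_smul,
      LinearMap.smul_apply, h.bilin_Y_uv hp]
    simp

theorem conformal_parallel (h : IsPolarPair B φ Y ψ 0 ε)
    (h0 : ∀ q ∈ φ.source, polarCoeff B φ Y ψ q ≠ 0) (hp : p ∈ φ.source) :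
    (polarCoeff B φ Y ψ p)⁻¹ • Y p ∈ B.orthogonal (confTangent φ ψ p) ∧
      confDu B φ ψ (fun q => (polarCoeff B φ Y ψ q)⁻¹ • Y q) p = 0 ∧
      confDv B φ ψ (fun q => (polarCoeff B φ Y ψ q)⁻¹ • Y q) p = 0 := by
  have hε := h.sign_ne_zero
  have hnd := h.isNullMap.confTangent_inf hp (by have := h0 p hp; positivity)
  refine ⟨Submodule.smul_mem _ _ (mem_orthogonal_four.2 (h.Y_normal hp)), ?_, ?_⟩
  · rw [confDu, h.du_dual h0 hp]
    exact normalPart_eq_zero hnd (Submodule.smul_mem _ _ (Submodule.subset_span (by simp)))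
  · rw [confDv, h.dv_dual h0 hp]
    exact normalPart_eq_zero hnd (Submodule.smul_mem _ _ (Submodule.subset_span (by simp)))

end IsPolarPair

end Lifts

section Transition

variable {M : Type*} [TopologicalSpace M]
variable {E : Type*} [NormedAddCommGroup E] [NormedSpace ℝ E]
variable {φ φ' : OpenPartialHomeomorph M (ℝ × ℝ)} {p : M} {B : LinearMap.BilinForm ℝ E}

/-- Derivative at `p` of the coordinate change from `φ` to `φ'`. -/
def coordChange (φ φ' : OpenPartialHomeomorph M (ℝ × ℝ)) (p : M) : (ℝ × ℝ) →L[ℝ] (ℝ × ℝ) :=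
  fderiv ℝ (φ' ∘ φ.symm) (φ p)

theorem det_eq (L : (ℝ × ℝ) →L[ℝ] (ℝ × ℝ)) :
    L.det = (L (1, 0)).1 * (L (0, 1)).2 - (L (1, 0)).2 * (L (0, 1)).1 := by
  rw [ContinuousLinearMap.det, ← LinearMap.det_toMatrix (Module.Basis.finTwoProd ℝ), Matrix.det_fin_two]
  simp [LinearMap.toMatrix_apply]
  ring

theorem dirDeriv_eq (w : ℝ × ℝ) (F : M → E) :
    dirDeriv φ w F p = w.1 • du φ F p + w.2 • dv φ F p := by
  have : w = w.1 • ((1, 0) : ℝ × ℝ) + w.2 • ((0, 1) : ℝ × ℝ) := by ext <;> simp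
  conv_lhs => rw [this, dirDeriv, map_add, map_smul, map_smul]
  rfl

theorem dirDeriv_change (hφ' : SmoothIn φ φ') (hp : p ∈ φ.source) (hp' : p ∈ φ'.source)
    {F : M → E} (hF : SmoothIn φ' F) (w : ℝ × ℝ) :
    dirDeriv φ w F p =
      (dirDeriv φ w φ' p).1 • du φ' F p + (dirDeriv φ w φ' p).2 • dv φ' F p := by
  rw [← dirDeriv_eq]
  have hev : F ∘ φ.symm =ᶠ[nhds (φ p)] (F ∘ φ'.symm) ∘ (φ' ∘ φ.symm) := by
    have h1 : φ.symm ⁻¹' φ'.source ∈ nhds (φ p) :=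
      (φ.continuousAt_symm (φ.map_source hp)).preimage_mem_nhds
        (φ'.open_source.mem_nhds (by rwa [φ.left_inv hp]))
    filter_upwards [h1] with x hx
    simp only [Function.comp_apply, φ'.left_inv hx]
  have e : (φ' ∘ φ.symm) (φ p) = φ' p := by simp [φ.left_inv hp]
  have h2 := fderiv_comp (φ p) (g := F ∘ φ'.symm) (f := φ' ∘ φ.symm)
    (by rw [e]; exact hF.differentiableAt hp') (hφ'.differentiableAt hp)
  unfold dirDeriv
  rw [hev.fderiv_eq, h2, e]
  rfl

variable [ChartedSpace (ℝ × ℝ) M]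

theorem SmoothIn.change (hφ : φ ∈ IsManifold.maximalAtlas 𝓘(ℝ, ℝ × ℝ) ∞ M)
    (hφ' : φ' ∈ IsManifold.maximalAtlas 𝓘(ℝ, ℝ × ℝ) ∞ M) (hs : φ.source = φ'.source)
    {F : M → E} (hF : SmoothIn φ F) : SmoothIn φ' F := by
  rw [smoothIn_iff hφ', ← hs]
  exact (smoothIn_iff hφ).1 hF

theorem smoothIn_chart (hφ : φ ∈ IsManifold.maximalAtlas 𝓘(ℝ, ℝ × ℝ) ∞ M)
    (hφ' : φ' ∈ IsManifold.maximalAtlas 𝓘(ℝ, ℝ × ℝ) ∞ M) (hs : φ.source = φ'.source) :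
    SmoothIn φ φ' := by
  rw [smoothIn_iff hφ, hs]
  exact contMDiffOn_of_mem_maximalAtlas hφ'

/-- The coordinate change from `φ` to `φ'` at `p` is conformal for the form `du dv`, with positive
factor `l⁻²`. -/
structure IsConformalChange (φ φ' : OpenPartialHomeomorph M (ℝ × ℝ)) (l : ℝ) (p : M) : Prop where
  uu : (du φ φ' p).1 * (du φ φ' p).2 = 0
  vv : (dv φ φ' p).1 * (dv φ φ' p).2 = 0
  uv : l ^ 2 * ((du φ φ' p).1 * (dv φ φ' p).2 + (du φ φ' p).2 * (dv φ φ' p).1) = 1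

namespace IsConformalChange

variable {l : ℝ}

theorem fst (h : IsConformalChange φ φ' l p) : (du φ φ' p).1 * (dv φ φ' p).1 = 0 := by
  have h1 := h.uu
  have h2 := h.vv
  have h3 := h.uv
  set a := (du φ φ' p).1
  set b := (du φ φ' p).2
  set c := (dv φ φ' p).1
  set d := (dv φ φ' p).2
  linear_combination (-a * c) * h3 + l ^ 2 * a ^ 2 * h2 + l ^ 2 * c ^ 2 * h1

theorem snd (h : IsConformalChange φ φ' l p) : (du φ φ' p).2 * (dv φ φ' p).2 = 0 := by
  have h1 := h.uu
  have h2 := h.vv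
  have h3 := h.uv
  set a := (du φ φ' p).1
  set b := (du φ φ' p).2
  set c := (dv φ φ' p).1
  set d := (dv φ φ' p).2
  linear_combination (-b * d) * h3 + l ^ 2 * b ^ 2 * h2 + l ^ 2 * d ^ 2 * h1

theorem l_ne_zero (h : IsConformalChange φ φ' l p) : l ≠ 0 := by
  rintro rfl
  simpa using h.uv

theorem factor_pos (h : IsConformalChange φ φ' l p) :
    0 < (du φ φ' p).1 * (dv φ φ' p).2 + (du φ φ' p).2 * (dv φ φ' p).1 := by
  have h3 := h.uv
  have : 0 < l ^ 2 := sq_pos_of_ne_zero h.l_ne_zero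
  by_contra hn
  nlinarith

theorem abs_det (h : IsConformalChange φ φ' l p) : |(coordChange φ φ' p).det| =
    (du φ φ' p).1 * (dv φ φ' p).2 + (du φ φ' p).2 * (dv φ φ' p).1 := by
  have h1 : (coordChange φ φ' p).det =
      (du φ φ' p).1 * (dv φ φ' p).2 - (du φ φ' p).2 * (dv φ φ' p).1 := det_eq _
  have h2 := h.uu
  rw [h1, ← abs_of_pos h.factor_pos, ← sq_eq_sq_iff_abs_eq_abs]
  linear_combination -4 * (dv φ φ' p).1 * (dv φ φ' p).2 * h2

end IsConformalChange

variable [FiniteDimensional ℝ E] {σ : ℝ} {Y Y' : M → E} {l : M → ℝ}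

/-- Ratio of two normalized lifts. -/
theorem exists_ratio (hφ : φ ∈ IsManifold.maximalAtlas 𝓘(ℝ, ℝ × ℝ) ∞ M)
    (hφ' : φ' ∈ IsManifold.maximalAtlas 𝓘(ℝ, ℝ × ℝ) ∞ M) (hs : φ.source = φ'.source)
    (hσ : σ ^ 2 = 1) (h : IsNormalizedMap B σ φ Y) (h' : IsNormalizedMap B σ φ' Y')
    (hr : ∀ q ∈ φ'.source, ∃ r : ℝ, Y q = r • Y' q) :
    ∃ l : M → ℝ, SmoothIn φ' l ∧ ∀ q ∈ φ'.source, Y q = l q • Y' q := by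
  refine ⟨fun q => (-2 * σ) * B (Y q) (du φ' (dv φ' Y') q),
    (SmoothIn.const _).mul ((h.smooth.change hφ hφ' hs).bilin B h'.smooth.dv.du), fun q hq => ?_⟩
  obtain ⟨r, hr⟩ := hr q hq
  suffices hrl : r = (-2 * σ) * B (Y q) (du φ' (dv φ' Y') q) by
    change Y q = ((-2 * σ) * B (Y q) (du φ' (dv φ' Y') q)) • Y' q
    rw [← hrl]
    exact hr
  rw [hr, map_smul, LinearMap.smul_apply, h'.x_uv hq, smul_eq_mul]
  linear_combination -r * hσ

theorem isConformalChange (hφ : φ ∈ IsManifold.maximalAtlas 𝓘(ℝ, ℝ × ℝ) ∞ M)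
    (hφ' : φ' ∈ IsManifold.maximalAtlas 𝓘(ℝ, ℝ × ℝ) ∞ M) (hs : φ.source = φ'.source)
    (hσ : σ ^ 2 = 1) (h : IsNormalizedMap B σ φ Y) (h' : IsNormalizedMap B σ φ' Y')
    (hl : SmoothIn φ' l) (hY : ∀ q ∈ φ'.source, Y q = l q • Y' q) (hp' : p ∈ φ'.source) :
    IsConformalChange φ φ' (l p) p := by
  have hp : p ∈ φ.source := hs ▸ hp'
  have hσ0 : σ ≠ 0 := by rintro rfl; simp at hσ
  have key : ∀ w, dirDeriv φ w Y p =
      (dirDeriv φ w φ' p).1 • (l p • du φ' Y' p + du φ' l p • Y' p) +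
      (dirDeriv φ w φ' p).2 • (l p • dv φ' Y' p + dv φ' l p • Y' p) := fun w => by
    rw [dirDeriv_change (smoothIn_chart hφ hφ' hs) hp hp' (h.smooth.change hφ hφ' hs),
      du_congr hY hp', dv_congr hY hp', du_eq_dirDeriv, dv_eq_dirDeriv,
      dirDeriv_smul hl h'.smooth hp', dirDeriv_smul hl h'.smooth hp']
    rfl
  have key2 : ∀ w w', B (dirDeriv φ w Y p) (dirDeriv φ w' Y p) = σ / 2 * l p ^ 2 *
      ((dirDeriv φ w φ' p).1 * (dirDeriv φ w' φ' p).2 +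
        (dirDeriv φ w φ' p).2 * (dirDeriv φ w' φ' p).1) := fun w w' => by
    rw [key, key]
    simp only [map_add, map_smul, LinearMap.add_apply, LinearMap.smul_apply, smul_eq_mul,
      h'.symm _ (Y' p), h'.symm (dv φ' Y' p) (du φ' Y' p), h'.len p hp', h'.x_u hp', h'.x_v hp',
      h'.uu p hp', h'.vv p hp', h'.uv p hp']
    ring
  have huu := (key2 (1, 0) (1, 0)).symm.trans (h.uu p hp)
  have hvv := (key2 (0, 1) (0, 1)).symm.trans (h.vv p hp)
  have huv := (key2 (1, 0) (0, 1)).symm.trans (h.uv p hp)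
  simp only [← du_eq_dirDeriv, ← dv_eq_dirDeriv] at huu hvv huv
  have h3 : l p ^ 2 * ((du φ φ' p).1 * (dv φ φ' p).2 + (du φ φ' p).2 * (dv φ φ' p).1) = 1 := by
    have h2 : σ / 2 ≠ 0 := by positivity
    apply mul_left_cancel₀ h2
    rw [← mul_assoc, huv, mul_one]
  have hl0 : l p ≠ 0 := by
    intro h0
    rw [h0] at h3
    simp at h3
  have hne : σ / 2 * l p ^ 2 ≠ 0 := by positivity
  refine ⟨?_, ?_, h3⟩
  · have := (mul_eq_zero.1 huu).resolve_left hne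
    linarith
  · have := (mul_eq_zero.1 hvv).resolve_left hne
    linarith

theorem dirDeriv_dirDeriv_change (hφ : φ ∈ IsManifold.maximalAtlas 𝓘(ℝ, ℝ × ℝ) ∞ M)
    (hφ' : φ' ∈ IsManifold.maximalAtlas 𝓘(ℝ, ℝ × ℝ) ∞ M) (hs : φ.source = φ'.source)
    (hY' : SmoothIn φ' Y') (hl : SmoothIn φ' l) (hY : ∀ q ∈ φ'.source, Y q = l q • Y' q)
    (hp' : p ∈ φ'.source) (w : ℝ × ℝ) :
    ∃ i j k : ℝ, dirDeriv φ w (dirDeriv φ w Y) p =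
      (l p * (dirDeriv φ w φ' p).1 ^ 2) • du φ' (du φ' Y') p +
      (2 * l p * ((dirDeriv φ w φ' p).1 * (dirDeriv φ w φ' p).2)) • du φ' (dv φ' Y') p +
      (l p * (dirDeriv φ w φ' p).2 ^ 2) • dv φ' (dv φ' Y') p +
      i • Y' p + j • du φ' Y' p + k • dv φ' Y' p := by
  have hp : p ∈ φ.source := hs ▸ hp'
  have hc := smoothIn_chart hφ hφ' hs
  have hYs : SmoothIn φ' Y := (hl.smul hY').congr hY
  have h1 : ∀ q ∈ φ.source, dirDeriv φ w Y q =
      (dirDeriv φ w φ' q).1 • du φ' Y q + (dirDeriv φ w φ' q).2 • dv φ' Y q := fun q hq =>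
    dirDeriv_change hc hq (hs ▸ hq) hYs w
  have ha : SmoothIn φ fun q => (dirDeriv φ w φ' q).1 :=
    ContDiffOn.fst (hc.dirDeriv w)
  have hb : SmoothIn φ fun q => (dirDeriv φ w φ' q).2 :=
    ContDiffOn.snd (hc.dirDeriv w)
  have hu := hYs.du.change hφ' hφ hs.symm
  have hv := hYs.dv.change hφ' hφ hs.symm
  rw [dirDeriv_congr h1 hp, dirDeriv_add (ha.smul hu) (hb.smul hv) hp, dirDeriv_smul ha hu hp,
    dirDeriv_smul hb hv hp, dirDeriv_change hc hp hp' hYs.du, dirDeriv_change hc hp hp' hYs.dv,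
    du_dv_comm hYs hp']
  have key1 : ∀ w, ∀ q ∈ φ'.source,
      dirDeriv φ' w Y q = l q • dirDeriv φ' w Y' q + dirDeriv φ' w l q • Y' q :=
    fun w q hq => by rw [dirDeriv_congr hY hq, dirDeriv_smul hl hY' hq]
  have key : ∀ w w', dirDeriv φ' w (dirDeriv φ' w' Y) p =
      l p • dirDeriv φ' w (dirDeriv φ' w' Y') p + dirDeriv φ' w l p • dirDeriv φ' w' Y' p +
      (dirDeriv φ' w' l p • dirDeriv φ' w Y' p + dirDeriv φ' w (dirDeriv φ' w' l) p • Y' p) :=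
    fun w w' => by
      rw [dirDeriv_congr (key1 w') hp', dirDeriv_add (hl.smul (hY'.dirDeriv w'))
        ((hl.dirDeriv w').smul hY') hp', dirDeriv_smul hl (hY'.dirDeriv w') hp',
        dirDeriv_smul (hl.dirDeriv w') hY' hp']
  simp only [du_eq_dirDeriv, dv_eq_dirDeriv, key, key1 _ p hp']
  generalize dirDeriv φ' (1, 0) (dirDeriv φ' (1, 0) Y') p = Y11
  generalize dirDeriv φ' (1, 0) (dirDeriv φ' (0, 1) Y') p = Y12
  generalize dirDeriv φ' (0, 1) (dirDeriv φ' (0, 1) Y') p = Y22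
  generalize dirDeriv φ' (1, 0) Y' p = Y1
  generalize dirDeriv φ' (0, 1) Y' p = Y2
  generalize dirDeriv φ w φ' p = z
  obtain ⟨a, b⟩ := z
  generalize dirDeriv φ w (fun q => (dirDeriv φ w φ' q).1) p = a'
  generalize dirDeriv φ w (fun q => (dirDeriv φ w φ' q).2) p = b'
  generalize dirDeriv φ' (1, 0) (dirDeriv φ' (1, 0) l) p = l11
  generalize dirDeriv φ' (1, 0) (dirDeriv φ' (0, 1) l) p = l12
  generalize dirDeriv φ' (0, 1) (dirDeriv φ' (0, 1) l) p = l22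
  generalize dirDeriv φ' (1, 0) l p = l1
  generalize dirDeriv φ' (0, 1) l p = l2
  refine ⟨a ^ 2 * l11 + 2 * a * b * l12 + b ^ 2 * l22 + a' * l1 + b' * l2,
    2 * a ^ 2 * l1 + 2 * a * b * l2 + a' * l p, 2 * a * b * l1 + 2 * b ^ 2 * l2 + b' * l p, ?_⟩
  module

theorem bilin_uu_vv_change (hφ : φ ∈ IsManifold.maximalAtlas 𝓘(ℝ, ℝ × ℝ) ∞ M)
    (hφ' : φ' ∈ IsManifold.maximalAtlas 𝓘(ℝ, ℝ × ℝ) ∞ M) (hs : φ.source = φ'.source)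
    (hσ : σ ^ 2 = 1) (h : IsNormalizedMap B σ φ Y) (h' : IsNormalizedMap B σ φ' Y')
    (hl : SmoothIn φ' l) (hY : ∀ q ∈ φ'.source, Y q = l q • Y' q) (hp' : p ∈ φ'.source) :
    B (du φ (du φ Y) p) (dv φ (dv φ Y) p) = |(coordChange φ φ' p).det| *
      B (du φ' (du φ' Y') p) (dv φ' (dv φ' Y') p) := by
  have hp : p ∈ φ.source := hs ▸ hp'
  have hσ0 : σ ≠ 0 := by rintro rfl; simp at hσ
  have hcc := isConformalChange hφ hφ' hs hσ h h' hl hY hp'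
  have hl0 := hcc.l_ne_zero
  rw [hcc.abs_det]
  obtain ⟨i, j, k, hu⟩ := dirDeriv_dirDeriv_change hφ hφ' hs h'.smooth hl hY hp' (1, 0)
  obtain ⟨i', j', k', hv⟩ := dirDeriv_dirDeriv_change hφ hφ' hs h'.smooth hl hY hp' (0, 1)
  simp only [← du_eq_dirDeriv] at hu
  simp only [← dv_eq_dirDeriv] at hv
  rw [hcc.uu, mul_zero, zero_smul, add_zero] at hu
  rw [hcc.vv, mul_zero, zero_smul, add_zero] at hv
  have key : ∀ w, dirDeriv φ w Y p =
      (dirDeriv φ w φ' p).1 • (l p • du φ' Y' p + du φ' l p • Y' p) +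
      (dirDeriv φ w φ' p).2 • (l p • dv φ' Y' p + dv φ' l p • Y' p) := fun w => by
    rw [dirDeriv_change (smoothIn_chart hφ hφ' hs) hp hp' (h.smooth.change hφ hφ' hs),
      du_congr hY hp', dv_congr hY hp', du_eq_dirDeriv, dv_eq_dirDeriv,
      dirDeriv_smul hl h'.smooth hp', dirDeriv_smul hl h'.smooth hp']
    rfl
  have k1 := key (1, 0)
  have k2 := key (0, 1)
  simp only [← du_eq_dirDeriv] at k1
  simp only [← dv_eq_dirDeriv] at k2
  have e1 := h.u_uu hp
  have e2 := h.v_uu hp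
  have e3 := h.u_vv hp
  have e4 := h.v_vv hp
  rw [k1, hu] at e1
  rw [k2, hu] at e2
  rw [k1, hv] at e3
  rw [k2, hv] at e4
  simp only [map_add, map_smul, LinearMap.add_apply, LinearMap.smul_apply, smul_eq_mul,
    h'.symm _ (Y' p), h'.symm (dv φ' Y' p) (du φ' Y' p), h'.len p hp', h'.x_u hp', h'.x_v hp',
    h'.uu p hp', h'.vv p hp', h'.uv p hp', h'.x_uu hp', h'.x_vv hp', h'.u_uu hp', h'.v_vv hp',
    h'.v_uu hp', h'.u_vv hp'] at e1 e2 e3 e4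
  have f1 := hcc.uu
  have f2 := hcc.vv
  have f3 := hcc.uv
  have f4 := hcc.fst
  have f5 := hcc.snd
  rw [hu, hv]
  generalize (du φ φ' p).1 = a at *
  generalize (du φ φ' p).2 = b at *
  generalize (dv φ φ' p).1 = c at *
  generalize (dv φ φ' p).2 = d at *
  have hsl : σ * l p ≠ 0 := mul_ne_zero hσ0 hl0
  have g1 : a * k + b * j = 0 := mul_left_cancel₀ hsl (by linear_combination 2 * e1)
  have g2 : c * k + d * j = 0 := mul_left_cancel₀ hsl (by linear_combination 2 * e2)
  have g3 : a * k' + b * j' = 0 := mul_left_cancel₀ hsl (by linear_combination 2 * e3)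
  have g4 : c * k' + d * j' = 0 := mul_left_cancel₀ hsl (by linear_combination 2 * e4)
  have hk : k = 0 := by
    linear_combination (-k) * f3 + l p ^ 2 * (d * g1 + b * g2) - 2 * l p ^ 2 * j * f5
  have hj : j = 0 := by
    linear_combination (-j) * f3 + l p ^ 2 * (c * g1 + a * g2) - 2 * l p ^ 2 * k * f4
  have hk' : k' = 0 := by
    linear_combination (-k') * f3 + l p ^ 2 * (d * g3 + b * g4) - 2 * l p ^ 2 * j' * f5
  have hj' : j' = 0 := by
    linear_combination (-j') * f3 + l p ^ 2 * (c * g3 + a * g4) - 2 * l p ^ 2 * k' * f4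
  subst hk hj hk' hj'
  simp only [zero_smul, add_zero, map_add, map_smul, LinearMap.add_apply, LinearMap.smul_apply,
    smul_eq_mul, h'.symm _ (Y' p), h'.symm (dv φ' (dv φ' Y') p) (du φ' (du φ' Y') p), h'.len p hp',
    h'.x_uu hp', h'.x_vv hp']
  generalize B (du φ' (du φ' Y') p) (du φ' (du φ' Y') p) = x
  generalize B (dv φ' (dv φ' Y') p) (dv φ' (dv φ' Y') p) = z
  generalize B (du φ' (du φ' Y') p) (dv φ' (dv φ' Y') p) = t
  linear_combination (l p ^ 2 * a * c * x) * f4 + (l p ^ 2 * b * d * z) * f5 +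
    ((a * d + b * c) * t) * f3 - 2 * l p ^ 2 * c * d * t * f1

theorem lift_ratio {y : M → Projectivization ℝ E} {U U' : Set M} (h : IsLiftOn y Y U)
    (h' : IsLiftOn y Y' U') (hp : p ∈ U) (hp' : p ∈ U') : ∃ r : ℝ, Y p = r • Y' p := by
  obtain ⟨h1, e1⟩ := h p hp
  obtain ⟨h2, e2⟩ := h' p hp'
  obtain ⟨r, hr⟩ := (Projectivization.mk_eq_mk_iff' ℝ _ _ h1 h2).1 (e1.trans e2.symm)
  exact ⟨r, hr.symm⟩

theorem source_restr_comm (φ φ' : OpenPartialHomeomorph M (ℝ × ℝ)) :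
    (φ.restr φ'.source).source = (φ'.restr φ.source).source := by
  rw [φ.restr_source' _ φ'.open_source, φ'.restr_source' _ φ.open_source, Set.inter_comm]

/-- The conformal metric is independent of the asymptotic coordinates. -/
theorem metricCoeff_change {y : M → Projectivization ℝ E} (hB : ∀ x y, B x y = B y x)
    (hσ : σ ^ 2 = 1) (h : IsCanonicalLift B σ φ y Y) (h' : IsCanonicalLift B σ φ' y Y')
    (hp : p ∈ φ.source) (hp' : p ∈ φ'.source) :
    metricCoeff B σ φ Y p = |(coordChange φ φ' p).det| * metricCoeff B σ φ' Y' p := by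
  have hr := h.restr φ'.open_source
  have hr' := h'.restr φ.open_source
  have hs := source_restr_comm φ φ'
  have hpr : p ∈ (φ'.restr φ.source).source := by
    rw [φ'.restr_source' _ φ.open_source]; exact ⟨hp', hp⟩
  obtain ⟨l, hl, hY⟩ := exists_ratio hr.chart hr'.chart hs hσ (hr.normalized hB)
    (hr'.normalized hB) fun q hq => lift_ratio hr.lift hr'.lift (hs ▸ hq) hq
  have key := bilin_uu_vv_change hr.chart hr'.chart hs hσ (hr.normalized hB)
    (hr'.normalized hB) hl hY hpr
  rw [(h.normalized hB).metricCoeff_eq_uu_vv hσ hp, (h'.normalized hB).metricCoeff_eq_uu_vv hσ hp']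
  change B (du φ (du φ Y) p) (dv φ (dv φ Y) p) = |(coordChange φ φ' p).det| *
      B (du φ' (du φ' Y') p) (dv φ' (dv φ' Y') p) at key
  rw [key]
  ring

theorem metricCoeff_unique {y : M → Projectivization ℝ E} (hB : ∀ x y, B x y = B y x)
    (hσ : σ ^ 2 = 1) (h : IsCanonicalLift B σ φ y Y) (h' : IsCanonicalLift B σ φ y Y')
    (hp : p ∈ φ.source) : metricCoeff B σ φ Y p = metricCoeff B σ φ Y' p := by
  have h1 := metricCoeff_change hB hσ h h' hp hp
  have h2 : coordChange φ φ p = ContinuousLinearMap.id ℝ _ := by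
    have : φ ∘ φ.symm =ᶠ[nhds (φ p)] id := by
      filter_upwards [φ.open_target.mem_nhds (φ.map_source hp)] with x hx
      exact φ.right_inv hx
    rw [coordChange, this.fderiv_eq, fderiv_id]
  rw [h1, h2, det_eq]
  simp

section Adapted

variable {ψ : M → E} {c ε : ℝ}

/-- The logarithmic derivative of `⟨ψ, κ₁⟩` does not depend on the adapted coordinates. -/
theorem IsPolarPair.logDeriv_eq (hφ : φ ∈ IsManifold.maximalAtlas 𝓘(ℝ, ℝ × ℝ) ∞ M)
    (hφ' : φ' ∈ IsManifold.maximalAtlas 𝓘(ℝ, ℝ × ℝ) ∞ M) (hs : φ.source = φ'.source)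
    (h : IsPolarPair B φ Y ψ c ε) (h' : IsPolarPair B φ' Y' ψ c ε)
    (hl : SmoothIn φ' l) (hY : ∀ q ∈ φ'.source, Y q = l q • Y' q)
    (h0 : ∀ q ∈ φ.source, polarCoeff B φ Y ψ q ≠ 0)
    (h0' : ∀ q ∈ φ'.source, polarCoeff B φ' Y' ψ q ≠ 0) (hp' : p ∈ φ'.source) (w : ℝ × ℝ) :
    dirDeriv φ' w (polarCoeff B φ Y ψ) p / polarCoeff B φ Y ψ p =
      dirDeriv φ' w (polarCoeff B φ' Y' ψ) p / polarCoeff B φ' Y' ψ p := by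
  have hp : p ∈ φ.source := hs ▸ hp'
  have hm := h.smooth_coeff
  have hm' := h'.smooth_coeff
  have hdual := fun q hq => h.du_dual h0 (p := q) hq
  have hdual2 := fun q hq => h.dv_dual h0 (p := q) hq
  have hdual' := fun q hq => h'.du_dual h0' (p := q) hq
  have hdual2' := fun q hq => h'.dv_dual h0' (p := q) hq
  have hn := h.isNullMap
  have hn' := h'.isNullMap
  have hYuu := h'.bilin_Y_uu hp'
  have hε := h.sign_ne_zero
  set m := polarCoeff B φ Y ψ
  set m' := polarCoeff B φ' Y' ψ
  clear_value m m'
  have hmc : SmoothIn φ' m := hm.change hφ hφ' hs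
  have hc := smoothIn_chart hφ hφ' hs
  have hc' := smoothIn_chart hφ' hφ hs.symm
  -- the two induced metrics agree
  have hmm : ∀ q ∈ φ'.source, l q ^ 2 * m q ^ 2 = m' q ^ 2 := fun q hq => by
    have hq' : q ∈ φ.source := hs ▸ hq
    have hcc := isConformalChange hφ hφ' hs (by norm_num) h.normalized h'.normalized hl hY hq
    have huv := hn.uv q hq'
    rw [du_eq_dirDeriv, dv_eq_dirDeriv, dirDeriv_change hc hq' hq h'.smooth,
      dirDeriv_change hc hq' hq h'.smooth] at huv
    simp only [← du_eq_dirDeriv, ← dv_eq_dirDeriv, map_add, map_smul, LinearMap.add_apply,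
      LinearMap.smul_apply, smul_eq_mul, hn'.symm (dv φ' ψ q) (du φ' ψ q), hn'.uu q hq,
      hn'.vv q hq, hn'.uv q hq] at huv
    have h2 : 2 * ε ≠ 0 := by positivity
    apply mul_left_cancel₀ h2
    linear_combination (-l q ^ 2) * huv + 2 * ε * m' q ^ 2 * hcc.uv
  have ht : SmoothIn φ' fun q => l q * m' q * (m q)⁻¹ :=
    (hl.mul hm').mul (hmc.inv fun q hq => h0 q (hs ▸ hq))
  have hdualeq : ∀ q ∈ φ'.source,
      (m q)⁻¹ • Y q = (l q * m' q * (m q)⁻¹) • ((m' q)⁻¹ • Y' q) := fun q hq => by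
    have := h0' q hq
    rw [hY q hq, smul_smul, smul_smul]
    congr 1
    field_simp
  -- a normal vector that pairs nontrivially with the second lift
  obtain ⟨N, hN1, hN2, hN3⟩ : ∃ N : E, B N (du φ' ψ p) = 0 ∧ B N (dv φ' ψ p) = 0 ∧
      B N (Y' p) ≠ 0 := by
    refine ⟨du φ' (du φ' ψ) p - (2 * du φ' m' p / m' p) • du φ' ψ p, ?_, ?_, ?_⟩
    · simp only [map_sub, map_smul, LinearMap.sub_apply, LinearMap.smul_apply, smul_eq_mul]
      rw [hn'.uu p hp', hn'.symm, hn'.u_uu hp']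
      ring
    · simp only [map_sub, map_smul, LinearMap.sub_apply, LinearMap.smul_apply, smul_eq_mul]
      have e : (fun p => 2 * ε * m' p ^ 2) = fun p => (2 * ε) * (m' p * m' p) := by
        funext p; ring
      have hdq : du φ' (fun p => 2 * ε * m' p ^ 2) p = 4 * ε * m' p * du φ' m' p := by
        rw [e, du_eq_dirDeriv, dirDeriv_mul (SmoothIn.const _) (hm'.mul hm') hp',
          dirDeriv_const, dirDeriv_mul hm' hm' hp']
        simp only [← du_eq_dirDeriv]
        ring
      have := h0' p hp'
      rw [hn'.symm, hn'.v_uu hp', hn'.uv p hp', hdq]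
      field_simp
      ring
    · simp only [map_sub, map_smul, LinearMap.sub_apply, LinearMap.smul_apply, smul_eq_mul]
      rw [hn'.symm _ (Y' p), hYuu, h'.bilin_du_Y hp']
      simpa using h0' p hp'
  have htw : dirDeriv φ' w (fun q => l q * m' q * (m q)⁻¹) p = 0 := by
    have e1 := dirDeriv_congr hdualeq hp' w
    have hds' : SmoothIn φ' fun q => (m' q)⁻¹ • Y' q := (hm'.inv h0').smul h'.normalized.smooth
    have hds : SmoothIn φ fun q => (m q)⁻¹ • Y q := (hm.inv h0).smul h.normalized.smooth
    rw [dirDeriv_smul ht hds' hp', dirDeriv_change hc' hp' hp hds, hdual p hp, hdual2 p hp,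
      dirDeriv_eq w (fun q => (m' q)⁻¹ • Y' q), hdual' p hp', hdual2' p hp',
      dv_eq_dirDeriv ψ, du_eq_dirDeriv ψ, dirDeriv_change hc hp hp' h'.smooth,
      dirDeriv_change hc hp hp' h'.smooth] at e1
    have e2 := congrArg (B N) e1
    simp only [map_add, map_smul, smul_eq_mul, ← du_eq_dirDeriv, ← dv_eq_dirDeriv, hN1, hN2,
      mul_zero, add_zero, zero_add] at e2
    have := h0' p hp'
    have h3 : (m' p)⁻¹ * B N (Y' p) ≠ 0 := mul_ne_zero (inv_ne_zero this) hN3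
    exact (mul_eq_zero.1 e2.symm).resolve_right h3
  set t := fun q => l q * m' q * (m q)⁻¹ with htdef
  have hfour : ∀ q ∈ φ'.source,
      t q * t q * ((m q * m q) * (m q * m q)) = (m' q * m' q) * (m' q * m' q) := fun q hq => by
    have h1 := h0 q (hs ▸ hq)
    have h2 := hmm q hq
    have h3 : t q * m q = l q * m' q := by
      rw [htdef]; field_simp
    linear_combination (m q ^ 2 * (t q * m q + l q * m' q)) * h3 + m' q ^ 2 * h2
  have hd := dirDeriv_congr hfour hp' w
  have hm2 := hmc.mul hmc
  have hm2' := hm'.mul hm'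
  rw [dirDeriv_mul (ht.mul ht) (hm2.mul hm2) hp', dirDeriv_mul ht ht hp',
    dirDeriv_mul hm2 hm2 hp', dirDeriv_mul hmc hmc hp', dirDeriv_mul hm2' hm2' hp',
    dirDeriv_mul hm' hm' hp', htw] at hd
  have hf := hfour p hp'
  have hm0 := h0 p hp
  have hm0' := h0' p hp'
  rw [div_eq_div_iff hm0 hm0']
  have h3 : 4 * m' p ^ 3 ≠ 0 := by positivity
  apply mul_left_cancel₀ h3
  linear_combination (m p) * hd - 4 * dirDeriv φ' w m p * hf

/-- The symmetric pairing of `dρ` with `d log m` with respect to the form `du dv`. -/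
def logPairing (φ : OpenPartialHomeomorph M (ℝ × ℝ)) (m ρ : M → ℝ) (p : M) : ℝ :=
  du φ ρ p * (dv φ m p / m p) + dv φ ρ p * (du φ m p / m p)

theorem IsPolarPair.logPairing_change {y : M → Projectivization ℝ E} (hB : ∀ x y, B x y = B y x)
    (hε : ε ^ 2 = 1) (hψ : IsPolarTransform B c y ψ) (h : IsAdaptedLift B 1 ε φ y Y)
    (h' : IsAdaptedLift B 1 ε φ' y Y')
    (h0 : ∀ q ∈ φ.source, polarCoeff B φ Y ψ q ≠ 0)
    (h0' : ∀ q ∈ φ'.source, polarCoeff B φ' Y' ψ q ≠ 0) {ρ : M → ℝ}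
    (hρ : ContMDiff 𝓘(ℝ, ℝ × ℝ) 𝓘(ℝ, ℝ) ∞ ρ) (hp : p ∈ φ.source) (hp' : p ∈ φ'.source) :
    logPairing φ (polarCoeff B φ Y ψ) ρ p =
      |(coordChange φ φ' p).det| * logPairing φ' (polarCoeff B φ' Y' ψ) ρ p := by
  have hr := h.restr φ'.open_source
  have hr' := h'.restr φ.open_source
  have hs := source_restr_comm φ φ'
  have hsub : (φ.restr φ'.source).source ⊆ φ.source := by
    rw [φ.restr_source' _ φ'.open_source]; exact Set.inter_subset_left
  have hsub' : (φ'.restr φ.source).source ⊆ φ'.source := by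
    rw [φ'.restr_source' _ φ.open_source]; exact Set.inter_subset_left
  have hpr : p ∈ (φ'.restr φ.source).source := by
    rw [φ'.restr_source' _ φ.open_source]; exact ⟨hp', hp⟩
  obtain ⟨l, hl, hY⟩ := exists_ratio hr.1.chart hr'.1.chart hs (by norm_num)
    (hr.1.normalized hB) (hr'.1.normalized hB)
    fun q hq => lift_ratio hr.1.lift hr'.1.lift (hs ▸ hq) hq
  have hP := hψ.isPolarPair hB hε hr
  have hP' := hψ.isPolarPair hB hε hr'
  have hlog := IsPolarPair.logDeriv_eq hr.1.chart hr'.1.chart hs hP hP' hl hY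
    (fun q hq => h0 q (hsub hq)) (fun q hq => h0' q (hsub' hq)) hpr
  have hcc := isConformalChange hr.1.chart hr'.1.chart hs (by norm_num) (hr.1.normalized hB)
    (hr'.1.normalized hB) hl hY hpr
  have hc := smoothIn_chart hr.1.chart hr'.1.chart hs
  have hm : SmoothIn (φ'.restr φ.source) (polarCoeff B φ Y ψ) :=
    SmoothIn.change hr.1.chart hr'.1.chart hs hP.smooth_coeff
  have hρ' : SmoothIn (φ'.restr φ.source) ρ := (smoothIn_iff hr'.1.chart).2 hρ.contMDiffOn
  have key : ∀ {F : M → ℝ}, SmoothIn (φ'.restr φ.source) F → ∀ w, dirDeriv φ w F p =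
      (dirDeriv φ w φ' p).1 * du φ' F p + (dirDeriv φ w φ' p).2 * dv φ' F p := fun hF w =>
    dirDeriv_change hc (hs ▸ hpr) hpr hF w
  have habs : |(coordChange φ φ' p).det| =
      (du φ φ' p).1 * (dv φ φ' p).2 + (du φ φ' p).2 * (dv φ φ' p).1 := hcc.abs_det
  have hfst : (du φ φ' p).1 * (dv φ φ' p).1 = 0 := hcc.fst
  have hsnd : (du φ φ' p).2 * (dv φ φ' p).2 = 0 := hcc.snd
  have l1 : du φ' (polarCoeff B φ Y ψ) p / polarCoeff B φ Y ψ p =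
    du φ' (polarCoeff B φ' Y' ψ) p / polarCoeff B φ' Y' ψ p := hlog (1, 0)
  have l2 : dv φ' (polarCoeff B φ Y ψ) p / polarCoeff B φ Y ψ p =
    dv φ' (polarCoeff B φ' Y' ψ) p / polarCoeff B φ' Y' ψ p := hlog (0, 1)
  rw [habs, logPairing, logPairing, ← l1, ← l2]
  have k1 := key hm (1, 0)
  have k2 := key hm (0, 1)
  have k3 := key hρ' (1, 0)
  have k4 := key hρ' (0, 1)
  simp only [← du_eq_dirDeriv] at k1 k3
  simp only [← dv_eq_dirDeriv] at k2 k4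
  rw [k1, k2, k3, k4]
  linear_combination (2 * du φ' ρ p * (du φ' (polarCoeff B φ Y ψ) p / polarCoeff B φ Y ψ p)) * hfst
    + (2 * dv φ' ρ p * (dv φ' (polarCoeff B φ Y ψ) p / polarCoeff B φ Y ψ p)) * hsnd

end Adapted

end Transition

section Integration

open MeasureTheory

variable {M : Type*} [TopologicalSpace M]
variable {φ φ' : OpenPartialHomeomorph M (ℝ × ℝ)} {p : M}

theorem SmoothIn.integrableOn {F : M → ℝ} (hF : SmoothIn φ F) {K : Set M} (hK : IsCompact K)
    (hKs : K ⊆ φ.source) (h0 : ∀ p ∈ φ.source, p ∉ K → F p = 0) :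
    IntegrableOn (fun x => F (φ.symm x)) φ.target := by
  have hK' : IsCompact (φ '' K) := hK.image_of_continuousOn (φ.continuousOn.mono hKs)
  have hsub : φ '' K ⊆ φ.target := by
    rintro _ ⟨q, hq, rfl⟩
    exact φ.map_source (hKs hq)
  have h1 : IntegrableOn (fun x => F (φ.symm x)) (φ '' K) :=
    ((ContDiffOn.continuousOn hF).mono hsub).integrableOn_compact hK'
  refine h1.of_forall_sdiff_eq_zero φ.open_target.measurableSet fun x hx => ?_
  refine h0 _ (φ.map_target hx.1) fun hxK => hx.2 ⟨_, hxK, φ.right_inv hx.1⟩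

theorem dirDeriv_eq_zero_of_notMem {F : M → ℝ} {K : Set M} (hKc : IsClosed K)
    (h0 : ∀ p ∈ φ.source, p ∉ K → F p = 0) (hp : p ∈ φ.source) (hpK : p ∉ K) (w : ℝ × ℝ) :
    dirDeriv φ w F p = 0 := by
  have h1 : φ.symm ⁻¹' Kᶜ ∈ nhds (φ p) :=
    (φ.continuousAt_symm (φ.map_source hp)).preimage_mem_nhds
      (hKc.isOpen_compl.mem_nhds (by rwa [φ.left_inv hp]))
  have hev : F ∘ φ.symm =ᶠ[nhds (φ p)] fun _ => 0 := by
    filter_upwards [h1, φ.open_target.mem_nhds (φ.map_source hp)] with x hx hxt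
    exact h0 _ (φ.map_target hxt) hx
  rw [dirDeriv, hev.fderiv_eq]
  simp

/-- A directional derivative of a compactly supported function integrates to zero. -/
theorem SmoothIn.integral_dirDeriv {F : M → ℝ} (hF : SmoothIn φ F) {K : Set M} (hK : IsCompact K)
    (hKc : IsClosed K) (hKs : K ⊆ φ.source) (h0 : ∀ p ∈ φ.source, p ∉ K → F p = 0) (w : ℝ × ℝ) :
    ∫ x in φ.target, TimelikeSurface.dirDeriv φ w F (φ.symm x) = 0 := by
  have hK' : IsCompact (φ '' K) := hK.image_of_continuousOn (φ.continuousOn.mono hKs)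
  let h : ℝ × ℝ → ℝ := φ.target.indicator (F ∘ φ.symm)
  have hin : ∀ x ∈ φ.target, h =ᶠ[nhds x] F ∘ φ.symm := fun x hx => by
    filter_upwards [φ.open_target.mem_nhds hx] with z hz
    exact Set.indicator_of_mem hz _
  have hout : ∀ x ∉ φ.target, h =ᶠ[nhds x] fun _ => 0 := fun x hx => by
    have hx' : x ∉ φ '' K := by
      rintro ⟨q, hq, rfl⟩
      exact hx (φ.map_source (hKs hq))
    filter_upwards [hK'.isClosed.isOpen_compl.mem_nhds hx'] with z hz
    by_cases hzt : z ∈ φ.target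
    · have e : h z = F (φ.symm z) := Set.indicator_of_mem hzt _
      rw [e]
      exact h0 _ (φ.map_target hzt) fun hzK => hz ⟨_, hzK, φ.right_inv hzt⟩
    · exact Set.indicator_of_notMem hzt _
  have hdiff : Differentiable ℝ h := fun x => by
    by_cases hx : x ∈ φ.target
    · have := hF.differentiableAt (φ.map_target hx)
      rw [φ.right_inv hx] at this
      exact this.congr_of_eventuallyEq (hin x hx)
    · exact (differentiableAt_const 0).congr_of_eventuallyEq (hout x hx)
  have hd_in : ∀ x ∈ φ.target, fderiv ℝ h x w = TimelikeSurface.dirDeriv φ w F (φ.symm x) :=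
    fun x hx => by rw [(hin x hx).fderiv_eq, TimelikeSurface.dirDeriv, φ.right_inv hx]
  have hd_out : ∀ x ∉ φ.target, fderiv ℝ h x w = 0 := fun x hx => by
    rw [(hout x hx).fderiv_eq]; simp
  have hi_h : Integrable h :=
    (integrable_indicator_iff φ.open_target.measurableSet).2 (hF.integrableOn hK hKs h0)
  have hi_d : Integrable fun x => fderiv ℝ h x w := by
    rw [← integrableOn_iff_integrable_of_support_subset (s := φ.target)
      (fun x hx => by_contra fun hxt => hx (hd_out x hxt))]
    refine ((hF.dirDeriv w).integrableOn hK hKs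
      fun p hp hpK => dirDeriv_eq_zero_of_notMem hKc h0 hp hpK w).congr_fun
      (fun x hx => (hd_in x hx).symm) φ.open_target.measurableSet
  rw [← setIntegral_congr_fun φ.open_target.measurableSet hd_in,
    setIntegral_eq_integral_of_forall_compl_eq_zero hd_out]
  have := integral_mul_fderiv_eq_neg_fderiv_mul_of_integrable (𝕜 := ℝ) (μ := volume)
    (f := fun _ : ℝ × ℝ => (1 : ℝ)) (g := h) (v := w) (by simp) (by simpa using hi_d)
    (by simpa using hi_h) (fun x _ => differentiableAt_const _) (fun x _ => hdiff x)
  simpa using this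

variable [ChartedSpace (ℝ × ℝ) M]

/-- Change of variables between two charts. -/
theorem integral_change (hφ : φ ∈ IsManifold.maximalAtlas 𝓘(ℝ, ℝ × ℝ) ∞ M)
    (hφ' : φ' ∈ IsManifold.maximalAtlas 𝓘(ℝ, ℝ × ℝ) ∞ M) {H H' : M → ℝ}
    (hH : ∀ p ∈ φ.source, p ∈ φ'.source → H p = |(coordChange φ φ' p).det| * H' p)
    (h0 : ∀ p ∈ φ.source, p ∉ φ'.source → H p = 0)
    (h0' : ∀ p ∈ φ'.source, p ∉ φ.source → H' p = 0) :
    ∫ x in φ.target, H (φ.symm x) = ∫ x in φ'.target, H' (φ'.symm x) := by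
  set S : Set (ℝ × ℝ) := (φ.symm.trans φ').source with hS
  set T : ℝ × ℝ → ℝ × ℝ := φ' ∘ φ.symm with hT
  have hSm : MeasurableSet S := (φ.symm.trans φ').open_source.measurableSet
  have hSmem : ∀ x, x ∈ S ↔ x ∈ φ.target ∧ φ.symm x ∈ φ'.source := fun x => by
    rw [hS, OpenPartialHomeomorph.trans_source]; rfl
  have himg : ∀ x, x ∈ T '' S ↔ x ∈ φ'.target ∧ φ'.symm x ∈ φ.source := fun x => by
    constructor
    · rintro ⟨z, hz, rfl⟩
      obtain ⟨h1, h2⟩ := (hSmem z).1 hz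
      refine ⟨φ'.map_source h2, ?_⟩
      simp only [hT, Function.comp_apply, φ'.left_inv h2]
      exact φ.map_target h1
    · rintro ⟨h1, h2⟩
      refine ⟨φ (φ'.symm x), (hSmem _).2 ⟨φ.map_source h2, ?_⟩, ?_⟩
      · rw [φ.left_inv h2]; exact φ'.map_target h1
      · simp only [hT, Function.comp_apply, φ.left_inv h2, φ'.right_inv h1]
  have hinj : Set.InjOn T S := (φ.symm.trans φ').injOn
  have hsm : SmoothIn (φ.restr φ'.source) (φ'.restr φ.source) :=
    smoothIn_chart (restr_mem φ'.open_source hφ) (restr_mem φ.open_source hφ')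
      (source_restr_comm φ φ')
  have hderiv : ∀ x ∈ S, HasFDerivWithinAt T (fderiv ℝ T x) S x := fun x hx => by
    obtain ⟨h1, h2⟩ := (hSmem x).1 hx
    have hmem : φ.symm x ∈ (φ.restr φ'.source).source := by
      rw [φ.restr_source' _ φ'.open_source]
      exact ⟨φ.map_target h1, h2⟩
    have hd := hsm.differentiableAt hmem
    change DifferentiableAt ℝ T (φ (φ.symm x)) at hd
    rw [φ.right_inv h1] at hd
    exact hd.hasFDerivAt.hasFDerivWithinAt
  have e1 : ∫ x in φ.target, H (φ.symm x) = ∫ x in S, H (φ.symm x) := by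
    refine setIntegral_eq_of_subset_of_forall_sdiff_eq_zero φ.open_target.measurableSet
      (fun x hx => ((hSmem x).1 hx).1) fun x hx => ?_
    exact h0 _ (φ.map_target hx.1) fun h => hx.2 ((hSmem x).2 ⟨hx.1, h⟩)
  have e2 : ∫ x in φ'.target, H' (φ'.symm x) = ∫ x in T '' S, H' (φ'.symm x) := by
    refine setIntegral_eq_of_subset_of_forall_sdiff_eq_zero φ'.open_target.measurableSet
      (fun x hx => ((himg x).1 hx).1) fun x hx => ?_
    exact h0' _ (φ'.map_target hx.1) fun h => hx.2 ((himg x).2 ⟨hx.1, h⟩)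
  rw [e1, e2, integral_image_eq_integral_abs_det_fderiv_smul volume hSm hderiv hinj]
  refine setIntegral_congr_fun hSm fun x hx => ?_
  obtain ⟨h1, h2⟩ := (hSmem x).1 hx
  have e3 : φ'.symm (T x) = φ.symm x := φ'.left_inv h2
  simp only [smul_eq_mul]
  rw [e3, hH _ (φ.map_target h1) h2, coordChange, φ.right_inv h1]

theorem integral_sum_partition {k : ℕ} {ρ : Fin k → M → ℝ}
    (hφ : φ ∈ IsManifold.maximalAtlas 𝓘(ℝ, ℝ × ℝ) ∞ M)
    (hρ : ∀ i, ContMDiff 𝓘(ℝ, ℝ × ℝ) 𝓘(ℝ, ℝ) ∞ (ρ i)) (hsum : ∀ p, ∑ i, ρ i p = 1) {F : M → ℝ}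
    (hF : SmoothIn φ F) {K : Set M} (hK : IsCompact K) (hKs : K ⊆ φ.source)
    (h0 : ∀ p ∈ φ.source, p ∉ K → F p = 0) :
    ∫ x in φ.target, F (φ.symm x) = ∑ j, ∫ x in φ.target, ρ j (φ.symm x) * F (φ.symm x) := by
  rw [← integral_finsetSum]
  · refine setIntegral_congr_fun φ.open_target.measurableSet fun x _ => ?_
    simp only [← Finset.sum_mul, hsum, one_mul]
  · intro j _
    exact SmoothIn.integrableOn (((smoothIn_iff hφ).2 (hρ j).contMDiffOn).mul hF) hK hKs
      fun p hp hpK => by simp [h0 p hp hpK]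

variable {E : Type*} [NormedAddCommGroup E] [NormedSpace ℝ E] [FiniteDimensional ℝ E]
variable {B : LinearMap.BilinForm ℝ E} {σ : ℝ} {y : M → Projectivization ℝ E} {Y : M → E}

theorem IsNormalizedMap.smooth_metricCoeff (h : IsNormalizedMap B σ φ Y) (hσ : σ ^ 2 = 1) :
    SmoothIn φ (metricCoeff B σ φ Y) :=
  ((SmoothIn.const σ).mul (h.smooth.du.du.bilin B h.smooth.dv.dv)).congr
    fun _ hp => h.metricCoeff_eq_uu_vv hσ hp

theorem eq_zero_of_notMem_source {ρ : M → ℝ} (h : tsupport ρ ⊆ φ.source) (hp : p ∉ φ.source) :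
    ρ p = 0 := image_eq_zero_of_notMem_tsupport fun hp' => hp (h hp')

variable [CompactSpace M]

/-- The energy does not depend on the partition of unity. -/
theorem AsymptoticPartition.energy_eq (hB : ∀ x y, B x y = B y x) (hσ : σ ^ 2 = 1)
    (P Q : AsymptoticPartition B σ y) : P.energy = Q.energy := by
  have key : ∀ P Q : AsymptoticPartition B σ y, ∀ i,
      ∫ x in (P.φ i).target,
        P.ρ i ((P.φ i).symm x) * metricCoeff B σ (P.φ i) (P.Y i) ((P.φ i).symm x) =
      ∑ j, ∫ x in (P.φ i).target, Q.ρ j ((P.φ i).symm x) * (P.ρ i ((P.φ i).symm x) *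
        metricCoeff B σ (P.φ i) (P.Y i) ((P.φ i).symm x)) := fun P Q i =>
    integral_sum_partition (F := fun q => P.ρ i q * metricCoeff B σ (P.φ i) (P.Y i) q)
      (P.canonical i).chart Q.smooth Q.sum_eq_one
      (SmoothIn.mul ((smoothIn_iff (P.canonical i).chart).2 (P.smooth i).contMDiffOn)
        (((P.canonical i).normalized hB).smooth_metricCoeff hσ))
      (isClosed_tsupport (P.ρ i)).isCompact (P.subordinate i)
      fun p _ hpK => by simp [image_eq_zero_of_notMem_tsupport hpK]
  unfold AsymptoticPartition.energy
  congr 1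
  rw [Finset.sum_congr rfl fun i _ => key P Q i, Finset.sum_congr rfl fun j _ => key Q P j,
    Finset.sum_comm]
  refine Finset.sum_congr rfl fun j _ => Finset.sum_congr rfl fun i _ => ?_
  refine integral_change (H := fun q => Q.ρ j q * (P.ρ i q * metricCoeff B σ (P.φ i) (P.Y i) q))
    (H' := fun q => P.ρ i q * (Q.ρ j q * metricCoeff B σ (Q.φ j) (Q.Y j) q))
    (P.canonical i).chart (Q.canonical j).chart ?_ ?_ ?_
  · intro p hp hp'
    rw [metricCoeff_change hB hσ (P.canonical i) (Q.canonical j) hp hp']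
    ring
  · intro p _ hp'
    simp [eq_zero_of_notMem_source (Q.subordinate j) hp']
  · intro p _ hp'
    simp [eq_zero_of_notMem_source (P.subordinate i) hp']

variable {c ε : ℝ} {ψ : M → E}

theorem integral_by_parts (hφ : φ ∈ IsManifold.maximalAtlas 𝓘(ℝ, ℝ × ℝ) ∞ M) {m ρ : M → ℝ}
    (hm : SmoothIn φ m) (h0 : ∀ q ∈ φ.source, m q ≠ 0)
    (hρ : ContMDiff 𝓘(ℝ, ℝ × ℝ) 𝓘(ℝ, ℝ) ∞ ρ) (hsub : tsupport ρ ⊆ φ.source) :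
    ∫ x in φ.target, ρ (φ.symm x) * dv φ (fun q => du φ m q / m q) (φ.symm x) =
      -(1 / 2) * ∫ x in φ.target, logPairing φ m ρ (φ.symm x) := by
  have hK := (isClosed_tsupport ρ).isCompact
  have hKc := isClosed_tsupport ρ
  have hρ' : SmoothIn φ ρ := (smoothIn_iff hφ).2 hρ.contMDiffOn
  have hu : SmoothIn φ fun q => du φ m q / m q := hm.logDeriv h0 _
  have hv : SmoothIn φ fun q => dv φ m q / m q := hm.logDeriv h0 _
  have hρ0 : ∀ p ∈ φ.source, p ∉ tsupport ρ → ρ p = 0 := fun p _ h =>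
    image_eq_zero_of_notMem_tsupport h
  have hcomm : ∀ p ∈ φ.source, du φ (fun q => dv φ m q / m q) p =
      dv φ (fun q => du φ m q / m q) p := fun p hp => by
    have e1 : ∀ q ∈ φ.source, dv φ m q = dv φ m q / m q * m q := fun q hq => by
      have := h0 q hq
      field_simp
    have e2 : ∀ q ∈ φ.source, du φ m q = du φ m q / m q * m q := fun q hq => by
      have := h0 q hq
      field_simp
    have d1 := dirDeriv_congr e1 hp (1, 0)
    have d2 := dirDeriv_congr e2 hp (0, 1)
    rw [dirDeriv_mul hv hm hp] at d1
    rw [dirDeriv_mul hu hm hp] at d2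
    simp only [← du_eq_dirDeriv, ← dv_eq_dirDeriv] at d1 d2
    rw [du_dv_comm hm hp] at d2
    have := h0 p hp
    apply mul_left_cancel₀ (pow_ne_zero 2 this)
    field_simp at d1 d2
    linarith
  have i1 := (hρ'.mul hu).integral_dirDeriv hK hKc hsub (fun p hp h => by simp [hρ0 p hp h]) (0, 1)
  have i2 := (hρ'.mul hv).integral_dirDeriv hK hKc hsub (fun p hp h => by simp [hρ0 p hp h]) (1, 0)
  have hI : IntegrableOn (fun x => ρ (φ.symm x) *
      dv φ (fun q => du φ m q / m q) (φ.symm x)) φ.target :=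
    (hρ'.mul hu.dv).integrableOn hK hsub fun p hp h => by simp [hρ0 p hp h]
  have hd0 : ∀ w, ∀ p ∈ φ.source, p ∉ tsupport ρ → dirDeriv φ w ρ p = 0 := fun w p hp h =>
    dirDeriv_eq_zero_of_notMem hKc hρ0 hp h w
  have hI1 : IntegrableOn (fun x => dv φ ρ (φ.symm x) *
      (du φ m (φ.symm x) / m (φ.symm x))) φ.target :=
    (hρ'.dv.mul hu).integrableOn hK hsub fun p hp h => by
      simp [dv_eq_dirDeriv, hd0 _ p hp h]
  have hI2 : IntegrableOn (fun x => du φ ρ (φ.symm x) *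
      (dv φ m (φ.symm x) / m (φ.symm x))) φ.target :=
    (hρ'.du.mul hv).integrableOn hK hsub fun p hp h => by
      simp [du_eq_dirDeriv, hd0 _ p hp h]
  have f1 : ∫ x in φ.target, dirDeriv φ (0, 1) (fun q => ρ q * (du φ m q / m q)) (φ.symm x) =
      ∫ x in φ.target, (ρ (φ.symm x) * dv φ (fun q => du φ m q / m q) (φ.symm x) +
        dv φ ρ (φ.symm x) * (du φ m (φ.symm x) / m (φ.symm x))) :=
    setIntegral_congr_fun φ.open_target.measurableSet fun x hx =>
      dirDeriv_mul hρ' hu (φ.map_target hx) (0, 1)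
  have f2 : ∫ x in φ.target, dirDeriv φ (1, 0) (fun q => ρ q * (dv φ m q / m q)) (φ.symm x) =
      ∫ x in φ.target, (ρ (φ.symm x) * dv φ (fun q => du φ m q / m q) (φ.symm x) +
        du φ ρ (φ.symm x) * (dv φ m (φ.symm x) / m (φ.symm x))) :=
    setIntegral_congr_fun φ.open_target.measurableSet fun x hx => by
      have hx' := φ.map_target hx
      have := dirDeriv_mul hρ' hv hx' (1, 0)
      simp only [← du_eq_dirDeriv, hcomm _ hx'] at this
      exact this
  rw [f1, integral_add hI hI1] at i1
  rw [f2, integral_add hI hI2] at i2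
  have f3 : ∫ x in φ.target, logPairing φ m ρ (φ.symm x) =
      (∫ x in φ.target, du φ ρ (φ.symm x) * (dv φ m (φ.symm x) / m (φ.symm x))) +
      ∫ x in φ.target, dv φ ρ (φ.symm x) * (du φ m (φ.symm x) / m (φ.symm x)) :=
    integral_add hI2 hI1
  rw [f3]
  linarith

/-- The total integral of `d * d log ⟨ψ, κ₁⟩` vanishes on a closed surface. -/
theorem sum_integral_log_eq_zero (hB : ∀ x y, B x y = B y x) (hε : ε ^ 2 = 1)
    (hψ : IsPolarTransform B c y ψ) (P : AsymptoticPartition B 1 y)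
    (hP : ∀ i, IsAdaptedLift B 1 ε (P.φ i) y (P.Y i))
    (h0 : ∀ i, ∀ q ∈ (P.φ i).source, polarCoeff B (P.φ i) (P.Y i) ψ q ≠ 0) :
    ∑ i, ∫ x in (P.φ i).target, P.ρ i ((P.φ i).symm x) *
      dv (P.φ i) (fun q => du (P.φ i) (polarCoeff B (P.φ i) (P.Y i) ψ) q /
        polarCoeff B (P.φ i) (P.Y i) ψ q) ((P.φ i).symm x) = 0 := by
  have hm := fun i => (hψ.isPolarPair hB hε (hP i)).smooth_coeff
  have hch := fun i => (P.canonical i).chart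
  have hρ : ∀ i j, SmoothIn (P.φ i) (P.ρ j) := fun i j =>
    (smoothIn_iff (hch i)).2 (P.smooth j).contMDiffOn
  have hlog : ∀ i j, SmoothIn (P.φ i)
      (logPairing (P.φ i) (polarCoeff B (P.φ i) (P.Y i) ψ) (P.ρ j)) := fun i j =>
    ((hρ i j).du.mul ((hm i).logDeriv (h0 i) _)).add ((hρ i j).dv.mul ((hm i).logDeriv (h0 i) _))
  have hlog0 : ∀ i j, ∀ p ∈ (P.φ i).source, p ∉ tsupport (P.ρ j) →
      logPairing (P.φ i) (polarCoeff B (P.φ i) (P.Y i) ψ) (P.ρ j) p = 0 := fun i j p hp h => by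
    have := dirDeriv_eq_zero_of_notMem (isClosed_tsupport (P.ρ j))
      (fun p _ h => image_eq_zero_of_notMem_tsupport h) hp h
    simp [logPairing, du_eq_dirDeriv, dv_eq_dirDeriv, this]
  rw [Finset.sum_congr rfl fun i _ =>
    integral_by_parts (hch i) (hm i) (h0 i) (P.smooth i) (P.subordinate i), ← Finset.mul_sum,
    Finset.sum_congr rfl fun i _ => integral_sum_partition (hch i) P.smooth P.sum_eq_one
      (hlog i i) (isClosed_tsupport (P.ρ i)).isCompact (P.subordinate i) (hlog0 i i),
    Finset.sum_comm]
  refine mul_eq_zero_of_right _ (Finset.sum_eq_zero fun j _ => ?_)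
  have hchange : ∀ i, ∫ x in (P.φ i).target, P.ρ j ((P.φ i).symm x) *
      logPairing (P.φ i) (polarCoeff B (P.φ i) (P.Y i) ψ) (P.ρ i) ((P.φ i).symm x) =
      ∫ x in (P.φ j).target, P.ρ j ((P.φ j).symm x) *
        logPairing (P.φ j) (polarCoeff B (P.φ j) (P.Y j) ψ) (P.ρ i) ((P.φ j).symm x) := fun i => by
    refine integral_change
      (H := fun q => P.ρ j q * logPairing (P.φ i) (polarCoeff B (P.φ i) (P.Y i) ψ) (P.ρ i) q)
      (H' := fun q => P.ρ j q * logPairing (P.φ j) (polarCoeff B (P.φ j) (P.Y j) ψ) (P.ρ i) q)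
      (hch i) (hch j) ?_ ?_ ?_
    · intro p hp hp'
      rw [IsPolarPair.logPairing_change hB hε hψ (hP i) (hP j) (h0 i) (h0 j) (P.smooth i) hp hp']
      ring
    · intro p _ hp'
      simp [eq_zero_of_notMem_source (P.subordinate j) hp']
    · intro p hp hp'
      rw [hlog0 j i p hp fun h => hp' (P.subordinate i h), mul_zero]
  rw [Finset.sum_congr rfl fun i _ => hchange i, ← integral_finsetSum]
  · refine setIntegral_eq_zero_of_forall_eq_zero fun x hx => ?_
    have hx' := (P.φ j).map_target hx
    have hs : ∀ w, ∑ i, dirDeriv (P.φ j) w (P.ρ i) ((P.φ j).symm x) = 0 := fun w => by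
      rw [← dirDeriv_sum Finset.univ (fun i _ => hρ j i) hx',
        dirDeriv_congr (G := fun _ => (1 : ℝ)) (fun q _ => P.sum_eq_one q) hx', dirDeriv_const]
    simp only [logPairing, ← Finset.mul_sum, Finset.sum_add_distrib, ← Finset.sum_mul]
    have hsu := hs (1, 0)
    have hsv := hs (0, 1)
    simp only [← du_eq_dirDeriv] at hsu
    simp only [← dv_eq_dirDeriv] at hsv
    rw [hsu, hsv]
    ring
  · intro i _
    exact ((hρ j j).mul (hlog j i)).integrableOn (isClosed_tsupport (P.ρ j)).isCompact
      (P.subordinate j) fun p _ h => by simp [image_eq_zero_of_notMem_tsupport h]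

/-- The Willmore functional of a conformal surface whose metric differs from that of `y` by
`d * d log ⟨ψ, κ₁⟩`. -/
theorem hasWillmore_of_metric {E' : Type*} [NormedAddCommGroup E'] [NormedSpace ℝ E']
    [FiniteDimensional ℝ E'] {B' : LinearMap.BilinForm ℝ E'} {y' : M → Projectivization ℝ E'}
    (hB : ∀ x y, B x y = B y x) (hB' : ∀ x y, B' x y = B' y x) (hε : ε ^ 2 = 1)
    (hψ : IsPolarTransform B c y ψ) (P : AsymptoticPartition B 1 y)
    (hP : ∀ i, IsAdaptedLift B 1 ε (P.φ i) y (P.Y i))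
    (h0 : ∀ i, ∀ q ∈ (P.φ i).source, polarCoeff B (P.φ i) (P.Y i) ψ q ≠ 0)
    (Z : Fin P.k → M → E') (hZ : ∀ i, IsCanonicalLift B' ε (P.φ i) y' (Z i))
    (hmetric : ∀ i, ∀ p ∈ (P.φ i).source,
      metricCoeff B' ε (P.φ i) (Z i) p = IsPolarPair.metric B (P.φ i) (P.Y i) ψ p) :
    HasWillmore B' ε y' P.energy := by
  let Q : AsymptoticPartition B' ε y' :=
    ⟨P.k, P.φ, Z, hZ, P.ρ, P.smooth, P.nonneg, P.subordinate, P.sum_eq_one⟩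
  refine ⟨⟨Q⟩, fun R => ?_⟩
  rw [AsymptoticPartition.energy_eq hB' hε R Q]
  have hzero := sum_integral_log_eq_zero hB hε hψ P hP h0
  unfold AsymptoticPartition.energy
  congr 1
  conv_rhs => rw [← add_zero (∑ i, _), ← hzero, ← Finset.sum_add_distrib]
  refine Finset.sum_congr rfl fun i _ => ?_
  have hρ : SmoothIn (P.φ i) (P.ρ i) :=
    (smoothIn_iff (P.canonical i).chart).2 (P.smooth i).contMDiffOn
  have hm := (hψ.isPolarPair hB hε (hP i)).smooth_coeff
  rw [← integral_add]
  · refine setIntegral_congr_fun (P.φ i).open_target.measurableSet fun x hx => ?_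
    change P.ρ i ((P.φ i).symm x) * metricCoeff B' ε (P.φ i) (Z i) ((P.φ i).symm x) = _
    rw [hmetric i _ ((P.φ i).map_target hx), IsPolarPair.metric, mul_add]
  · exact (hρ.mul (((P.canonical i).normalized hB).smooth_metricCoeff
      (by norm_num))).integrableOn (isClosed_tsupport (P.ρ i)).isCompact (P.subordinate i)
      fun p _ h => by simp [image_eq_zero_of_notMem_tsupport h]
  · exact (hρ.mul (SmoothIn.dv (hm.logDeriv (h0 i) (1, 0)))).integrableOn
      (isClosed_tsupport (P.ρ i)).isCompact (P.subordinate i)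
      fun p _ h => by simp [image_eq_zero_of_notMem_tsupport h]

/-- A closed isothermic surface has a finite partition of unity subordinate to adapted charts. -/
theorem exists_adapted_partition [T2Space M] [IsManifold 𝓘(ℝ, ℝ × ℝ) ∞ M]
    (hy : IsIsothermicOn B ε y Set.univ) :
    ∃ P : AsymptoticPartition B 1 y, ∀ i, IsAdaptedLift B 1 ε (P.φ i) y (P.Y i) := by
  choose φ Y hmem _ hA using fun p : M => hy.2 p trivial
  obtain ⟨t, ht⟩ := isCompact_univ.elim_finite_subcover (fun p => (φ p).source)
    (fun p => (φ p).open_source) fun p _ => Set.mem_iUnion.2 ⟨p, hmem p⟩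
  let e := t.equivFin.symm
  have hcov : (Set.univ : Set M) ⊆ ⋃ i : Fin t.card, (φ (e i)).source := fun p _ => by
    obtain ⟨q, hq, hpq⟩ := Set.mem_iUnion₂.1 (ht (Set.mem_univ p))
    exact Set.mem_iUnion.2 ⟨e.symm ⟨q, hq⟩, by simpa using hpq⟩
  obtain ⟨f, hf⟩ := SmoothPartitionOfUnity.exists_isSubordinate 𝓘(ℝ, ℝ × ℝ) isClosed_univ
    (fun i : Fin t.card => (φ (e i)).source) (fun i => (φ (e i)).open_source) hcov
  exact ⟨⟨t.card, fun i => φ (e i), fun i => Y (e i), fun i => (hA (e i)).1, fun i => f i,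
    fun i => (f i).contMDiff, fun i p => f.nonneg i p, hf,
    fun p => by rw [← finsum_eq_sum_of_fintype]; exact f.sum_eq_one (Set.mem_univ p)⟩,
    fun i => hA (e i)⟩

end Integration

section Global

variable {M : Type*} [TopologicalSpace M] [ChartedSpace (ℝ × ℝ) M]
variable {E : Type*} [NormedAddCommGroup E] [NormedSpace ℝ E] [FiniteDimensional ℝ E]
variable {φ : OpenPartialHomeomorph M (ℝ × ℝ)} {p : M} {B : LinearMap.BilinForm ℝ E}
variable {y : M → Projectivization ℝ E} {Y ψ : M → E} {c ε : ℝ}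

theorem pseudoForm_comm (m s : ℕ) (x y : Fin m → ℝ) : pseudoForm m s x y = pseudoForm m s y x := by
  simp only [pseudoForm, LinearMap.mk₂_apply]
  exact Finset.sum_congr rfl fun i _ => by rw [mul_comm (x i)]

theorem coneForm_comm (hB : ∀ x y, B x y = B y x) (x y : E × ℝ) :
    coneForm B c x y = coneForm B c y x := by
  change B x.1 y.1 - c * (x.2 * y.2) = B y.1 x.1 - c * (y.2 * x.2)
  rw [hB, mul_comm x.2]

variable [IsManifold 𝓘(ℝ, ℝ × ℝ) ∞ M]

/-- At an immersed point of the polar surface, `⟨ψ, κ₁⟩` does not vanish. -/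
theorem polarCoeff_ne_zero (hψ : IsPolarTransform B c y ψ) (hB : ∀ x y, B x y = B y x)
    (hε : ε ^ 2 = 1) (himm : IsPolarImmersed c ψ) (h : IsAdaptedLift B 1 ε φ y Y)
    (hp : p ∈ φ.source) : polarCoeff B φ Y ψ p ≠ 0 := by
  intro h0
  have hP := hψ.isPolarPair hB hε h
  have hu := hP.du_eq hp
  have hv := hP.dv_eq hp
  rw [h0, mul_zero, zero_smul, sub_zero] at hu hv
  obtain ⟨w, hw0, hw⟩ : ∃ w : ℝ × ℝ, w ≠ 0 ∧ dirDeriv φ w ψ p = 0 := by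
    by_cases hm : dv φ (polarCoeff B φ Y ψ) p = 0
    · refine ⟨(1, 0), by simp, ?_⟩
      rw [← du_eq_dirDeriv, hu, hm, mul_zero, zero_smul]
    · refine ⟨(ε * du φ (polarCoeff B φ Y ψ) p, -dv φ (polarCoeff B φ Y ψ) p), by simp [hm], ?_⟩
      rw [dirDeriv_eq, hu, hv]
      module
  obtain ⟨X, hX0, hX⟩ := exists_tangent (E := E) h.1.chart hp w
  have hX' : mfderiv 𝓘(ℝ, ℝ × ℝ) 𝓘(ℝ, E) ψ p X = 0 := (hX ψ hP.smooth).trans hw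
  by_cases hc : c = 0
  · refine hX0 hw0 ((himm.2 hc p).2 X ?_)
    rw [hX']
    exact Submodule.zero_mem _
  · exact hX0 hw0 (himm.1 hc p (hX'.trans (map_zero _).symm))

/-- Around every point of an open set there are adapted coordinates with domain in this set. -/
theorem IsIsothermicOn.exists_adapted (hy : IsIsothermicOn B ε y Set.univ) {U : Set M}
    (hU : IsOpen U) (hp : p ∈ U) : ∃ (φ : OpenPartialHomeomorph M (ℝ × ℝ)) (Y : M → E),
      p ∈ φ.source ∧ φ.source ⊆ U ∧ IsAdaptedLift B 1 ε φ y Y := by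
  obtain ⟨φ, Y, hpφ, -, h⟩ := hy.2 p trivial
  refine ⟨φ.restr U, Y, ?_, ?_, h.restr hU⟩ <;> rw [φ.restr_source' U hU]
  exacts [⟨hpφ, hp⟩, Set.inter_subset_right]

theorem IsQuadAdapted.exists_positive {x : M → E} (hε : ε = 1 ∨ ε = -1)
    (h : IsQuadAdapted B ε ε φ x) : ∃ φ' : OpenPartialHomeomorph M (ℝ × ℝ),
      φ'.source = φ.source ∧ IsQuadAdapted B 1 ε φ' x := by
  rcases hε with rfl | rfl
  · exact ⟨φ, rfl, h⟩
  · have := h.flip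
    rw [neg_neg] at this
    exact ⟨flipChart φ, rfl, this⟩

theorem IsAdaptedLift.exists_positive (hε : ε = 1 ∨ ε = -1)
    (h : IsAdaptedLift B ε ε φ y Y) : ∃ φ' : OpenPartialHomeomorph M (ℝ × ℝ),
      φ'.source = φ.source ∧ IsAdaptedLift B 1 ε φ' y Y := by
  rcases hε with rfl | rfl
  · exact ⟨φ, rfl, h⟩
  · have := h.flip
    rw [neg_neg] at this
    exact ⟨flipChart φ, rfl, this⟩

theorem IsPolarPair.isLorentzianAt (h : IsPolarPair B φ Y ψ c ε)
    (hφ : φ ∈ IsManifold.maximalAtlas 𝓘(ℝ, ℝ × ℝ) ∞ M) (hp : p ∈ φ.source)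
    (h0 : polarCoeff B φ Y ψ p ≠ 0) : IsLorentzianAt B ψ p := by
  have hn := h.isNullMap
  have hε := h.sign_ne_zero
  refine isLorentzianAt_of_null hφ hn.symm hn.smooth hp (hn.uu p hp) (hn.vv p hp) ?_
  rw [hn.uv p hp]
  positivity

variable {U : Set M}

theorem isQuadIsothermicOn_polar (hU : IsOpen U) (hε : ε = 1 ∨ ε = -1)
    (hB : ∀ x y, B x y = B y x) (hy : IsIsothermicOn B ε y Set.univ)
    (hψ : IsPolarTransform B c y ψ) (hc : c ≠ 0)
    (h0 : ∀ (φ : OpenPartialHomeomorph M (ℝ × ℝ)) (Y : M → E), IsAdaptedLift B 1 ε φ y Y →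
      φ.source ⊆ U → ∀ p ∈ φ.source, polarCoeff B φ Y ψ p ≠ 0) :
    IsQuadIsothermicOn B c ε ψ U := by
  have hε2 : ε ^ 2 = 1 := by rcases hε with rfl | rfl <;> norm_num
  refine ⟨⟨hψ.smooth.contMDiffOn, fun p hp => ⟨hψ.length p, ?_⟩⟩, fun p hp => ?_⟩
  · obtain ⟨φ, Y, hpφ, hφU, h⟩ := hy.exists_adapted hU hp
    exact (hψ.isPolarPair hB hε2 h).isLorentzianAt h.1.chart hpφ (h0 φ Y h hφU p hpφ)
  · obtain ⟨φ, Y, hpφ, hφU, h⟩ := hy.exists_adapted hU hp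
    obtain ⟨φ', hs, h'⟩ := ((hψ.isPolarPair hB hε2 h).isQuadAdapted hc h.1.chart
      (h0 φ Y h hφU)).exists_positive hε
    exact ⟨φ', hs ▸ hpφ, hs ▸ hφU, h'⟩

theorem isIsothermicOn_polar [Nontrivial E] (hU : IsOpen U) (hε : ε = 1 ∨ ε = -1)
    (hB : ∀ x y, B x y = B y x) (hy : IsIsothermicOn B ε y Set.univ)
    (hψ : IsPolarTransform B 0 y ψ)
    (h0 : ∀ (φ : OpenPartialHomeomorph M (ℝ × ℝ)) (Y : M → E), IsAdaptedLift B 1 ε φ y Y →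
      φ.source ⊆ U → ∀ p ∈ φ.source, polarCoeff B φ Y ψ p ≠ 0) :
    IsIsothermicOn B ε (fun p => proj (ψ p)) U := by
  have hε2 : ε ^ 2 = 1 := by rcases hε with rfl | rfl <;> norm_num
  have hne : ∀ p ∈ U, ψ p ≠ 0 := fun p hp => by
    obtain ⟨φ, Y, hpφ, hφU, h⟩ := hy.exists_adapted hU hp
    exact IsPolarPair.ne_zero (h0 φ Y h hφU p hpφ)
  refine ⟨fun p hp => ⟨proj_mem_projCone (hne p hp) (hψ.length p), U, ψ, hU, hp, subset_rfl,
    hψ.smooth.contMDiffOn, fun q hq => ⟨hne q hq, (proj_eq_mk (hne q hq)).symm⟩, ?_⟩,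
    fun p hp => ?_⟩
  · obtain ⟨φ, Y, hpφ, hφU, h⟩ := hy.exists_adapted hU hp
    exact (hψ.isPolarPair hB hε2 h).isLorentzianAt h.1.chart hpφ (h0 φ Y h hφU p hpφ)
  · obtain ⟨φ, Y, hpφ, hφU, h⟩ := hy.exists_adapted hU hp
    obtain ⟨φ', hs, h'⟩ := ((hψ.isPolarPair hB hε2 h).isAdaptedLift h.1.chart
      (h0 φ Y h hφU)).exists_positive hε
    exact ⟨φ', _, hs ▸ hpφ, hs ▸ hφU, h'⟩

theorem IsParallelMinimalSection.congr {x N N' : M → E} (h : IsParallelMinimalSection B φ x N)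
    (hN : ∀ p ∈ φ.source, N' p = N p) : IsParallelMinimalSection B φ x N' := by
  refine ⟨h.smooth.congr hN, fun p hp => ?_, fun p hp => ?_, fun p hp => ?_, fun p hp => ?_,
    fun p hp => ?_⟩
  · rw [hN p hp]; exact h.ne_zero p hp
  · rw [hN p hp]; exact h.normal p hp
  · rw [du_congr hN hp]; exact h.parallel_u p hp
  · rw [dv_congr hN hp]; exact h.parallel_v p hp
  · rw [hN p hp]; exact h.minimal p hp

theorem IsPolarPair.hasConformalMetric {E' : Type*} [NormedAddCommGroup E'] [NormedSpace ℝ E']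
    [FiniteDimensional ℝ E'] {B' : LinearMap.BilinForm ℝ E'} {y' : M → Projectivization ℝ E'}
    {Z : M → E'} (h : IsPolarPair B φ Y ψ c ε) (hB' : ∀ x y, B' x y = B' y x)
    (hZ : IsCanonicalLift B' ε φ y' Z)
    (hmetric : ∀ p ∈ φ.source, metricCoeff B' ε φ Z p = IsPolarPair.metric B φ Y ψ p) :
    HasConformalMetric B' ε φ y' fun p => B (kappa1 B φ Y p) (kappa2 B φ Y p) +
      dv φ (fun q => B (ψ q) (confDu B φ Y (kappa1 B φ Y) q) / B (ψ q) (kappa1 B φ Y q)) p := by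
  refine ⟨⟨Z, hZ⟩, fun Z' hZ' p hp => ?_⟩
  rw [metricCoeff_unique hB' h.sign hZ' hZ hp, hmetric p hp, IsPolarPair.metric, metricCoeff,
    one_mul]
  congr 1
  exact dv_congr (fun q hq => by rw [h.bilin_confDu_kappa1 hq, h.bilin_kappa1 hq]) hp

theorem IsPolarPair.dual (h : IsPolarPair B φ Y ψ c ε)
    (h0 : ∀ q ∈ φ.source, polarCoeff B φ Y ψ q ≠ 0) (hp : p ∈ φ.source) {N : M → E}
    (hN : ∀ q ∈ φ.source, N q = (polarCoeff B φ Y ψ q)⁻¹ • Y q) :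
    (∃ a : ℝ, a ≠ 0 ∧ du φ N p = a • dv φ ψ p) ∧ ∃ b : ℝ, b ≠ 0 ∧ dv φ N p = b • du φ ψ p := by
  have := h0 p hp
  have hε := h.sign_ne_zero
  refine ⟨⟨_, ?_, (du_congr hN hp).trans (h.du_dual h0 hp)⟩,
    ⟨_, ?_, (dv_congr hN hp).trans (h.dv_dual h0 hp)⟩⟩
  · exact div_ne_zero (neg_ne_zero.2 hε) (by positivity)
  · exact div_ne_zero (by norm_num) (by positivity)

end Global

end TimelikeSurface

end

theorem theorem3p4
    (n r : ℕ) (hr : 1 ≤ r) (hn : r + 2 ≤ n)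
    {M : Type*} [TopologicalSpace M] [T2Space M] [SecondCountableTopology M]
    [ChartedSpace (ℝ × ℝ) M] [IsManifold 𝓘(ℝ, ℝ × ℝ) ∞ M]
    (ε : ℝ) (hε : ε = 1 ∨ ε = -1) (c : ℝ)
    (B : LinearMap.BilinForm ℝ (Fin (n + 2) → ℝ))
    (hB : B = TimelikeSurface.pseudoForm (n + 2) (r + 1))
    (y : M → Projectivization ℝ (Fin (n + 2) → ℝ))
    (hy : TimelikeSurface.IsIsothermicOn B ε y Set.univ)
    (ψ : M → (Fin (n + 2) → ℝ))
    (hψ : TimelikeSurface.IsPolarTransform B c y ψ) :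
    (∀ M₀ : Set M, IsOpen M₀ → Dense M₀ →
      (∀ (φ : OpenPartialHomeomorph M (ℝ × ℝ)) (Y : M → (Fin (n + 2) → ℝ)),
        TimelikeSurface.IsAdaptedLift B 1 ε φ y Y →
        ∀ p ∈ φ.source ∩ M₀, B (ψ p) (TimelikeSurface.kappa1 B φ Y p) ≠ 0) →
      -- the polar surface is timelike `(±)`-isothermic
      (c ≠ 0 → TimelikeSurface.IsQuadIsothermicOn B c ε ψ M₀) ∧
      (c = 0 → TimelikeSurface.IsIsothermicOn B ε (fun p => TimelikeSurface.proj (ψ p)) M₀) ∧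
      ∀ (φ : OpenPartialHomeomorph M (ℝ × ℝ)) (Y : M → (Fin (n + 2) → ℝ)),
        TimelikeSurface.IsAdaptedLift B 1 ε φ y Y → φ.source ⊆ M₀ →
        -- it has the same adapted coordinates
        (c ≠ 0 → TimelikeSurface.IsQuadAdapted B ε ε φ ψ) ∧
        (c = 0 → ∃ Z, TimelikeSurface.IsAdaptedLift B ε ε φ
          (fun p => TimelikeSurface.proj (ψ p)) Z) ∧
        -- the dual lift `Y / ⟨ψ, κ₁⟩`
        (∀ Yψ : M → (Fin (n + 2) → ℝ),
          Yψ = (fun p => (B (ψ p) (TimelikeSurface.kappa1 B φ Y p))⁻¹ • Y p) →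
          TimelikeSurface.IsLiftOn y Yψ φ.source ∧
          (∀ p ∈ φ.source,
            (∃ a : ℝ, a ≠ 0 ∧ TimelikeSurface.du φ Yψ p = a • TimelikeSurface.dv φ ψ p) ∧
            (∃ b : ℝ, b ≠ 0 ∧ TimelikeSurface.dv φ Yψ p = b • TimelikeSurface.du φ ψ p)) ∧
          -- it is a parallel minimal section of the polar surface
          (c ≠ 0 → TimelikeSurface.IsParallelMinimalSection B φ ψ Yψ) ∧
          (c = 0 → ∀ p ∈ φ.source,
            Yψ p ∈ B.orthogonal (TimelikeSurface.confTangent φ ψ p) ∧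
            TimelikeSurface.confDu B φ ψ Yψ p = 0 ∧ TimelikeSurface.confDv B φ ψ Yψ p = 0)) ∧
        -- the conformal metric of the polar surface
        (∀ g : M → ℝ,
          g = (fun p => B (TimelikeSurface.kappa1 B φ Y p) (TimelikeSurface.kappa2 B φ Y p) +
            TimelikeSurface.dv φ (fun q =>
              B (ψ q) (TimelikeSurface.confDu B φ Y (TimelikeSurface.kappa1 B φ Y) q) /
                B (ψ q) (TimelikeSurface.kappa1 B φ Y q)) p) →
          (c ≠ 0 → TimelikeSurface.HasConformalMetric (TimelikeSurface.coneForm B c) ε φ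
            (fun p => TimelikeSurface.proj (ψ p, (1 : ℝ))) g) ∧
          (c = 0 → TimelikeSurface.HasConformalMetric B ε φ
            (fun p => TimelikeSurface.proj (ψ p)) g))) ∧
    -- the Willmore functional on a closed surface
    (CompactSpace M → TimelikeSurface.IsPolarImmersed c ψ →
      ∃ w : ℝ, TimelikeSurface.HasWillmore B 1 y w ∧
        (c ≠ 0 → TimelikeSurface.HasWillmore (TimelikeSurface.coneForm B c) ε
          (fun p => TimelikeSurface.proj (ψ p, (1 : ℝ))) w) ∧
        (c = 0 → TimelikeSurface.HasWillmore B ε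
          (fun p => TimelikeSurface.proj (ψ p)) w)) := by
  have hBs : ∀ x y, B x y = B y x := by
    rw [hB]
    exact TimelikeSurface.pseudoForm_comm _ _
  have hBc : ∀ x y, TimelikeSurface.coneForm B c x y = TimelikeSurface.coneForm B c y x :=
    TimelikeSurface.coneForm_comm hBs
  have hε2 : ε ^ 2 = 1 := by rcases hε with rfl | rfl <;> norm_num
  clear hB
  refine ⟨fun M₀ hM₀ _ hne => ?_, fun hcpt himm => ?_⟩
  · have h0 : ∀ (φ : OpenPartialHomeomorph M (ℝ × ℝ)) (Y : M → (Fin (n + 2) → ℝ)),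
        TimelikeSurface.IsAdaptedLift B 1 ε φ y Y → φ.source ⊆ M₀ →
        ∀ p ∈ φ.source, TimelikeSurface.polarCoeff B φ Y ψ p ≠ 0 := fun φ Y h hs p hp => by
      rw [← (hψ.isPolarPair hBs hε2 h).bilin_kappa1 hp]
      exact hne φ Y h p ⟨hp, hs hp⟩
    refine ⟨fun hc => TimelikeSurface.isQuadIsothermicOn_polar hM₀ hε hBs hy hψ hc h0, ?_, ?_⟩
    · rintro rfl
      exact TimelikeSurface.isIsothermicOn_polar hM₀ hε hBs hy hψ h0
    intro φ Y h hs
    have hφ := h.1.chart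
    have hP := hψ.isPolarPair hBs hε2 h
    have hm := h0 φ Y h hs
    have hY : ∀ p ∈ φ.source, Y p ≠ 0 := fun p hp => (h.1.lift p hp).1
    refine ⟨fun hc => hP.isQuadAdapted hc hφ hm, ?_, ?_, ?_⟩
    · rintro rfl
      exact ⟨_, hP.isAdaptedLift hφ hm⟩
    · rintro Yψ rfl
      have hN : ∀ q ∈ φ.source, (B (ψ q) (TimelikeSurface.kappa1 B φ Y q))⁻¹ • Y q =
          (TimelikeSurface.polarCoeff B φ Y ψ q)⁻¹ • Y q := fun q hq => by
        rw [hP.bilin_kappa1 hq]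
      refine ⟨fun p hp => ?_, fun p hp => hP.dual hm hp hN,
        fun hc => (hP.isParallelMinimalSection hc hφ hm hY).congr hN, ?_⟩
      · have hne0 : (B (ψ p) (TimelikeSurface.kappa1 B φ Y p))⁻¹ ≠ 0 := by
          rw [hP.bilin_kappa1 hp]
          exact inv_ne_zero (hm p hp)
        refine ⟨smul_ne_zero hne0 (hY p hp), ?_⟩
        obtain ⟨h1, h2⟩ := h.1.lift p hp
        rw [← h2, Projectivization.mk_eq_mk_iff']
        exact ⟨_, rfl⟩
      · rintro rfl p hp
        obtain ⟨h1, h2, h3⟩ := hP.conformal_parallel hm hp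
        refine ⟨by simp only [hN p hp]; exact h1, ?_, ?_⟩
        · rw [TimelikeSurface.confDu, TimelikeSurface.du_congr hN hp]
          exact h2
        · rw [TimelikeSurface.confDv, TimelikeSurface.dv_congr hN hp]
          exact h3
    · rintro g rfl
      refine ⟨fun _ => hP.hasConformalMetric hBc (hP.isCanonicalLift_cone hφ hm)
        fun p hp => hP.metricCoeff_cone hm hp, ?_⟩
      rintro rfl
      exact hP.hasConformalMetric hBs (hP.isCanonicalLift hφ hm)
        fun p hp => hP.metricCoeff_lift hm hp
  · obtain ⟨P, hPA⟩ := TimelikeSurface.exists_adapted_partition hy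
    have h0 : ∀ i, ∀ q ∈ (P.φ i).source,
        TimelikeSurface.polarCoeff B (P.φ i) (P.Y i) ψ q ≠ 0 := fun i q hq =>
      TimelikeSurface.polarCoeff_ne_zero hψ hBs hε2 himm (hPA i) hq
    have hP := fun i => hψ.isPolarPair hBs hε2 (hPA i)
    refine ⟨P.energy, ⟨⟨P⟩, fun Q => Q.energy_eq hBs (by norm_num) P⟩, fun _ => ?_, ?_⟩
    · exact TimelikeSurface.hasWillmore_of_metric hBs hBc hε2 hψ P hPA h0 _
        (fun i => (hP i).isCanonicalLift_cone (hPA i).1.chart (h0 i))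
        fun i p hp => (hP i).metricCoeff_cone (h0 i) hp
    · rintro rfl
      exact TimelikeSurface.hasWillmore_of_metric hBs hBs hε2 hψ P hPA h0 _
        (fun i => (hP i).isCanonicalLift (hPA i).1.chart (h0 i))
        fun i p hp => (hP i).metricCoeff_lift (h0 i) hp
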